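/- Let $N\ge 2$, $L\ge 1$, $\varepsilon=e^{2\pi i/N}$, $\mathfrak g=\mathfrak{sl}_N(\mathbb C)$ with $(A|B)=\operatorname{tr}(AB)$, and let $\mathfrak h\subset\mathfrak g$ be the traceless diagonal matrices. Let $\beta$ be the cyclic shift matrix ($\beta_{i,i+1}=1$ for $1\le i<N$, $\beta_{N,1}=1$, all other entries $0$) and $\gamma=\operatorname{diag}(1,\varepsilon^{-1},\dots,\varepsilon^{1-N})$. Let $t_1,\dots,t_L\in\mathbb C\setminus\{0\}$ satisfy $t_i\ne\varepsilon^a t_j$ for all $i\neq j$ and all integers $a$. *Lie algebras.* Let $\hat{\mathfrak g}^{Q_i}=\mathfrak g((t-t_i))\oplus\mathbb C\hat k$ with $\hat k$ central and $[A,B]=[A,B]^\circ+\operatorname{Res}_{t=t_i}(dA|B)\,\hat k$, where $[\cdot,\cdot]^\circ$ is the pointwise bracket, and let $\hat{\mathfrak g}^{Q_i}_+=\mathfrak g[[t-t_i]]\oplus\mathbb C\hat k$. Let $\hat{\mathfrak g}^{(0)}=\{A\in\mathfrak g((t)) : A(\varepsilon t)=\operatorname{Ad}\gamma\,(A(t))\}\oplus\mathbb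 C\hat k$ and $\hat{\mathfrak g}^{(\infty)}=\{A\in\mathfrak g((t^{-1})) : A(\varepsilon t)=\operatorname{Ad}\gamma\,(A(t))\}\oplus\mathbb C\hat k$, with $\hat k$ central and cocycles $\tfrac1N\operatorname{Res}_{t=0}(dA|B)$ and $\tfrac1N\operatorname{Res}_{t=\infty}(dA|B)$ respectively. For $\lambda\in\mathfrak h^*$ and $k\in\mathbb C$, the Verma module $M_\lambda$ of level $k$ over $\hat{\mathfrak g}^{(0)}$ (resp. $\hat{\mathfrak g}^{(\infty)}$) is the quotient of the universal enveloping algebra by the left ideal generated by the series with only strictly positive powers of $t$ (resp. of $t^{-1}$), by $H-\lambda(H)$ for $H\in\mathfrak h$ (constant series), and by $\hat k-k$. *Coinvariants.* Let $\mathfrak g^{\mathrm{trig}}_{\mathrm{out}}$ be the space of $\mathfrak g$-valued rational functions $f$ on $\mathbb P^1$ with $f(\varepsilon t)=\operatorname{Ad}\gamma\,(f(t))$, holomorphic outside $\{\varepsilon^a t_i\}$, with $f(\infty)=\operatorname{Ad}\beta\,(f(0))$. Let $\mathfrak g^{\mathrm{orb}}_{\mathrm{out}}$ be the space of $\mathfrak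 g$-valued rational functions $f$ with $f(\varepsilon t)=\operatorname{Ad}\gamma\,(f(t))$, holomorphic outside $\{\varepsilon^a t_i\}\cup\{0,\infty\}$. For $\hat{\mathfrak g}^{Q_i}$-modules $M_i$ of the same level $k$ (that is, $\hat k$ acts as $k$) and $M=M_1\otimes\cdots\otimes M_L$, put $CC_{\mathrm{trig}}(M)=M/\mathfrak g^{\mathrm{trig}}_{\mathrm{out}}M$. For level-$k$ modules $M_0$ over $\hat{\mathfrak g}^{(0)}$ and $M_\infty$ over $\hat{\mathfrak g}^{(\infty)}$, put $CC_{\mathrm{orb}}(M_0\otimes M\otimes M_\infty)=(M_0\otimes M\otimes M_\infty)/\mathfrak g^{\mathrm{orb}}_{\mathrm{out}}(M_0\otimes M\otimes M_\infty)$. Here $f$ acts as the sum, over the tensor factors, of the actions of its Laurent expansions at $t_i$, and at $0$ and $\infty$ in the second case. *Theorem.* Let $k\in\mathbb C$, let $M_i$ be a $\hat{\mathfrak g}^{Q_i}$-module of level $k$ ($i=1,\dots,L$), and let $V_i\subset M_i$ be a finite-dimensional subspace with $\hat{\mathfrak g}^{Q_i}_+V_i\subset V_i$ that generates $M_i$ over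 $\hat{\mathfrak g}^{Q_i}$. Let $M=M_1\otimes\cdots\otimes M_L$, and let $\operatorname{wt}(V)\subset\mathfrak h^*$ be the set of weights of the $\mathfrak g$-module $V=V_1\otimes\cdots\otimes V_L$, where $\mathfrak g$ acts on each $V_i$ by constant series. For $\lambda\in\mathfrak h^*$ put $$\tilde\lambda=-\lambda\circ(1-\operatorname{Ad}\beta^{-1})^{-1},\qquad \tilde\lambda'=-\lambda\circ(1-\operatorname{Ad}\beta)^{-1},$$ where $1-\operatorname{Ad}\beta^{\pm1}$ is invertible on $\mathfrak h$. Then $\operatorname{wt}(V)$ is finite, $CC_{\mathrm{trig}}(M)$ is finite-dimensional, and there is a linear isomorphism $$CC_{\mathrm{trig}}(M)\;\cong\;\bigoplus_{\lambda\in\operatorname{wt}(V)}CC_{\mathrm{orb}}\bigl(M_{\tilde\lambda}\otimes M\otimes M_{\tilde\lambda'}\bigr),$$ where the Verma modules $M_{\tilde\lambda}$ and $M_{\tilde\lambda'}$ of level $k$ are inserted at $0$ and $\infty$ respectively. -/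

import Mathlib

open scoped TensorProduct

noncomputable section

namespace TrigWZW

attribute [local instance 100] LieRing.ofAssociativeRing

/-- Laurent series as a complex algebra, through constant series. -/
instance (priority := 2000) laurentAlgebra : Algebra ℂ (LaurentSeries ℂ) :=
  HahnSeries.instAlgebra

/-! ### Matrices -/

/-- `N × N` matrices with entries in `R`. -/
abbrev Mat (N : ℕ) (R : Type*) : Type _ := Matrix (Fin N) (Fin N) R

/-- The primitive root of unity `ε = exp (2πi / N)`. -/
def eps (N : ℕ) : ℂˣ :=
  Units.mk0 (Complex.exp (2 * Real.pi * Complex.I / N)) (Complex.exp_ne_zero _)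

/-- The cyclic shift `β`: `β i j = 1` if `j = i + 1` modulo `N`, and `0` otherwise. -/
def betaMat (N : ℕ) : Mat N ℂ := fun i j => if j = finRotate N i then 1 else 0

theorem betaMat_mul_transpose (N : ℕ) : betaMat N * (betaMat N).transpose = 1 := by
  ext i j
  simp [Matrix.mul_apply, betaMat, Matrix.one_apply, -finRotate_apply, eq_comm]

/-- `β` as an invertible matrix. -/
def beta (N : ℕ) : (Mat N ℂ)ˣ where
  val := betaMat N
  inv := (betaMat N).transpose
  val_inv := betaMat_mul_transpose N
  inv_val := mul_eq_one_comm.mp (betaMat_mul_transpose N)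

/-- The matrix `γ = diag (1, ε⁻¹, …, ε^(1-N))`, as an invertible matrix. -/
def gamma (N : ℕ) : (Mat N ℂ)ˣ where
  val := Matrix.diagonal fun i => (((eps N)⁻¹ ^ (i : ℕ) : ℂˣ) : ℂ)
  inv := Matrix.diagonal fun i => ((eps N ^ (i : ℕ) : ℂˣ) : ℂ)
  val_inv := by
    rw [Matrix.diagonal_mul_diagonal, ← Matrix.diagonal_one]
    congr 1; ext i; rw [← Units.val_mul, inv_pow, inv_mul_cancel, Units.val_one]
  inv_val := by
    rw [Matrix.diagonal_mul_diagonal, ← Matrix.diagonal_one]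
    congr 1; ext i; rw [← Units.val_mul, inv_pow, mul_inv_cancel, Units.val_one]

section Ad

variable {N : ℕ} {R : Type*} [CommRing R] [Algebra ℂ R]

/-- The image of an invertible complex matrix in the invertible `R`-matrices. -/
def toR (R : Type*) [CommRing R] [Algebra ℂ R] (g : (Mat N ℂ)ˣ) : (Mat N R)ˣ :=
  Units.map ((Algebra.ofId ℂ R).mapMatrix : Mat N ℂ →ₐ[ℂ] Mat N R).toMonoidHom g

theorem toR_inv (g : (Mat N ℂ)ˣ) : (toR R g)⁻¹ = toR R g⁻¹ := (map_inv _ g).symm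

/-- `Ad g A = g A g⁻¹`, for a constant invertible matrix `g` and an `R`-valued matrix `A`. -/
def Ad (R : Type*) [CommRing R] [Algebra ℂ R] (g : (Mat N ℂ)ˣ) : Mat N R →ₐ[ℂ] Mat N R where
  toFun A := (toR R g : Mat N R) * A * ((toR R g)⁻¹ : (Mat N R)ˣ)
  map_one' := by simp
  map_mul' A B := by simp [mul_assoc]
  map_zero' := by simp
  map_add' A B := by simp [mul_add, add_mul]
  commutes' r := by
    rw [← Algebra.commutes, mul_assoc, Units.mul_inv, mul_one]

/-- `sl_N (R)` as a complex Lie algebra. -/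
def sl (N : ℕ) (R : Type*) [CommRing R] [Algebra ℂ R] : LieSubalgebra ℂ (Mat N R) where
  carrier := {A | A.trace = 0}
  add_mem' {A B} hA hB := by
    simp only [Set.mem_ofPred_eq] at *; rw [Matrix.trace_add, hA, hB, add_zero]
  zero_mem' := by simp
  smul_mem' c A hA := by
    simp only [Set.mem_ofPred_eq] at *; rw [Matrix.trace_smul, hA, smul_zero]
  lie_mem' {A B} _ _ := by
    change (A * B - B * A).trace = 0
    rw [Matrix.trace_sub, Matrix.trace_mul_comm, sub_self]

theorem Ad_map {S : Type*} [CommRing S] [Algebra ℂ S] (φ : R →ₐ[ℂ] S) (g : (Mat N ℂ)ˣ)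
    (A : Mat N R) : Ad S g (φ.mapMatrix A) = φ.mapMatrix (Ad R g A) := by
  have h : ∀ u : (Mat N ℂ)ˣ, ((toR S u : (Mat N S)ˣ) : Mat N S) =
      φ.mapMatrix ((toR R u : (Mat N R)ˣ) : Mat N R) := by
    intro u
    ext i j
    exact (φ.commutes ((u : Mat N ℂ) i j)).symm
  change (toR S g : Mat N S) * φ.mapMatrix A * (((toR S g)⁻¹ : (Mat N S)ˣ) : Mat N S) =
    φ.mapMatrix ((toR R g : Mat N R) * A * (((toR R g)⁻¹ : (Mat N R)ˣ) : Mat N R))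
  rw [map_mul, map_mul, ← h, toR_inv, toR_inv, ← h]

theorem map_mem_sl {S : Type*} [CommRing S] [Algebra ℂ S] (φ : R →ₐ[ℂ] S) {A : Mat N R}
    (hA : A ∈ sl N R) : A.map φ ∈ sl N S := by
  change (A.map φ).trace = 0
  have h : A.trace = 0 := hA
  have := congrArg φ h
  simpa [Matrix.trace] using this

end Ad

/-! ### The Cartan subalgebra -/

/-- The Cartan subalgebra of `sl_N (ℂ)`: traceless diagonal matrices. -/
def cartan (N : ℕ) : Submodule ℂ (Mat N ℂ) where
  carrier := {H | H.IsDiag ∧ H.trace = 0}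
  add_mem' {A B} hA hB := ⟨hA.1.add hB.1, by rw [Matrix.trace_add, hA.2, hB.2, add_zero]⟩
  zero_mem' := ⟨Matrix.isDiag_zero, Matrix.trace_zero _ _⟩
  smul_mem' c A hA := ⟨hA.1.smul c, by rw [Matrix.trace_smul, hA.2, smul_zero]⟩

theorem Ad_apply_complex {N : ℕ} (g : (Mat N ℂ)ˣ) (A : Mat N ℂ) :
    Ad ℂ g A = (g : Mat N ℂ) * A * ((g⁻¹ : (Mat N ℂ)ˣ) : Mat N ℂ) := by
  have h : toR ℂ g = g := by
    ext i j
    simp [toR]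
  change (toR ℂ g : Mat N ℂ) * A * ((toR ℂ g)⁻¹ : (Mat N ℂ)ˣ) = _
  rw [h]

theorem Ad_beta_apply (N : ℕ) (A : Mat N ℂ) (i j : Fin N) :
    Ad ℂ (beta N) A i j = A (finRotate N i) (finRotate N j) := by
  rw [Ad_apply_complex]
  change (betaMat N * A * (betaMat N).transpose) i j = _
  simp [Matrix.mul_apply, betaMat, -finRotate_apply]

theorem Ad_beta_inv_apply (N : ℕ) (A : Mat N ℂ) (i j : Fin N) :
    Ad ℂ (beta N)⁻¹ A i j = A ((finRotate N).symm i) ((finRotate N).symm j) := by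
  rw [Ad_apply_complex, inv_inv]
  change ((betaMat N).transpose * A * betaMat N) i j = _
  simp [Matrix.mul_apply, betaMat, -finRotate_apply, ← Equiv.symm_apply_eq]

/-- `Ad β` restricted to the Cartan subalgebra. -/
def adBeta (N : ℕ) : cartan N →ₗ[ℂ] cartan N :=
  (Ad ℂ (beta N)).toLinearMap.restrict (p := cartan N) (q := cartan N) fun H hH => by
    refine ⟨fun i j hij => ?_, ?_⟩
    · exact (Ad_beta_apply N H i j).trans (hH.1 fun h => hij ((finRotate N).injective h))
    · rw [← hH.2]
      simp only [Matrix.trace, Matrix.diag_apply, AlgHom.toLinearMap_apply, Ad_beta_apply]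
      exact Equiv.sum_comp (finRotate N) fun i => H i i

/-- `Ad β⁻¹` restricted to the Cartan subalgebra. -/
def adBetaInv (N : ℕ) : cartan N →ₗ[ℂ] cartan N :=
  (Ad ℂ (beta N)⁻¹).toLinearMap.restrict (p := cartan N) (q := cartan N) fun H hH => by
    refine ⟨fun i j hij => ?_, ?_⟩
    · exact (Ad_beta_inv_apply N H i j).trans
        (hH.1 fun h => hij ((finRotate N).symm.injective h))
    · rw [← hH.2]
      simp only [Matrix.trace, Matrix.diag_apply, AlgHom.toLinearMap_apply, Ad_beta_inv_apply]
      exact Equiv.sum_comp (finRotate N).symm fun i => H i i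

theorem cartan_eq_zero {N : ℕ} (H : cartan N)
    (h : ∀ i, (H : Mat N ℂ) (finRotate N i) (finRotate N i) = (H : Mat N ℂ) i i) : H = 0 := by
  obtain ⟨A, hd, ht⟩ := H
  simp only at h
  have hN : ∀ i j : Fin N, A i i = A j j := by
    rcases N with _ | n
    · exact fun i => i.elim0
    · have h0 : ∀ i : Fin (n + 1), A i i = A 0 0 := by
        intro i
        induction i using Fin.induction with
        | zero => rfl
        | succ i ih =>
          rw [← ih, ← h i.castSucc, finRotate_apply, Fin.coeSucc_eq_succ]
      exact fun i j => (h0 i).trans (h0 j).symm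
  apply Subtype.ext
  ext i j
  change A i j = 0
  by_cases hij : i = j
  · subst hij
    have h1 : (N : ℂ) * A i i = 0 := by
      rw [← ht]
      simp only [Matrix.trace, Matrix.diag_apply]
      rw [Finset.sum_congr rfl fun j _ => hN j i]
      simp
    have h2 : (N : ℂ) ≠ 0 := by
      have := i.pos
      exact_mod_cast this.ne'
    exact (mul_eq_zero.mp h1).resolve_left h2
  · exact hd hij

/-- `1 - Ad β` is invertible on the Cartan subalgebra. -/
def oneSubAdBeta (N : ℕ) : cartan N ≃ₗ[ℂ] cartan N :=
  LinearEquiv.ofInjectiveEndo (LinearMap.id - adBeta N) <| by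
    rw [← LinearMap.ker_eq_bot, LinearMap.ker_eq_bot']
    intro H hH
    refine cartan_eq_zero H fun i => ?_
    have h1 : adBeta N H = H := (sub_eq_zero.mp hH).symm
    have h2 := congrArg (fun K : cartan N => (K : Mat N ℂ) i i) h1
    exact (Ad_beta_apply N H i i).symm.trans h2

/-- `1 - Ad β⁻¹` is invertible on the Cartan subalgebra. -/
def oneSubAdBetaInv (N : ℕ) : cartan N ≃ₗ[ℂ] cartan N :=
  LinearEquiv.ofInjectiveEndo (LinearMap.id - adBetaInv N) <| by
    rw [← LinearMap.ker_eq_bot, LinearMap.ker_eq_bot']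
    intro H hH
    refine cartan_eq_zero H fun i => ?_
    have h1 : adBetaInv N H = H := (sub_eq_zero.mp hH).symm
    have h2 := congrArg (fun K : cartan N => (K : Mat N ℂ) (finRotate N i) (finRotate N i)) h1
    have h3 := (Ad_beta_inv_apply N H (finRotate N i) (finRotate N i)).symm.trans h2
    simpa [-finRotate_apply] using h3.symm

/-- `λ̃ = - λ ∘ (1 - Ad β⁻¹)⁻¹`. -/
def tildeWt {N : ℕ} (lam : Module.Dual ℂ (cartan N)) : Module.Dual ℂ (cartan N) :=
  -(lam ∘ₗ (oneSubAdBetaInv N).symm.toLinearMap)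

/-- `λ̃' = - λ ∘ (1 - Ad β)⁻¹`. -/
def tildeWt' {N : ℕ} (lam : Module.Dual ℂ (cartan N)) : Module.Dual ℂ (cartan N) :=
  -(lam ∘ₗ (oneSubAdBeta N).symm.toLinearMap)

/-! ### Laurent series -/

/-- Regular Laurent series (no negative powers). -/
def regular : Subalgebra ℂ (LaurentSeries ℂ) where
  carrier := {f | ∀ n < 0, f.coeff n = 0}
  add_mem' {f g} hf hg n hn := by
    rw [HahnSeries.coeff_add, hf n hn, hg n hn, add_zero]
  mul_mem' {f g} hf hg n hn := by
    rw [HahnSeries.coeff_mul]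
    refine Finset.sum_eq_zero fun p hp => ?_
    rw [Finset.mem_antidiagonal] at hp
    by_cases h : p.1 < 0
    · rw [hf _ h, zero_mul]
    · rw [hg _ (by omega), mul_zero]
  algebraMap_mem' r n hn := by
    rw [HahnSeries.algebraMap_apply, HahnSeries.C_apply]
    exact HahnSeries.coeff_single_of_ne hn.ne

theorem regular_coeff_zero_mul {f g : LaurentSeries ℂ} (hf : f ∈ regular) (hg : g ∈ regular) :
    (f * g).coeff 0 = f.coeff 0 * g.coeff 0 := by
  rw [HahnSeries.coeff_mul]
  rw [Finset.sum_eq_single (0, 0)]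
  · intro p hp hne
    rw [Finset.mem_antidiagonal] at hp
    by_cases h : p.1 < 0
    · rw [hf _ h, zero_mul]
    · by_cases h' : p.2 < 0
      · rw [hg _ h', mul_zero]
      · exact absurd (Prod.ext (by simp; omega) (by simp; omega)) hne
  · intro h
    by_contra hne
    apply h
    rw [Finset.mem_antidiagonal]
    exact ⟨left_ne_zero_of_mul hne, right_ne_zero_of_mul hne, by simp⟩

/-- The substitution `f(X) ↦ f(ζ X)` of Laurent series. -/
def scale (z : ℂˣ) : LaurentSeries ℂ →ₐ[ℂ] LaurentSeries ℂ where
  toFun f :=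
    { coeff := fun n => ((z ^ n : ℂˣ) : ℂ) * f.coeff n
      isPWO_support' := f.isPWO_support.mono fun _ hn => right_ne_zero_of_mul hn }
  map_one' := by
    ext n
    by_cases h : n = 0 <;> simp [h, HahnSeries.coeff_one]
  map_zero' := by ext n; simp
  map_add' f g := by ext n; simp [mul_add]
  map_mul' f g := by
    ext n
    have hs : ∀ h : LaurentSeries ℂ,
        (HahnSeries.mk (fun n => ((z ^ n : ℂˣ) : ℂ) * h.coeff n)
          (h.isPWO_support.mono fun _ hn => right_ne_zero_of_mul hn) :
            LaurentSeries ℂ).support = h.support := by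
      intro h
      ext n
      simp [-Units.val_zpow_eq_zpow_val]
    rw [HahnSeries.coeff_mul]
    simp only [hs]
    rw [HahnSeries.coeff_mul, Finset.mul_sum]
    refine Finset.sum_congr rfl fun p hp => ?_
    rw [Finset.mem_antidiagonal] at hp
    rw [← hp.2.2, zpow_add, Units.val_mul]
    ring
  commutes' r := by
    ext n
    by_cases h : n = 0
    · subst h; simp
    · simp [HahnSeries.algebraMap_apply, HahnSeries.C_apply, HahnSeries.coeff_single_of_ne h]

/-- The residue of `f dX`. -/
def res : LaurentSeries ℂ →ₗ[ℂ] ℂ where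
  toFun f := f.coeff (-1)
  map_add' _ _ := HahnSeries.coeff_add
  map_smul' _ _ := HahnSeries.coeff_smul ..

/-- The derivative of a Laurent series. -/
abbrev D : LaurentSeries ℂ →ₗ[ℂ] LaurentSeries ℂ := LaurentSeries.derivative ℂ

theorem coeff_D (f : LaurentSeries ℂ) (n : ℤ) :
    (D f).coeff n = ((n : ℂ) + 1) * f.coeff (n + 1) := by
  change (LaurentSeries.derivative ℂ f).coeff n = _
  rw [LaurentSeries.derivative_apply, LaurentSeries.hasseDeriv_coeff]
  simp

theorem res_D (f : LaurentSeries ℂ) : res (D f) = 0 := by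
  change (D f).coeff (-1) = 0
  rw [coeff_D]; simp

/-- The Euler operator, used only to prove the Leibniz rule. -/
def euler (f : LaurentSeries ℂ) : LaurentSeries ℂ where
  coeff := fun n => (n : ℂ) * f.coeff n
  isPWO_support' := f.isPWO_support.mono fun _ hn => right_ne_zero_of_mul hn

theorem euler_support (f : LaurentSeries ℂ) : (euler f).support ⊆ f.support :=
  fun _ hn => right_ne_zero_of_mul hn

theorem euler_mul (f g : LaurentSeries ℂ) : euler (f * g) = euler f * g + f * euler g := by
  ext n
  rw [HahnSeries.coeff_add,
    HahnSeries.coeff_mul_left' f.isPWO_support (euler_support f),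
    HahnSeries.coeff_mul_right' g.isPWO_support (euler_support g), ← Finset.sum_add_distrib]
  change (n : ℂ) * (f * g).coeff n = _
  rw [HahnSeries.coeff_mul, Finset.mul_sum]
  refine Finset.sum_congr rfl fun p hp => ?_
  rw [Finset.mem_antidiagonal] at hp
  change _ = ((p.1 : ℂ) * f.coeff p.1) * g.coeff p.2 + f.coeff p.1 * ((p.2 : ℂ) * g.coeff p.2)
  rw [← hp.2.2]
  push_cast
  ring

theorem euler_eq (f : LaurentSeries ℂ) : D f = HahnSeries.single (-1) 1 * euler f := by
  ext n
  rw [coeff_D]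
  have h := HahnSeries.coeff_single_mul_add (r := (1 : ℂ)) (x := euler f) (a := n + 1) (b := -1)
  rw [add_neg_cancel_right] at h
  rw [h, one_mul]
  change _ = ((n + 1 : ℤ) : ℂ) * _
  push_cast
  rfl

theorem D_mul (f g : LaurentSeries ℂ) : D (f * g) = D f * g + f * D g := by
  rw [euler_eq, euler_eq, euler_eq, euler_mul]
  ring

/-! ### Loop algebras and their central extensions -/

section Loop

variable {N : ℕ}

/-- The entrywise derivative of a matrix of Laurent series. -/
def matD (A : Mat N (LaurentSeries ℂ)) : Mat N (LaurentSeries ℂ) := A.map D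

theorem matD_mul (A B : Mat N (LaurentSeries ℂ)) : matD (A * B) = matD A * B + A * matD B := by
  ext1 i j
  simp only [matD, Matrix.map_apply, Matrix.mul_apply, Matrix.add_apply, map_sum, D_mul,
    Finset.sum_add_distrib]

theorem matD_sub (A B : Mat N (LaurentSeries ℂ)) : matD (A - B) = matD A - matD B := by
  ext1 i j
  simp [matD]

theorem res_trace_matD (A : Mat N (LaurentSeries ℂ)) : res (matD A).trace = 0 := by
  have : (matD A).trace = D A.trace := by simp [matD, Matrix.trace]
  rw [this, res_D]

/-- The bilinear form `(A, B) ↦ c · Res (dA | B)`, where `(A | B) = tr (A B)`. -/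
def cocycle (c : ℂ) (A B : Mat N (LaurentSeries ℂ)) : ℂ := c * res (matD A * B).trace

theorem cocycle_add_left (c : ℂ) (A B C : Mat N (LaurentSeries ℂ)) :
    cocycle c (A + B) C = cocycle c A C + cocycle c B C := by
  have : matD (A + B) = matD A + matD B := by ext1 i j; simp [matD]
  simp [cocycle, this, add_mul, mul_add]

theorem cocycle_add_right (c : ℂ) (A B C : Mat N (LaurentSeries ℂ)) :
    cocycle c A (B + C) = cocycle c A B + cocycle c A C := by
  simp [cocycle, mul_add]

theorem cocycle_smul_right (c r : ℂ) (A B : Mat N (LaurentSeries ℂ)) :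
    cocycle c A (r • B) = r * cocycle c A B := by
  have h : matD A * r • B = r • (matD A * B) := Algebra.mul_smul_comm _ _ _
  rw [cocycle, cocycle, h, Matrix.trace_smul, map_smul, smul_eq_mul, mul_left_comm]

theorem cocycle_swap (c : ℂ) (A B : Mat N (LaurentSeries ℂ)) :
    cocycle c A B = -cocycle c B A := by
  have h := res_trace_matD (A * B)
  rw [matD_mul, Matrix.trace_add, map_add, Matrix.trace_mul_comm A] at h
  rw [cocycle, cocycle, eq_neg_of_add_eq_zero_left h, mul_neg]

theorem cocycle_self (c : ℂ) (A : Mat N (LaurentSeries ℂ)) : cocycle c A A = 0 :=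
  self_eq_neg.mp (cocycle_swap c A A)

theorem cocycle_jacobi (c : ℂ) (A B C : Mat N (LaurentSeries ℂ)) :
    cocycle c A ⁅B, C⁆ = cocycle c ⁅A, B⁆ C + cocycle c B ⁅A, C⁆ := by
  simp only [LieRing.of_associative_ring_bracket, cocycle, matD_sub, matD_mul, ← mul_add,
    ← map_add]
  rw [← sub_eq_zero, ← mul_sub, ← map_sub]
  have h1 : (B * matD A * C).trace = (matD A * C * B).trace := by
    rw [mul_assoc, Matrix.trace_mul_comm]
  have h2 : (matD B * C * A).trace = (A * matD B * C).trace := by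
    rw [Matrix.trace_mul_comm, mul_assoc]
  have e : (matD A * (B * C - C * B) -
      ((matD A * B + A * matD B - (matD B * A + B * matD A)) * C +
        matD B * (A * C - C * A))).trace = 0 := by
    simp only [mul_sub, sub_mul, add_mul, Matrix.trace_sub, Matrix.trace_add, ← mul_assoc, h1, h2]
    ring
  rw [← Matrix.trace_add, ← Matrix.trace_sub, e, map_zero, mul_zero]

/-- The central extension `K ⊕ ℂ k̂` of a Lie algebra `K` of matrices of Laurent series, with
bracket `[A, B] = [A, B]° ⊕ c · Res (dA | B) k̂`. The first component of a pair is the loop and the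
second the coefficient of `k̂`. -/
def Affine (K : LieSubalgebra ℂ (Mat N (LaurentSeries ℂ))) (_c : ℂ) : Type := K × ℂ

namespace Affine

variable {K : LieSubalgebra ℂ (Mat N (LaurentSeries ℂ))} {c : ℂ}

instance : AddCommGroup (Affine K c) := inferInstanceAs (AddCommGroup (K × ℂ))
instance : Module ℂ (Affine K c) := inferInstanceAs (Module ℂ (K × ℂ))

instance : LieRing (Affine K c) where
  bracket x y := (⁅x.1, y.1⁆, cocycle c (x.1 : Mat N (LaurentSeries ℂ)) y.1)
  add_lie x y z := Prod.ext (add_lie x.1 y.1 z.1) (cocycle_add_left c _ _ _)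
  lie_add x y z := Prod.ext (lie_add x.1 y.1 z.1) (cocycle_add_right c _ _ _)
  lie_self x := Prod.ext (lie_self x.1) (cocycle_self c _)
  leibniz_lie x y z := Prod.ext (leibniz_lie x.1 y.1 z.1) (cocycle_jacobi c _ _ _)

instance : LieAlgebra ℂ (Affine K c) where
  lie_smul r x y := Prod.ext (lie_smul r x.1 y.1) (cocycle_smul_right c r _ _)

/-- The central element `k̂`. -/
def khat : Affine K c := ((0 : K), (1 : ℂ))

/-- A loop, as an element of the central extension. -/
def ofLoop (A : K) : Affine K c := (A, (0 : ℂ))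

end Affine

/-- The affine Lie algebra at an ordinary marked point: the central extension of `sl_N (ℂ((ξ)))`
by the cocycle `Res (dA | B)`. -/
abbrev AffineSl (N : ℕ) : Type := Affine (sl N (LaurentSeries ℂ)) 1

/-- The subalgebra of `AffineSl N` spanned by the regular loops and `k̂`. -/
def affinePlus (N : ℕ) : LieSubalgebra ℂ (AffineSl N) where
  carrier := {x | ∀ i j, (x.1 : Mat N (LaurentSeries ℂ)) i j ∈ regular}
  add_mem' hx hy i j := add_mem (hx i j) (hy i j)
  zero_mem' _ _ := zero_mem _
  smul_mem' r _ hx i j := regular.smul_mem (hx i j) r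
  lie_mem' {x y} hx hy i j := by
    change ((x.1 : Mat N (LaurentSeries ℂ)) * y.1 - y.1 * x.1) i j ∈ regular
    rw [Matrix.sub_apply, Matrix.mul_apply, Matrix.mul_apply]
    exact sub_mem (sum_mem fun k _ => mul_mem (hx i k) (hy k j))
      (sum_mem fun k _ => mul_mem (hy i k) (hx k j))

/-- The twisted loop algebra: traceless matrices `A(ξ)` of Laurent series with
`A(ζ ξ) = Ad γ (A(ξ))`. -/
def twLoop (N : ℕ) (z : ℂˣ) : LieSubalgebra ℂ (Mat N (LaurentSeries ℂ)) where
  carrier := {A | A ∈ sl N (LaurentSeries ℂ) ∧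
    (scale z).mapMatrix A = Ad (LaurentSeries ℂ) (gamma N) A}
  add_mem' {A B} hA hB := ⟨add_mem hA.1 hB.1, by rw [map_add, map_add, hA.2, hB.2]⟩
  zero_mem' := ⟨zero_mem _, by rw [map_zero, map_zero]⟩
  smul_mem' r A hA := ⟨SMulMemClass.smul_mem r hA.1, by rw [map_smul, map_smul, hA.2]⟩
  lie_mem' {A B} hA hB := ⟨LieSubalgebra.lie_mem _ hA.1 hB.1, by
    simp only [LieRing.of_associative_ring_bracket, map_sub, map_mul, hA.2, hB.2]⟩

/-- The twisted affine Lie algebra, with the cocycle `(1/N) Res (dA | B)`. -/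
abbrev AffineTw (N : ℕ) (z : ℂˣ) : Type := Affine (twLoop N z) (1 / (N : ℂ))

/-- The twisted affine Lie algebra at `0`, in the coordinate `t`. -/
abbrev AffineZero (N : ℕ) : Type := AffineTw N (eps N)

/-- The twisted affine Lie algebra at `∞`, in the coordinate `1 / t`; the substitution
`t ↦ ε t` is `1 / t ↦ ε⁻¹ (1 / t)`. -/
abbrev AffineInfty (N : ℕ) : Type := AffineTw N (eps N)⁻¹

/-- Constant loops. -/
def constLoop (A : Mat N ℂ) : Mat N (LaurentSeries ℂ) :=
  (Algebra.ofId ℂ (LaurentSeries ℂ)).mapMatrix A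

theorem constLoop_mem_sl {A : Mat N ℂ} (hA : A.trace = 0) :
    constLoop A ∈ sl N (LaurentSeries ℂ) :=
  map_mem_sl (Algebra.ofId ℂ (LaurentSeries ℂ)) (A := A) hA

theorem constLoop_mem_twLoop (z : ℂˣ) {H : Mat N ℂ} (hH : H ∈ cartan N) :
    constLoop H ∈ twLoop N z := by
  refine ⟨constLoop_mem_sl hH.2, ?_⟩
  have h1 : Ad ℂ (gamma N) H = H := by
    have hd : H = Matrix.diagonal H.diag := hH.1.diagonal_diag.symm
    rw [Ad_apply_complex, hd]
    change Matrix.diagonal _ * _ * Matrix.diagonal _ = _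
    rw [Matrix.diagonal_mul_diagonal, Matrix.diagonal_mul_diagonal]
    congr 1
    ext i
    rw [mul_right_comm, ← Units.val_mul, inv_pow, inv_mul_cancel, Units.val_one, one_mul]
  have h2 : Ad (LaurentSeries ℂ) (gamma N) (constLoop H) = constLoop (Ad ℂ (gamma N) H) := by
    exact Ad_map (Algebra.ofId ℂ (LaurentSeries ℂ)) (gamma N) H
  rw [h2, h1]
  ext1 i j
  exact (scale z).commutes (H i j)

/-- A Cartan element as a constant loop in the twisted affine Lie algebra. -/
def cartanTw (N : ℕ) (z : ℂˣ) (H : cartan N) : AffineTw N z :=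
  Affine.ofLoop ⟨constLoop (H : Mat N ℂ), constLoop_mem_twLoop z H.2⟩

/-- A Cartan element as a constant loop in `affinePlus N`. -/
def cartanPlus (N : ℕ) (H : cartan N) : affinePlus N :=
  ⟨Affine.ofLoop ⟨constLoop (H : Mat N ℂ), constLoop_mem_sl H.2.2⟩,
    fun i j => regular.algebraMap_mem ((H : Mat N ℂ) i j)⟩

/-- The nilpotent subalgebra `n_{γ,+}`: twisted loops with strictly positive powers only. -/
def nPlus (N : ℕ) (z : ℂˣ) : Set (AffineTw N z) :=
  {x | (∀ i j, ∀ n ≤ 0, ((x.1 : Mat N (LaurentSeries ℂ)) i j).coeff n = 0) ∧ x.2 = 0}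

end Loop

/-! ### Verma modules -/

section Verma

variable (N : ℕ) (z : ℂˣ) (k : ℂ) (lam : Module.Dual ℂ (cartan N))

/-- The universal enveloping algebra of the twisted affine Lie algebra. -/
abbrev UTw : Type := UniversalEnvelopingAlgebra ℂ (AffineTw N z)

/-- The canonical map into the universal enveloping algebra. -/
abbrev iotaTw : AffineTw N z →ₗ⁅ℂ⁆ UTw N z := UniversalEnvelopingAlgebra.ι ℂ

/-- The left ideal generated by `n_{γ,+}`, `H - λ(H)` for `H` in the Cartan subalgebra, and
`k̂ - k`. -/
def vermaIdeal : Submodule (UTw N z) (UTw N z) :=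
  Submodule.span (UTw N z)
    ({u | ∃ x ∈ nPlus N z, u = iotaTw N z x} ∪
      {u | ∃ H : cartan N,
        u = iotaTw N z (cartanTw N z H) - algebraMap ℂ (UTw N z) (lam H)} ∪
      {iotaTw N z Affine.khat - algebraMap ℂ (UTw N z) k})

/-- The Verma module of highest weight `λ` and level `k`. -/
def Verma : Type := UTw N z ⧸ vermaIdeal N z k lam

namespace Verma

instance : AddCommGroup (Verma N z k lam) :=
  inferInstanceAs (AddCommGroup (UTw N z ⧸ vermaIdeal N z k lam))
instance : Module (UTw N z) (Verma N z k lam) :=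
  inferInstanceAs (Module (UTw N z) (UTw N z ⧸ vermaIdeal N z k lam))
instance : Module ℂ (Verma N z k lam) :=
  inferInstanceAs (Module ℂ (UTw N z ⧸ vermaIdeal N z k lam))
instance : IsScalarTower ℂ (UTw N z) (Verma N z k lam) :=
  inferInstanceAs (IsScalarTower ℂ (UTw N z) (UTw N z ⧸ vermaIdeal N z k lam))

instance : LieRingModule (AffineTw N z) (Verma N z k lam) where
  bracket x v := iotaTw N z x • v
  add_lie x y v := by
    change iotaTw N z (x + y) • v = _
    rw [map_add, add_smul]
  lie_add x v w := smul_add _ v w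
  leibniz_lie x y v := by
    change iotaTw N z x • iotaTw N z y • v =
      iotaTw N z ⁅x, y⁆ • v + iotaTw N z y • iotaTw N z x • v
    rw [LieHom.map_lie, LieRing.of_associative_ring_bracket, sub_smul, mul_smul, mul_smul,
      sub_add_cancel]

instance : LieModule ℂ (AffineTw N z) (Verma N z k lam) where
  smul_lie r x v := by
    change iotaTw N z (r • x) • v = r • iotaTw N z x • v
    rw [map_smul, smul_assoc]
  lie_smul r x v := by
    change iotaTw N z x • r • v = r • iotaTw N z x • v
    rw [← algebraMap_smul (UTw N z) r v, ← algebraMap_smul (UTw N z) r (iotaTw N z x • v),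
      smul_smul, smul_smul, Algebra.commutes]

end Verma

end Verma

/-! ### Meromorphic functions on the projective line -/

section Sections

theorem transcendental_of_not_const {K : Type*} [Field K] [Algebra ℂ K] (x : K)
    (hx : ∀ c : ℂ, algebraMap ℂ K c ≠ x) : Function.Injective (Polynomial.aeval (R := ℂ) x) := by
  rw [← transcendental_iff_injective]
  intro h
  have hd := IsAlgClosed.degree_eq_one_of_irreducible ℂ (minpoly.irreducible h.isIntegral)
  obtain ⟨c, hc⟩ := minpoly.mem_range_of_degree_eq_one ℂ x hd
  exact hx c hc

/-- The substitution `t ↦ x` of rational functions, for `x` a non-constant element of a field. -/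
def subst {K : Type*} [Field K] [Algebra ℂ K] (x : K) (hx : ∀ c : ℂ, algebraMap ℂ K c ≠ x) :
    RatFunc ℂ →ₐ[ℂ] K :=
  RatFunc.liftAlgHom (Polynomial.aeval x)
    (nonZeroDivisors_le_comap_nonZeroDivisors_of_injective _ (transcendental_of_not_const x hx))

theorem subst_X {K : Type*} [Field K] [Algebra ℂ K] (x : K) (hx : ∀ c : ℂ, algebraMap ℂ K c ≠ x) :
    subst x hx RatFunc.X = x := by
  have := RatFunc.liftAlgHom_apply_div (Polynomial.aeval (R := ℂ) x)
    (nonZeroDivisors_le_comap_nonZeroDivisors_of_injective _ (transcendental_of_not_const x hx))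
    Polynomial.X 1
  simpa [subst] using this

theorem ratFunc_hom_ext {K : Type*} [Field K] [Algebra ℂ K] {f g : RatFunc ℂ →ₐ[ℂ] K}
    (h : f RatFunc.X = g RatFunc.X) : f = g := by
  have h1 : ∀ p : Polynomial ℂ, f (algebraMap _ _ p) = g (algebraMap _ _ p) := by
    intro p
    have : f.comp (Algebra.ofId (Polynomial ℂ) (RatFunc ℂ) |>.restrictScalars ℂ) =
        g.comp (Algebra.ofId (Polynomial ℂ) (RatFunc ℂ) |>.restrictScalars ℂ) := by
      apply Polynomial.algHom_ext
      change f (algebraMap _ _ Polynomial.X) = g (algebraMap _ _ Polynomial.X)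
      rwa [RatFunc.algebraMap_X]
    exact DFunLike.congr_fun this p
  ext x
  induction x using RatFunc.induction_on with
  | f p q hq => rw [map_div₀, map_div₀, h1, h1]

/-- The Laurent expansion of the coordinate `t` at a point of the projective line, in the local
parameter `t - c` at a finite point `c` and `1 / t` at `∞`. -/
def coordAt : OnePoint ℂ → LaurentSeries ℂ
  | OnePoint.some c => HahnSeries.C c + HahnSeries.single 1 1
  | OnePoint.infty => HahnSeries.single (-1) 1

theorem coordAt_ne_const (P : OnePoint ℂ) (c : ℂ) :
    algebraMap ℂ (LaurentSeries ℂ) c ≠ coordAt P := by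
  have hc : algebraMap ℂ (LaurentSeries ℂ) c = HahnSeries.single 0 c := rfl
  rw [hc]
  intro h
  induction P using OnePoint.rec with
  | infty =>
    have := congrArg (fun f : LaurentSeries ℂ => f.coeff (-1)) h
    simp [coordAt] at this
  | coe a =>
    have := congrArg (fun f : LaurentSeries ℂ => f.coeff 1) h
    simp [coordAt] at this

/-- The Laurent expansion of a rational function at a point of the projective line. -/
def expand (P : OnePoint ℂ) : RatFunc ℂ →ₐ[ℂ] LaurentSeries ℂ :=
  subst (coordAt P) (coordAt_ne_const P)

theorem epsX_ne_const (N : ℕ) (c : ℂ) :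
    algebraMap ℂ (RatFunc ℂ) c ≠ algebraMap ℂ (RatFunc ℂ) (eps N) * RatFunc.X := by
  intro h
  have h1 : algebraMap (Polynomial ℂ) (RatFunc ℂ) (Polynomial.C c) =
      algebraMap (Polynomial ℂ) (RatFunc ℂ) (Polynomial.C (eps N : ℂ) * Polynomial.X) := by
    rw [map_mul, RatFunc.algebraMap_X]
    exact h
  have h2 := congrArg (fun p : Polynomial ℂ => p.coeff 1)
    (IsFractionRing.injective (Polynomial ℂ) (RatFunc ℂ) h1)
  simp only [Polynomial.coeff_C_succ, Polynomial.coeff_C_mul_X, if_true] at h2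
  exact (eps N).ne_zero h2.symm

/-- The rotation `f(t) ↦ f(ε t)` of rational functions. -/
def rotate (N : ℕ) : RatFunc ℂ →ₐ[ℂ] RatFunc ℂ :=
  subst (algebraMap ℂ (RatFunc ℂ) (eps N) * RatFunc.X) (epsX_ne_const N)

/-- Meromorphic sections of `g^orb`: `sl_N`-valued rational functions with
`f(ε t) = Ad γ (f(t))`. -/
def meroOrb (N : ℕ) : LieSubalgebra ℂ (Mat N (RatFunc ℂ)) where
  carrier := {f | f ∈ sl N (RatFunc ℂ) ∧ (rotate N).mapMatrix f = Ad (RatFunc ℂ) (gamma N) f}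
  add_mem' {A B} hA hB := ⟨add_mem hA.1 hB.1, by rw [map_add, map_add, hA.2, hB.2]⟩
  zero_mem' := ⟨zero_mem _, by rw [map_zero, map_zero]⟩
  smul_mem' r A hA := ⟨SMulMemClass.smul_mem r hA.1, by rw [map_smul, map_smul, hA.2]⟩
  lie_mem' {A B} hA hB := ⟨LieSubalgebra.lie_mem _ hA.1 hB.1, by
    simp only [LieRing.of_associative_ring_bracket, map_sub, map_mul, hA.2, hB.2]⟩

/-- Holomorphy at a point of the projective line. -/
def HoloAt {N : ℕ} (P : OnePoint ℂ) (f : Mat N (RatFunc ℂ)) : Prop :=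
  ∀ i j, expand P (f i j) ∈ regular

/-- The value at a point of the projective line (meaningful where `f` is holomorphic). -/
def valueAt {N : ℕ} (P : OnePoint ℂ) (f : Mat N (RatFunc ℂ)) : Mat N ℂ :=
  f.map fun x => (expand P x).coeff 0

theorem HoloAt.lie {N : ℕ} {P : OnePoint ℂ} {f g : Mat N (RatFunc ℂ)} (hf : HoloAt P f)
    (hg : HoloAt P g) : HoloAt P ⁅f, g⁆ := by
  intro i j
  rw [LieRing.of_associative_ring_bracket, Matrix.sub_apply, Matrix.mul_apply, Matrix.mul_apply,
    map_sub, map_sum, map_sum]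
  simp only [map_mul]
  exact sub_mem (sum_mem fun k _ => mul_mem (hf i k) (hg k j))
      (sum_mem fun k _ => mul_mem (hg i k) (hf k j))

theorem valueAt_mul {N : ℕ} {P : OnePoint ℂ} {f g : Mat N (RatFunc ℂ)} (hf : HoloAt P f)
    (hg : HoloAt P g) : valueAt P (f * g) = valueAt P f * valueAt P g := by
  ext i j
  simp only [valueAt, Matrix.map_apply, Matrix.mul_apply, map_sum, map_mul, HahnSeries.coeff_sum]
  exact Finset.sum_congr rfl fun k _ => regular_coeff_zero_mul (hf i k) (hg k j)

theorem valueAt_add {N : ℕ} (P : OnePoint ℂ) (f g : Mat N (RatFunc ℂ)) :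
    valueAt P (f + g) = valueAt P f + valueAt P g := by
  ext i j; simp [valueAt]

theorem valueAt_sub {N : ℕ} (P : OnePoint ℂ) (f g : Mat N (RatFunc ℂ)) :
    valueAt P (f - g) = valueAt P f - valueAt P g := by
  ext i j; simp [valueAt]

theorem valueAt_smul {N : ℕ} (P : OnePoint ℂ) (r : ℂ) (f : Mat N (RatFunc ℂ)) :
    valueAt P (r • f) = r • valueAt P f := by
  ext i j
  simp only [valueAt, Matrix.map_apply, Matrix.smul_apply, map_smul]
  exact HahnSeries.coeff_smul ..

/-- Global meromorphic sections of `g^orb` that are holomorphic outside `S`. -/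
def gOrb (N : ℕ) (S : Set (OnePoint ℂ)) : LieSubalgebra ℂ (Mat N (RatFunc ℂ)) where
  carrier := {f | f ∈ meroOrb N ∧ ∀ P ∉ S, HoloAt P f}
  add_mem' {f g} hf hg := ⟨add_mem hf.1 hg.1, fun P hP i j => by
    rw [Matrix.add_apply, map_add]; exact add_mem (hf.2 P hP i j) (hg.2 P hP i j)⟩
  zero_mem' := ⟨zero_mem _, fun P _ i j => by
    rw [Matrix.zero_apply, map_zero]; exact zero_mem _⟩
  smul_mem' r f hf := ⟨SMulMemClass.smul_mem r hf.1, fun P hP i j => by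
    rw [Matrix.smul_apply, map_smul]; exact regular.smul_mem (hf.2 P hP i j) r⟩
  lie_mem' {f g} hf hg := ⟨LieSubalgebra.lie_mem _ hf.1 hg.1, fun P hP =>
    (hf.2 P hP).lie (hg.2 P hP)⟩

/-- Global meromorphic sections of `g^trig` that are holomorphic outside `S`: sections of `g^orb`
that are holomorphic at `0` and `∞` with `f(∞) = Ad β (f(0))`. -/
def gTrig (N : ℕ) (S : Set (OnePoint ℂ)) : LieSubalgebra ℂ (Mat N (RatFunc ℂ)) where
  carrier := {f | f ∈ gOrb N S ∧ HoloAt ((0 : ℂ) : OnePoint ℂ) f ∧ HoloAt OnePoint.infty f ∧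
    valueAt OnePoint.infty f = Ad ℂ (beta N) (valueAt ((0 : ℂ) : OnePoint ℂ) f)}
  add_mem' {f g} hf hg := ⟨add_mem hf.1 hg.1,
    fun i j => by rw [Matrix.add_apply, map_add]; exact add_mem (hf.2.1 i j) (hg.2.1 i j),
    fun i j => by rw [Matrix.add_apply, map_add]; exact add_mem (hf.2.2.1 i j) (hg.2.2.1 i j),
    by rw [valueAt_add, valueAt_add, map_add, hf.2.2.2, hg.2.2.2]⟩
  zero_mem' := ⟨zero_mem _,
    fun i j => by rw [Matrix.zero_apply, map_zero]; exact zero_mem _,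
    fun i j => by rw [Matrix.zero_apply, map_zero]; exact zero_mem _,
    by
      have h : ∀ P, valueAt P (0 : Mat N (RatFunc ℂ)) = 0 := fun P => by ext i j; simp [valueAt]
      rw [h, h, map_zero]⟩
  smul_mem' r f hf := ⟨SMulMemClass.smul_mem r hf.1,
    fun i j => by rw [Matrix.smul_apply, map_smul]; exact regular.smul_mem (hf.2.1 i j) r,
    fun i j => by rw [Matrix.smul_apply, map_smul]; exact regular.smul_mem (hf.2.2.1 i j) r,
    by rw [valueAt_smul, valueAt_smul, map_smul, hf.2.2.2]⟩
  lie_mem' {f g} hf hg := ⟨LieSubalgebra.lie_mem _ hf.1 hg.1, hf.2.1.lie hg.2.1,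
    hf.2.2.1.lie hg.2.2.1, by
      rw [LieRing.of_associative_ring_bracket, valueAt_sub, valueAt_sub,
        valueAt_mul hf.2.2.1 hg.2.2.1, valueAt_mul hg.2.2.1 hf.2.2.1,
        valueAt_mul hf.2.1 hg.2.1, valueAt_mul hg.2.1 hf.2.1, map_sub, map_mul, map_mul,
        hf.2.2.2, hg.2.2.2]⟩

/-- The points of the projective line over the marked points `t_1, …, t_L` of the orbifold: all
`ε^a t_i`. -/
def marked (N : ℕ) {L : ℕ} (t : Fin L → ℂ) : Set (OnePoint ℂ) :=
  {P | ∃ (i : Fin L) (a : ℕ), P = (((eps N : ℂ) ^ a * t i : ℂ) : OnePoint ℂ)}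

/-- The marked points together with `0` and `∞`. -/
def markedZeroInfty (N : ℕ) {L : ℕ} (t : Fin L → ℂ) : Set (OnePoint ℂ) :=
  marked N t ∪ {((0 : ℂ) : OnePoint ℂ), OnePoint.infty}

/-- The germ at the finite point `c`, in the local parameter `t - c`. -/
def germ (N : ℕ) (c : ℂ) (f : meroOrb N) : AffineSl N :=
  Affine.ofLoop ⟨(f : Mat N (RatFunc ℂ)).map (expand c), map_mem_sl (expand c) f.2.1⟩

theorem mem_twLoop_of_comm {N : ℕ} {z : ℂˣ} {P : OnePoint ℂ}
    (h : scale z (coordAt P) = algebraMap ℂ (LaurentSeries ℂ) (eps N) * coordAt P)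
    (f : meroOrb N) : (f : Mat N (RatFunc ℂ)).map (expand P) ∈ twLoop N z := by
  refine ⟨map_mem_sl (expand P) f.2.1, ?_⟩
  have h1 : (scale z).comp (expand P) = (expand P).comp (rotate N) := by
    apply ratFunc_hom_ext
    simp only [AlgHom.comp_apply, rotate, expand, subst_X, map_mul, AlgHom.commutes, h]
  have h2 : (scale z).mapMatrix ((expand P).mapMatrix (f : Mat N (RatFunc ℂ))) =
      (expand P).mapMatrix ((rotate N).mapMatrix (f : Mat N (RatFunc ℂ))) := by
    ext1 i j
    exact DFunLike.congr_fun h1 ((f : Mat N (RatFunc ℂ)) i j)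
  exact h2.trans ((congrArg _ f.2.2).trans (Ad_map (expand P) (gamma N) _).symm)

theorem scale_coordAt_zero (N : ℕ) : scale (eps N) (coordAt ((0 : ℂ) : OnePoint ℂ)) =
    algebraMap ℂ (LaurentSeries ℂ) (eps N) * coordAt ((0 : ℂ) : OnePoint ℂ) := by
  have hc : algebraMap ℂ (LaurentSeries ℂ) (eps N) = HahnSeries.C (eps N : ℂ) := rfl
  have h0 : coordAt ((0 : ℂ) : OnePoint ℂ) = HahnSeries.single 1 1 := by
    change HahnSeries.C (0 : ℂ) + HahnSeries.single 1 1 = _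
    rw [map_zero, zero_add]
  rw [hc, h0, HahnSeries.C_mul_eq_smul]
  ext n
  change ((eps N ^ n : ℂˣ) : ℂ) * (HahnSeries.single 1 1 : LaurentSeries ℂ).coeff n = _
  rw [HahnSeries.coeff_smul]
  by_cases hn : n = 1
  · subst hn; simp
  · simp [HahnSeries.coeff_single_of_ne hn]

theorem scale_coordAt_infty (N : ℕ) : scale (eps N)⁻¹ (coordAt OnePoint.infty) =
    algebraMap ℂ (LaurentSeries ℂ) (eps N) * coordAt OnePoint.infty := by
  have hc : algebraMap ℂ (LaurentSeries ℂ) (eps N) = HahnSeries.C (eps N : ℂ) := rfl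
  have h0 : coordAt OnePoint.infty = HahnSeries.single (-1) 1 := rfl
  rw [hc, h0, HahnSeries.C_mul_eq_smul]
  ext n
  change (((eps N)⁻¹ ^ n : ℂˣ) : ℂ) * (HahnSeries.single (-1) 1 : LaurentSeries ℂ).coeff n = _
  rw [HahnSeries.coeff_smul]
  by_cases hn : n = -1
  · subst hn; simp
  · simp [HahnSeries.coeff_single_of_ne hn]

/-- The germ at `0`. -/
def germZero (N : ℕ) (f : meroOrb N) : AffineZero N :=
  Affine.ofLoop ⟨(f : Mat N (RatFunc ℂ)).map (expand ((0 : ℂ) : OnePoint ℂ)),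
    mem_twLoop_of_comm (scale_coordAt_zero N) f⟩

/-- The germ at `∞`, in the local parameter `1 / t`. -/
def germInfty (N : ℕ) (f : meroOrb N) : AffineInfty N :=
  Affine.ofLoop ⟨(f : Mat N (RatFunc ℂ)).map (expand OnePoint.infty),
    mem_twLoop_of_comm (scale_coordAt_infty N) f⟩

end Sections

/-! ### Conformal coinvariants -/

section Coinvariants

variable (N : ℕ) {L : ℕ} (t : Fin L → ℂ)
variable (M : Fin L → Type*) [∀ i, AddCommGroup (M i)] [∀ i, Module ℂ (M i)]
  [∀ i, LieRingModule (AffineSl N) (M i)] [∀ i, LieModule ℂ (AffineSl N) (M i)]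

/-- The operator acting by `a i` on the `i`-th factor of a tensor product, and by the identity on
the others. -/
def actFactor {W : Fin L → Type*} [∀ i, AddCommGroup (W i)] [∀ i, Module ℂ (W i)] (i : Fin L)
    (a : Module.End ℂ (W i)) : Module.End ℂ (⨂[ℂ] j, W j) :=
  PiTensorProduct.map (Function.update (fun j => (LinearMap.id : W j →ₗ[ℂ] W j)) i a)

/-- The action of a meromorphic section on `M_1 ⊗ ⋯ ⊗ M_L` through its germs at the marked
points. -/
def actM (f : meroOrb N) : Module.End ℂ (⨂[ℂ] i, M i) :=
  ∑ i, actFactor i (LieModule.toEnd ℂ (AffineSl N) (M i) (germ N (t i) f))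

/-- Conformal coinvariants on the degenerate elliptic curve: `M / g_out^trig M`. -/
def CCtrig : Type _ :=
  (⨂[ℂ] i, M i) ⧸ Submodule.span ℂ
    {w | ∃ f : meroOrb N, (f : Mat N (RatFunc ℂ)) ∈ gTrig N (marked N t) ∧
      ∃ v, w = actM N t M f v}

instance : AddCommGroup (CCtrig N t M) := inferInstanceAs (AddCommGroup (_ ⧸ _))
instance : Module ℂ (CCtrig N t M) := inferInstanceAs (Module ℂ (_ ⧸ _))

variable (M₀ : Type*) [AddCommGroup M₀] [Module ℂ M₀] [LieRingModule (AffineZero N) M₀]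
  [LieModule ℂ (AffineZero N) M₀]
variable (M' : Type*) [AddCommGroup M'] [Module ℂ M'] [LieRingModule (AffineInfty N) M']
  [LieModule ℂ (AffineInfty N) M']

/-- The action of a meromorphic section on `M₀ ⊗ (M_1 ⊗ ⋯ ⊗ M_L) ⊗ M'` through its germs at `0`,
at the marked points, and at `∞`. -/
def actZMI (f : meroOrb N) : Module.End ℂ (M₀ ⊗[ℂ] (⨂[ℂ] i, M i) ⊗[ℂ] M') :=
  TensorProduct.map (TensorProduct.map
      (LieModule.toEnd ℂ (AffineZero N) M₀ (germZero N f)) LinearMap.id) LinearMap.id +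
    TensorProduct.map (TensorProduct.map LinearMap.id (actM N t M f)) LinearMap.id +
    TensorProduct.map (TensorProduct.map LinearMap.id LinearMap.id)
      (LieModule.toEnd ℂ (AffineInfty N) M' (germInfty N f))

/-- Conformal coinvariants on the orbifold, with `M₀` inserted at `0`, `M_i` at the marked points,
and `M'` at `∞`. -/
def CCorb : Type _ :=
  (M₀ ⊗[ℂ] (⨂[ℂ] i, M i) ⊗[ℂ] M') ⧸ Submodule.span ℂ
    {w | ∃ f : meroOrb N, (f : Mat N (RatFunc ℂ)) ∈ gOrb N (markedZeroInfty N t) ∧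
      ∃ v, w = actZMI N t M M₀ M' f v}

instance : AddCommGroup (CCorb N t M M₀ M') := inferInstanceAs (AddCommGroup (_ ⧸ _))
instance : Module ℂ (CCorb N t M M₀ M') := inferInstanceAs (Module ℂ (_ ⧸ _))

variable {N M}

/-- The set of weights of `V = V_1 ⊗ ⋯ ⊗ V_L` with respect to the Cartan subalgebra of `sl_N`, for
subspaces `V_i ⊆ M_i` stable under the regular loops. -/
def weights (V : ∀ i, LieSubmodule ℂ (affinePlus N) (M i)) : Set (Module.Dual ℂ (cartan N)) :=
  {lam | ∃ v : ⨂[ℂ] i, V i, v ≠ 0 ∧ ∀ H : cartan N,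
    (∑ i, actFactor (W := fun i => V i) i
      (LieModule.toEnd ℂ (affinePlus N) (V i) (cartanPlus N H))) v = lam H • v}

end Coinvariants

end TrigWZW

end

open scoped TensorProduct

noncomputable section

namespace TrigWZW

attribute [local instance 100] LieRing.ofAssociativeRing

/-! ### Semisimplicity of the Cartan generator of an `sl₂`-triple of operators -/

section SlTwo

variable {W : Type*} [AddCommGroup W] [Module ℂ W]

/-! Both sides are quotients of $M$, and the proof compares the relations that define them. A
constant section $H\in\mathfrak h$ lies in $\mathfrak g^{\rm orb}$, but in $\mathfrak g^{\rm
trig}_{\rm out}$ only if $H=0$. Its bracket with a trigonometric section vanishes at $0$ and at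
$\infty$, hence is again trigonometric, and its cocycles vanish. So $\mathfrak h$ acts on $CC_{\rm
trig}(M)$ (`cartanCC`).

Partial fractions, averaged over the rotation, give a trigonometric section with any prescribed
principal part at one $t_i$; invertibility of $1-\operatorname{Ad}\beta$ lets a constant correct its
values at $0$ and $\infty$ (`exists_gTrig_principal`). Therefore $V\to CC_{\rm trig}(M)$ is onto
(`toCC_surjective`), which gives finite dimension. As $\mathfrak h$ is diagonalizable on $V$
(`iSup_wtSpace_sl`, from the $\mathfrak{sl}_2$ theory), $CC_{\rm trig}(M)$ is the direct sum over
$\lambda\in\operatorname{wt}(V)$ of its quotients by all $Hx-\lambda(H)x$.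

On the orbifold side, $CC_{\rm orb}(M_\mu\otimes M\otimes M_{\mu'})$ is $M$ modulo the relations
$fx+(\mu(f(0))+\mu'(f(\infty)))x$ for sections $f$ regular at $0$ and $\infty$
(`nonempty_vacSpan_quotient_equiv`). Surjectivity holds because loops at $0$ and $\infty$ can be
approximated simultaneously by global sections (`exists_approx`). For injectivity, the projection
$\varphi$ of $M$ to its quotient $W$ has to extend to an invariant pairing of the Verma modules.
Loops at $0$ and $\infty$ act on the linear maps $M\to W$ killed by sections of high order there:
approximate the loops by a section $f$ and send $\psi$ to $-\psi\circ f$, plus a central term. The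
residue theorem (`sum_cocycle_germ`) makes this an action of level $k$ at both points; $\varphi$ is
a highest weight vector for it, and the universal property of Verma modules gives the pairing.

Finally take $\mu=\tilde\lambda$ and $\mu'=\tilde\lambda'$. A section regular at $0$ and $\infty$ is
uniquely a trigonometric section plus a constant $K$, and the weights are chosen so that the scalar
in its relation is $-\lambda(K)$. The orbifold relations are thus those of $\mathfrak g^{\rm
trig}_{\rm out}M$ together with $Kx-\lambda(K)x$ (`vacSpan_tildeWt`), which is the $\lambda$-summand
above. -/

/-- If `[h, g] = r g` with `r ≠ 0`, then `g` is nilpotent. -/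
theorem exists_pow_eq_zero_of_lie_eq_smul [FiniteDimensional ℂ W] {h g : Module.End ℂ W} {r : ℂ}
    (hr : r ≠ 0) (hg : h * g - g * h = r • g) : ∃ n : ℕ, g ^ n = 0 := by
  by_contra! hne
  have hpow : ∀ n : ℕ, h * g ^ n - g ^ n * h = (n * r : ℂ) • g ^ n := by
    intro n
    induction n with
    | zero => simp
    | succ n ih =>
      have : h * g ^ (n + 1) - g ^ (n + 1) * h =
          (h * g ^ n - g ^ n * h) * g + g ^ n * (h * g - g * h) := by
        rw [pow_succ]; noncomm_ring
      rw [this, ih, hg, smul_mul_assoc, mul_smul_comm, ← pow_succ, ← add_smul]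
      congr 1; push_cast; ring
  -- `Φ` is $\operatorname{ad}h$. If no power of `g` vanished, the powers would be eigenvectors for
  -- the infinitely many eigenvalues $nr$.
  let Φ : Module.End ℂ (Module.End ℂ W) := LinearMap.mulLeft ℂ h - LinearMap.mulRight ℂ h
  have hev : ∀ n : ℕ, Φ.HasEigenvalue (n * r) := fun n =>
    Module.End.hasEigenvalue_of_hasEigenvector (x := g ^ n)
      (Module.End.hasEigenvector_iff.mpr ⟨Module.End.mem_eigenspace_iff.mpr (hpow n), hne n⟩)
  have hfin : Set.Finite {μ | Φ.HasEigenvalue μ} := Module.End.finite_hasEigenvalue Φ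
  refine Set.infinite_of_injective_forall_mem (f := fun n : ℕ => (n * r : ℂ)) ?_ hev hfin
  intro a b hab
  exact_mod_cast mul_right_cancel₀ hr hab

variable {h e f : Module.End ℂ W}

theorem slTwo_h_pow_f (hf : ∀ x, h (f x) = f (h x) - (2 : ℂ) • f x) (n : ℕ) (x : W) :
    h ((f ^ n) x) = (f ^ n) (h x) - (2 * n : ℂ) • (f ^ n) x := by
  induction n generalizing x with
  | zero => simp
  | succ n ih =>
    rw [pow_succ, Module.End.mul_apply, Module.End.mul_apply, ih, hf, map_sub, map_smul]
    push_cast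
    module

/-- The usual formula for $ef^{n+1}$ on a primitive vector, without assuming that `x` is an
eigenvector of `h`: it is also applied to the upper vector of a Jordan chain. -/
theorem slTwo_e_pow_f (hef : ∀ x, e (f x) = f (e x) + h x)
    (hf : ∀ x, h (f x) = f (h x) - (2 : ℂ) • f x) {x : W} (hx : e x = 0) (n : ℕ) :
    e ((f ^ (n + 1)) x) = (n + 1 : ℂ) • ((f ^ n) (h x) - (n : ℂ) • (f ^ n) x) := by
  induction n with
  | zero => simp [hef, hx]
  | succ n ih =>
    have e1 : (f ^ (n + 1 + 1)) x = f ((f ^ (n + 1)) x) := by rw [pow_succ' f (n + 1)]; rfl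
    have e2 : ∀ y, f ((f ^ n) y) = (f ^ (n + 1)) y := fun y => by rw [pow_succ' f n]; rfl
    rw [e1, hef, ih, map_smul, map_sub, map_smul, e2, e2, slTwo_h_pow_f hf]
    push_cast
    module

theorem slTwo_h_pow_e (he : ∀ x, h (e x) = e (h x) + (2 : ℂ) • e x) (n : ℕ) (x : W) :
    h ((e ^ n) x) = (e ^ n) (h x) + (2 * n : ℂ) • (e ^ n) x := by
  induction n generalizing x with
  | zero => simp
  | succ n ih =>
    rw [pow_succ, Module.End.mul_apply, Module.End.mul_apply, ih, he, map_add, map_smul]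
    push_cast
    module

theorem exists_pow_ne_zero_pow_succ_eq_zero {g : Module.End ℂ W} (hg : ∃ n : ℕ, g ^ n = 0) {x : W}
    (hx : x ≠ 0) : ∃ n : ℕ, (g ^ n) x ≠ 0 ∧ (g ^ (n + 1)) x = 0 :=
  Nat.exists_not_and_succ_of_not_zero_of_exists (p := fun n => (g ^ n) x = 0) hx
    (hg.imp fun n hn => by rw [hn]; rfl)

theorem slTwo_primitive (hef : ∀ x, e (f x) = f (e x) + h x)
    (hf : ∀ x, h (f x) = f (h x) - (2 : ℂ) • f x) {w : W} {a : ℂ} (hw : e w = 0)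
    (hwa : h w = a • w) {n : ℕ} (h0 : (f ^ n) w ≠ 0) (h1 : (f ^ (n + 1)) w = 0) : a = n := by
  have := slTwo_e_pow_f hef hf hw n
  rw [h1, map_zero, hwa, map_smul, ← sub_smul, smul_smul, eq_comm, smul_eq_zero] at this
  have h2 := this.resolve_right h0
  exact sub_eq_zero.mp ((mul_eq_zero.mp h2).resolve_left (Nat.cast_add_one_ne_zero n))

/-- Rules out a Jordan chain of `h` whose upper vector is primitive. Let $f^n$ and $f^m$ be the last
powers not killing $w$ and $v$; then $a=n$. Applying $e$ to $f^{m+1}v=0$ gives $f^mw=(m-n)f^mv$, and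
applying $h$ to this gives $(m-n)^2f^mv=0$. So $m=n$ and $f^nw=0$, a contradiction. -/
theorem slTwo_primitive_semisimple (hef : ∀ x, e (f x) = f (e x) + h x)
    (he : ∀ x, h (e x) = e (h x) + (2 : ℂ) • e x)
    (hf : ∀ x, h (f x) = f (h x) - (2 : ℂ) • f x) (hnil : ∃ n : ℕ, f ^ n = 0) {v w : W} {a : ℂ}
    (hv : e v = 0) (hva : h v = a • v + w) (hwa : h w = a • w) : w = 0 := by
  by_contra hw0
  have hw : e w = 0 := by
    have h1 := he v
    rw [hv, map_zero, hva, map_add, map_smul, hv] at h1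
    simpa using h1.symm
  obtain ⟨n, hn0, hn1⟩ := exists_pow_ne_zero_pow_succ_eq_zero hnil hw0
  have han := slTwo_primitive hef hf hw hwa hn0 hn1
  have hv0 : v ≠ 0 := by
    rintro rfl
    exact hw0 (by simpa using hva.symm)
  obtain ⟨m, hm0, hm1⟩ := exists_pow_ne_zero_pow_succ_eq_zero hnil hv0
  have h1 := slTwo_e_pow_f hef hf hv m
  rw [hm1, map_zero, hva, map_add, map_smul, eq_comm, smul_eq_zero] at h1
  have h2 : (f ^ m) w = ((m : ℂ) - n) • (f ^ m) v := by
    have := h1.resolve_left (Nat.cast_add_one_ne_zero m)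
    rw [han] at this
    rw [sub_smul, ← sub_eq_zero, ← this]
    abel
  have h3 := slTwo_h_pow_f hf m w
  have h4 := slTwo_h_pow_f hf m v
  rw [h2, map_smul, h4, hva, hwa, map_add, map_smul, map_smul, h2] at h3
  have h5 : (((m : ℂ) - n) * ((m : ℂ) - n)) • (f ^ m) v = 0 := by
    rw [← sub_eq_zero] at h3
    rw [← h3]
    module
  have h6 : (m : ℂ) - n = 0 := by
    simpa using (smul_eq_zero.mp h5).resolve_right hm0
  have h7 : m = n := by exact_mod_cast sub_eq_zero.mp h6
  rw [h6, zero_smul, h7] at h2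
  exact hn0 h2

/-- The Cartan generator of an `sl₂`-triple of operators on a finite-dimensional complex space is
semisimple. -/
theorem slTwo_maxGenEigenspace_le [FiniteDimensional ℂ W] (hef : e * f - f * e = h)
    (he : h * e - e * h = (2 : ℂ) • e) (hf : h * f - f * h = (-2 : ℂ) • f) (a : ℂ) :
    h.maxGenEigenspace a ≤ h.eigenspace a := by
  have hef' : ∀ x, e (f x) = f (e x) + h x := fun x => by
    rw [← hef]; simp
  have he' : ∀ x, h (e x) = e (h x) + (2 : ℂ) • e x := fun x => by
    have := LinearMap.congr_fun he x
    simp only [LinearMap.sub_apply, Module.End.mul_apply, LinearMap.smul_apply] at this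
    rw [← this]; abel
  have hf' : ∀ x, h (f x) = f (h x) - (2 : ℂ) • f x := fun x => by
    have := LinearMap.congr_fun hf x
    simp only [LinearMap.sub_apply, Module.End.mul_apply, neg_smul, LinearMap.neg_apply, LinearMap.smul_apply] at this
    rw [sub_eq_add_neg, ← this]; abel
  have hfn := exists_pow_eq_zero_of_lie_eq_smul (by norm_num) hf
  have hen := exists_pow_eq_zero_of_lie_eq_smul two_ne_zero he
  -- The Casimir operator. It separates the highest weights and so reduces an arbitrary Jordan chain
  -- to one with primitive upper vector.
  let c : Module.End ℂ W := (4 : ℂ) • (f * e) + h * h + (2 : ℂ) • h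
  have hc : ∀ x, c x = (4 : ℂ) • f (e x) + h (h x) + (2 : ℂ) • h x := fun x => rfl
  have hch : Commute c h := LinearMap.ext fun x => by
    simp only [Module.End.mul_apply, hc, map_add, map_smul, he', hf']
    module
  have hce : Commute c e := LinearMap.ext fun x => by
    simp only [Module.End.mul_apply, hc, map_add, map_smul, he', hef']
    module
  -- Raising a weight vector until it becomes primitive reaches a weight `n`, on which the Casimir
  -- acts by $n^2+2n$; so its generalized eigenvalue `κ` determines `n`.
  have key : ∀ (w : W) (b κ : ℂ), w ≠ 0 → h w = b • w → w ∈ c.maxGenEigenspace κ →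
      ∃ j n : ℕ, (e ^ j) w ≠ 0 ∧ (e ^ (j + 1)) w = 0 ∧ b + 2 * j = n ∧ κ = n * n + 2 * n := by
    intro w b κ hw0 hwb hwκ
    obtain ⟨j, hj0, hj1⟩ := exists_pow_ne_zero_pow_succ_eq_zero hen hw0
    have he1 : e ((e ^ j) w) = 0 := by rw [pow_succ' e j] at hj1; exact hj1
    have hh1 : h ((e ^ j) w) = (b + 2 * j) • (e ^ j) w := by
      rw [slTwo_h_pow_e he', hwb, map_smul, add_smul]
    obtain ⟨n, hn0, hn1⟩ := exists_pow_ne_zero_pow_succ_eq_zero hfn hj0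
    have hbn := slTwo_primitive hef' hf' he1 hh1 hn0 hn1
    refine ⟨j, n, hj0, hj1, hbn, ?_⟩
    have hm : (e ^ j) w ∈ c.maxGenEigenspace κ :=
      Module.End.mapsTo_maxGenEigenspace_of_comm (hce.pow_right j) κ hwκ
    have hm' : (e ^ j) w ∈ c.maxGenEigenspace (n * n + 2 * n) := by
      refine (c.genEigenspace _).mono (show (1 : ℕ∞) ≤ ⊤ from le_top) ?_
      refine Module.End.mem_eigenspace_iff.mpr ?_
      rw [hc, he1, hh1, hbn, map_smul, hh1, hbn]
      simp only [map_zero]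
      module
    by_contra hne
    exact hj0 (Submodule.disjoint_def.mp (c.disjoint_genEigenspace hne ⊤ ⊤) _ hm hm')
  have main : ∀ (v w : W), h v = a • v + w → h w = a • w → w = 0 := by
    have main' : ∀ (κ : ℂ) (v w : W), v ∈ c.maxGenEigenspace κ → h v = a • v + w →
        h w = a • w → w = 0 := by
      intro κ v w hvκ hva hwa
      by_contra hw0
      have hwκ : w ∈ c.maxGenEigenspace κ := by
        have : w = h v - a • v := by rw [hva]; abel
        rw [this]
        exact sub_mem (Module.End.mapsTo_maxGenEigenspace_of_comm hch κ hvκ)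
          (Submodule.smul_mem _ _ hvκ)
      obtain ⟨j, n, hj0, hj1, hn, hκ⟩ := key w a κ hw0 hwa hwκ
      have hej : ∀ i : ℕ, h ((e ^ i) v) = (a + 2 * i) • (e ^ i) v + (e ^ i) w := by
        intro i
        rw [slTwo_h_pow_e he', hva, map_add, map_smul]
        module
      -- As $e^{j+1}w=0$, a nonzero $e^{j+1}v$ would be a weight vector. Its primitive descendant
      -- would have a weight $n'>n$ with the same Casimir eigenvalue, but $n^2+2n$ is strictly
      -- increasing.
      have hz : (e ^ (j + 1)) v = 0 := by
        by_contra hz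
        obtain ⟨j', n', -, -, hn', hκ'⟩ := key _ (a + 2 * (j + 1 : ℕ)) κ hz
          (by rw [hej, hj1, add_zero])
          (Module.End.mapsTo_maxGenEigenspace_of_comm (hce.pow_right _) κ hvκ)
        have h1 : (n' : ℂ) = n + 2 + 2 * j' := by
          rw [← hn', ← hn]; push_cast; ring
        have h2 : n' = n + 2 + 2 * j' := by exact_mod_cast h1
        have h3 : (n * n + 2 * n : ℂ) = n' * n' + 2 * n' := hκ.symm.trans hκ'
        have h4 : n * n + 2 * n = n' * n' + 2 * n' := by exact_mod_cast h3
        subst h2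
        nlinarith
      refine hj0 (slTwo_primitive_semisimple hef' he' hf' hfn (v := (e ^ j) v) ?_ (hej j) ?_)
      · rw [pow_succ' e j] at hz; exact hz
      · rw [slTwo_h_pow_e he', hwa, map_smul, add_smul]
    intro v w hva hwa
    let g : Module.End ℂ W := h - algebraMap ℂ _ a
    have hgw : w = g v := by
      simp [g, hva, Module.algebraMap_end_apply]
    have hcg : Commute c g := hch.sub_right (Algebra.commutes a c).symm
    have hvp : v ∈ LinearMap.ker (g * g) := by
      rw [LinearMap.mem_ker, Module.End.mul_apply, ← hgw]
      simp [g, hwa, Module.algebraMap_end_apply]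
    -- The kernel of $(h-a)^2$ is stable under the Casimir, hence is the sum of its intersections
    -- with the generalized Casimir eigenspaces, where `main'` applies.
    have hle : LinearMap.ker (g * g) ≤ LinearMap.ker g := by
      rw [Submodule.eq_iSup_inf_genEigenspace (p := LinearMap.ker (g * g)) (f := c) (k := ⊤)
        (fun x hx => ?_) (Module.End.iSup_maxGenEigenspace_eq_top c)]
      · refine iSup_le fun κ x hx => ?_
        rw [LinearMap.mem_ker]
        refine main' κ x (g x) hx.2 ?_ ?_
        · simp [g, Module.algebraMap_end_apply]
        · have h1 : g (g x) = 0 := hx.1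
          have h2 : h (g x) = a • g x + g (g x) := by simp [g, Module.algebraMap_end_apply]
          rw [h2, h1, add_zero]
      · rw [LinearMap.mem_ker] at hx ⊢
        rw [← Module.End.mul_apply, ← (hcg.mul_right hcg).eq, Module.End.mul_apply, hx, map_zero]
    rw [hgw]
    exact hle hvp
  have hsq : LinearMap.ker ((h - a • (1 : Module.End ℂ W)) * (h - a • (1 : Module.End ℂ W))) ≤
      LinearMap.ker (h - a • (1 : Module.End ℂ W)) := by
    intro x hx
    refine main x _ ?_ ?_
    · simp
    · have : (h - a • (1 : Module.End ℂ W)) ((h - a • (1 : Module.End ℂ W)) x) = 0 := hx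
      rw [LinearMap.sub_apply, sub_eq_zero] at this
      simpa using this
  intro x hx
  obtain ⟨n, hn⟩ := (Module.End.mem_maxGenEigenspace _ _ _).mp hx
  rw [Module.End.mem_eigenspace_iff]
  have hn1 : ∀ n : ℕ, ((h - a • (1 : Module.End ℂ W)) ^ n) x = 0 →
      (h - a • (1 : Module.End ℂ W)) x = 0 := by
    intro n
    induction n with
    | zero => intro h0; rw [show x = 0 from h0, map_zero]
    | succ n ih =>
      intro h1
      rcases n with _ | n
      · simpa using h1
      · refine ih ?_
        rw [pow_succ' _ (n + 1), pow_succ'] at h1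
        rw [pow_succ']
        exact hsq h1
  have := hn1 n hn
  rw [LinearMap.sub_apply, sub_eq_zero] at this
  simpa using this

end SlTwo

/-! ### Weight spaces of families of operators -/

section WeightSpaces

variable {𝔞 X : Type*} [AddCommGroup 𝔞] [Module ℂ 𝔞] [AddCommGroup X] [Module ℂ X]

/-- The joint eigenspace of the operators `T H` with eigenvalues `λ(H)`. -/
def wtSpace (T : 𝔞 → Module.End ℂ X) (lam : Module.Dual ℂ 𝔞) : Submodule ℂ X :=
  ⨅ H, (T H).eigenspace (lam H)

theorem mem_wtSpace {T : 𝔞 → Module.End ℂ X} {lam : Module.Dual ℂ 𝔞} {x : X} :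
    x ∈ wtSpace T lam ↔ ∀ H, T H x = lam H • x := by
  simp [wtSpace]

theorem iSupIndep_wtSpace {T : 𝔞 → Module.End ℂ X} (hT : ∀ H K, Commute (T H) (T K)) :
    iSupIndep (wtSpace T) := by
  have h1 := Module.End.independent_iInf_maxGenEigenspace_of_forall_mapsTo T
    fun i j φ => Module.End.mapsTo_maxGenEigenspace_of_comm (hT j i) φ
  have h2 := h1.comp (f := fun lam : Module.Dual ℂ 𝔞 => (lam : 𝔞 → ℂ)) DFunLike.coe_injective
  exact h2.mono fun lam => iInf_mono fun H => (T H).genEigenspace _ |>.mono le_top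

/-- The span of all `T H x - λ(H) x`. -/
def wtCoinv (T : 𝔞 → Module.End ℂ X) (lam : Module.Dual ℂ 𝔞) : Submodule ℂ X :=
  Submodule.span ℂ {y | ∃ H x, y = T H x - lam H • x}

/-- If `X` is the sum of its weight spaces for `λ ∈ S`, then it is the direct sum of its
`λ`-coinvariants. -/
theorem nonempty_equiv_directSum_wtCoinv (T : 𝔞 → Module.End ℂ X) (S : Set (Module.Dual ℂ 𝔞))
    (hT : ∀ H K, Commute (T H) (T K)) (hS : ⨆ lam : S, wtSpace T lam = ⊤) :
    Nonempty (X ≃ₗ[ℂ] DirectSum S fun lam => X ⧸ wtCoinv T lam) := by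
  classical
  have hind : iSupIndep fun lam : S => wtSpace T lam :=
    (iSupIndep_wtSpace hT).comp Subtype.val_injective
  have hint : DirectSum.IsInternal fun lam : S => wtSpace T lam :=
    (DirectSum.isInternal_submodule_iff_iSupIndep_and_iSup_eq_top _).mpr ⟨hind, hS⟩
  -- On a weight space for $\mu\ne\lambda$ some $T_H-\lambda(H)$ is a nonzero scalar, while on the
  -- $\lambda$-space all of them vanish. So $\lambda$-coinvariants remove exactly the other weight
  -- spaces.
  have hco : ∀ lam : S, wtCoinv T lam = ⨆ (mu : S) (_ : mu ≠ lam), wtSpace T mu := by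
    intro lam
    refine le_antisymm (Submodule.span_le.mpr ?_) (iSup₂_le fun mu hmu x hx => ?_)
    · rintro _ ⟨H, x, rfl⟩
      have hx : x ∈ ⨆ lam : S, wtSpace T lam := hS ▸ Submodule.mem_top
      induction hx using Submodule.iSup_induction' with
      | mem mu x hx =>
        rw [SetLike.mem_coe, mem_wtSpace.mp hx H, ← sub_smul]
        by_cases h : mu = lam
        · rw [h, sub_self, zero_smul]; exact zero_mem _
        · exact Submodule.smul_mem _ _ (Submodule.mem_iSup_of_mem mu (Submodule.mem_iSup_of_mem h hx))
      | zero => simp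
      | add x y _ _ hx hy =>
        rw [map_add, smul_add, add_sub_add_comm]
        exact add_mem hx hy
    · obtain ⟨H, hH⟩ : ∃ H, (mu : Module.Dual ℂ 𝔞) H ≠ (lam : Module.Dual ℂ 𝔞) H := by
        by_contra! h
        exact hmu (Subtype.ext (LinearMap.ext h))
      have h1 : x = ((mu : Module.Dual ℂ 𝔞) H - (lam : Module.Dual ℂ 𝔞) H)⁻¹ •
          (T H x - (lam : Module.Dual ℂ 𝔞) H • x) := by
        rw [mem_wtSpace.mp hx H, ← sub_smul, smul_smul, inv_mul_cancel₀ (sub_ne_zero.mpr hH),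
          one_smul]
      rw [h1]
      exact Submodule.smul_mem _ _ (Submodule.subset_span ⟨H, x, rfl⟩)
  have hcompl : ∀ lam : S, IsCompl (wtCoinv T lam) (wtSpace T lam) := by
    intro lam
    rw [hco]
    refine (IsCompl.symm ⟨hind lam, codisjoint_iff.mpr (top_unique ?_)⟩)
    rw [← hS]
    refine iSup_le fun mu => ?_
    by_cases h : mu = lam
    · rw [h]; exact le_sup_left
    · exact le_sup_of_le_right (le_iSup₂_of_le mu h le_rfl)
  exact ⟨(LinearEquiv.ofBijective (DirectSum.coeLinearMap _) hint).symm ≪≫ₗ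
    DFinsupp.mapRange.linearEquiv fun lam =>
      (Submodule.quotientEquivOfIsCompl _ _ (hcompl lam)).symm⟩

theorem wtSpace_iSup_eq_top_of_surjective {Y : Type*} [AddCommGroup Y] [Module ℂ Y]
    {T : 𝔞 → Module.End ℂ X} {T' : 𝔞 → Module.End ℂ Y} (q : X →ₗ[ℂ] Y)
    (hq : Function.Surjective q) (hqT : ∀ H x, q (T H x) = T' H (q x))
    {S : Set (Module.Dual ℂ 𝔞)} (hS : ⨆ lam : S, wtSpace T lam = ⊤) :
    ⨆ lam : S, wtSpace T' lam = ⊤ := by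
  rw [← top_le_iff, ← LinearMap.range_eq_top.mpr hq, LinearMap.range_eq_map, ← hS,
    Submodule.map_iSup]
  refine iSup_mono fun lam => ?_
  rintro _ ⟨x, hx, rfl⟩
  rw [mem_wtSpace]
  intro H
  rw [← hqT, mem_wtSpace.mp hx H, map_smul]

theorem iSup_wtSpace_ne_bot (T : 𝔞 → Module.End ℂ X) (h : ⨆ lam, wtSpace T lam = ⊤) :
    ⨆ lam : {lam | wtSpace T lam ≠ ⊥}, wtSpace T lam = ⊤ := by
  rw [← h]
  exact iSup_ne_bot_subtype _

end WeightSpaces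

/-! ### Operators on tensor products acting on one factor -/

section Tensor

variable {L : ℕ} {W : Fin L → Type*} [∀ i, AddCommGroup (W i)] [∀ i, Module ℂ (W i)]

theorem actFactor_tprod (i : Fin L) (a : Module.End ℂ (W i)) (x : ∀ i, W i) :
    actFactor i a (PiTensorProduct.tprod ℂ x) =
      PiTensorProduct.tprod ℂ (Function.update x i (a (x i))) := by
  rw [actFactor, PiTensorProduct.map_tprod]
  congr 1
  ext j
  by_cases h : j = i
  · subst h; simp
  · simp [h]

theorem actFactor_commute {i j : Fin L} (hij : i ≠ j) (a : Module.End ℂ (W i))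
    (b : Module.End ℂ (W j)) : Commute (actFactor i a) (actFactor j b) := by
  refine PiTensorProduct.ext (MultilinearMap.ext fun x => ?_)
  simp only [LinearMap.compMultilinearMap_apply, Module.End.mul_apply, actFactor_tprod]
  rw [Function.update_comm hij, Function.update_of_ne hij, Function.update_of_ne hij.symm]

theorem actFactor_mul (i : Fin L) (a b : Module.End ℂ (W i)) :
    actFactor i (a * b) = actFactor i a * actFactor i b := by
  refine PiTensorProduct.ext (MultilinearMap.ext fun x => ?_)
  simp only [LinearMap.compMultilinearMap_apply, Module.End.mul_apply, actFactor_tprod]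
  simp

theorem actFactor_one (i : Fin L) : actFactor i (1 : Module.End ℂ (W i)) = 1 := by
  refine PiTensorProduct.ext (MultilinearMap.ext fun x => ?_)
  simp only [LinearMap.compMultilinearMap_apply, actFactor_tprod]
  simp

variable (W) in
/-- `actFactor i` as a linear map. -/
def actFactorₗ (i : Fin L) : Module.End ℂ (W i) →ₗ[ℂ] Module.End ℂ (⨂[ℂ] j, W j) where
  toFun := actFactor i
  map_add' a b := PiTensorProduct.map_update_add _ i a b
  map_smul' c a := PiTensorProduct.map_update_smul _ i c a

/-- The commutator of two sums of one-factor operators is computed factor by factor. -/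
theorem sum_actFactor_commutator (a b : ∀ i, Module.End ℂ (W i)) :
    (∑ i, actFactor i (a i)) * (∑ i, actFactor i (b i)) -
      (∑ i, actFactor i (b i)) * (∑ i, actFactor i (a i)) =
      ∑ i, actFactor i (a i * b i - b i * a i) := by
  have h : ∀ i j, actFactor i (a i) * actFactor j (b j) - actFactor j (b j) * actFactor i (a i) =
      if i = j then actFactor i (a i * b i - b i * a i) else 0 := by
    intro i j
    split_ifs with hij
    · subst hij
      change _ = actFactorₗ W i _
      rw [map_sub]
      change _ = actFactor i _ - actFactor i _
      rw [actFactor_mul, actFactor_mul]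
    · exact sub_eq_zero.mpr (actFactor_commute hij _ _)
  rw [Finset.sum_mul_sum, Finset.sum_mul_sum, Finset.sum_comm (s := Finset.univ) (t := Finset.univ)
    (f := fun i j => actFactor i (b i) * actFactor j (a j)), ← Finset.sum_sub_distrib]
  refine Finset.sum_congr rfl fun i _ => ?_
  rw [← Finset.sum_sub_distrib, Finset.sum_congr rfl fun j _ => h i j]
  simp

/-- A submodule containing all pure tensors with factors in spanning sets is everything. -/
theorem tensor_eq_top_of_tprod_mem (P : Submodule ℂ (⨂[ℂ] i, W i)) (s : ∀ i, Set (W i))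
    (hs : ∀ i, Submodule.span ℂ (s i) = ⊤)
    (h : ∀ x : ∀ i, W i, (∀ i, x i ∈ s i) → PiTensorProduct.tprod ℂ x ∈ P) : P = ⊤ := by
  rw [← top_le_iff, ← PiTensorProduct.submodule_span_eq_top
    (g := fun i => (Subtype.val : s i → W i)) fun i => by rw [Subtype.range_coe]; exact hs i,
    Submodule.span_le]
  rintro _ ⟨x, rfl⟩
  exact h _ fun i => (x i).2

/-- Weights add: pure tensors of weight vectors are weight vectors, and they span. -/
theorem iSup_wtSpace_tensor {𝔞 : Type*} [AddCommGroup 𝔞] [Module ℂ 𝔞]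
    (T : ∀ i, 𝔞 → Module.End ℂ (W i)) (hT : ∀ i, ⨆ lam, wtSpace (T i) lam = ⊤) :
    ⨆ lam, wtSpace (fun H => ∑ i, actFactor i (T i H)) lam = ⊤ := by
  refine tensor_eq_top_of_tprod_mem _ (fun i => ⋃ lam, (wtSpace (T i) lam : Set (W i)))
    (fun i => ?_) fun x hx => ?_
  · rw [Submodule.span_iUnion, ← hT i]
    exact iSup_congr fun lam => Submodule.span_eq _
  · choose lam hlam using fun i => Set.mem_iUnion.mp (hx i)
    refine Submodule.mem_iSup_of_mem (∑ i, lam i) (mem_wtSpace.mpr fun H => ?_)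
    rw [LinearMap.sum_apply, LinearMap.sum_apply, Finset.sum_smul]
    refine Finset.sum_congr rfl fun i _ => ?_
    rw [actFactor_tprod, mem_wtSpace.mp (hlam i) H, MultilinearMap.map_update_smul,
      Function.update_eq_self]

end Tensor

/-! ### Diagonalizability of the Cartan subalgebra on finite-dimensional representations -/

section SlRep

/-- For $i\ne0$ the matrix $E_{ii}-E_{00}$ is the Cartan generator of the $\mathfrak{sl}_2$-triple
with $E_{i0}$ and $E_{0i}$, hence acts semisimply. These matrices commute, and
$H=\sum_iH_{ii}(E_{ii}-E_{00})$ because the trace of $H$ is zero, so their joint eigenvectors are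
weight vectors. -/
theorem iSup_wtSpace_sl {N : ℕ} {W : Type*} [AddCommGroup W] [Module ℂ W] [FiniteDimensional ℂ W]
    (ρ : sl N ℂ →ₗ⁅ℂ⁆ Module.End ℂ W) :
    ⨆ lam, wtSpace (fun H : cartan N => ρ ⟨(H : Mat N ℂ), H.2.2⟩) lam = ⊤ := by
  rcases N with _ | N
  · refine top_unique (le_iSup_of_le 0 fun x _ => mem_wtSpace.mpr fun H => ?_)
    have : (⟨(H : Mat 0 ℂ), H.2.2⟩ : sl 0 ℂ) = 0 := Subsingleton.elim _ _
    rw [this, map_zero]; simp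
  have hsl : ∀ {A : Mat (N + 1) ℂ}, A ∈ sl (N + 1) ℂ ↔ A.trace = 0 := Iff.rfl
  let E : Fin (N + 1) → Fin (N + 1) → Mat (N + 1) ℂ := fun i j => Matrix.single i j 1
  have hH : ∀ i, E i i - E 0 0 ∈ sl (N + 1) ℂ := fun i => by
    rw [hsl]; simp [E, Matrix.trace_sub]
  let T : Fin (N + 1) → Module.End ℂ W := fun i => ρ ⟨E i i - E 0 0, hH i⟩
  have hss : ∀ i a, (T i).maxGenEigenspace a ≤ (T i).eigenspace a := by
    intro i a
    by_cases hi : i = 0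
    · have h0 : T i = 0 := by
        have : (⟨E i i - E 0 0, hH i⟩ : sl (N + 1) ℂ) = 0 := Subtype.ext (by simp [hi])
        change ρ _ = 0
        rw [this, map_zero]
      rw [h0]
      exact slTwo_maxGenEigenspace_le (e := 0) (f := 0) (by simp) (by simp) (by simp) a
    · have he : E i 0 ∈ sl (N + 1) ℂ := by rw [hsl]; simp [E, hi]
      have hf : E 0 i ∈ sl (N + 1) ℂ := by rw [hsl]; simp [E, Ne.symm hi]
      have hbr : ∀ x y : sl (N + 1) ℂ, ρ x * ρ y - ρ y * ρ x = ρ ⁅x, y⁆ := fun x y => by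
        rw [LieHom.map_lie]; rfl
      refine slTwo_maxGenEigenspace_le (e := ρ ⟨E i 0, he⟩) (f := ρ ⟨E 0 i, hf⟩) ?_ ?_ ?_ a
      · rw [hbr]
        refine congrArg ρ (Subtype.ext ?_)
        change E i 0 * E 0 i - E 0 i * E i 0 = _
        simp [E]
      · rw [hbr, ← map_smul]
        refine congrArg ρ (Subtype.ext ?_)
        change (E i i - E 0 0) * E i 0 - E i 0 * (E i i - E 0 0) = (2 : ℂ) • E i 0
        simp [E, sub_mul, mul_sub, Ne.symm hi, two_smul]
      · rw [hbr, ← map_smul]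
        refine congrArg ρ (Subtype.ext ?_)
        change (E i i - E 0 0) * E 0 i - E 0 i * (E i i - E 0 0) = (-2 : ℂ) • E 0 i
        simp [E, sub_mul, mul_sub, hi, two_smul]
        abel
  have hcomm : Pairwise fun i j => Commute (T i) (T j) := by
    intro i j _
    change _ = _
    rw [← sub_eq_zero]
    have : ρ ⁅(⟨E i i - E 0 0, hH i⟩ : sl (N + 1) ℂ), ⟨E j j - E 0 0, hH j⟩⁆ = 0 := by
      rw [← map_zero ρ]
      refine congrArg ρ (Subtype.ext ?_)
      change (E i i - E 0 0) * (E j j - E 0 0) - (E j j - E 0 0) * (E i i - E 0 0) = 0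
      have hd : ∀ i, E i i = Matrix.diagonal (Pi.single i 1) := fun i => by
        ext a b; simp [E, Matrix.single, Matrix.diagonal, Pi.single_apply]; grind
      have hc : ∀ i j, Commute (E i i) (E j j) := fun i j => by
        rw [hd, hd]; exact Matrix.commute_diagonal _ _
      exact sub_eq_zero.mpr (((hc i j).sub_right (hc i 0)).sub_left ((hc 0 j).sub_right (hc 0 0)))
    rw [LieHom.map_lie] at this
    exact this
  have htop := Module.End.iSup_iInf_maxGenEigenspace_eq_top_of_iSup_maxGenEigenspace_eq_top_of_commute
    T hcomm fun i => Module.End.iSup_maxGenEigenspace_eq_top (T i)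
  rw [← top_le_iff, ← htop]
  refine iSup_le fun χ => ?_
  -- The joint eigenvalues `χ`, extended linearly along the decomposition of `H` into the
  -- $E_{ii}-E_{00}$.
  let lam : Module.Dual ℂ (cartan (N + 1)) :=
    { toFun := fun H => ∑ i, (H : Mat (N + 1) ℂ) i i * χ i
      map_add' := fun H K => by simp [add_mul, Finset.sum_add_distrib]
      map_smul' := fun c H => by simp [Finset.mul_sum, mul_assoc] }
  refine le_iSup_of_le lam fun x hx => mem_wtSpace.mpr fun H => ?_
  have hx' : ∀ i, T i x = χ i • x := fun i =>
    Module.End.mem_eigenspace_iff.mp (hss i _ ((Submodule.mem_iInf _).mp hx i))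
  have hdec : (⟨(H : Mat (N + 1) ℂ), H.2.2⟩ : sl (N + 1) ℂ) =
      ∑ i, (H : Mat (N + 1) ℂ) i i • ⟨E i i - E 0 0, hH i⟩ := by
    apply Subtype.ext
    rw [AddSubmonoidClass.coe_finsetSum]
    change (H : Mat (N + 1) ℂ) = ∑ i, (H : Mat (N + 1) ℂ) i i • (E i i - E 0 0)
    have htr : ∑ i, (H : Mat (N + 1) ℂ) i i = 0 := H.2.2
    simp only [smul_sub, Finset.sum_sub_distrib, ← Finset.sum_smul, htr, zero_smul, sub_zero]
    conv_lhs => rw [← H.2.1.diagonal_diag]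
    ext a b
    rw [Matrix.sum_apply]
    by_cases hab : a = b
    · subst hab; simp [E, Matrix.single_apply]
    · rw [Matrix.diagonal_apply_ne _ hab, Finset.sum_eq_zero]
      intro c _
      simp only [E, Matrix.smul_apply, Matrix.single_apply]
      rw [if_neg (by rintro ⟨rfl, rfl⟩; exact hab rfl), smul_zero]
  rw [hdec, map_sum, LinearMap.sum_apply]
  change _ = (∑ i, (H : Mat (N + 1) ℂ) i i * χ i) • x
  rw [Finset.sum_smul]
  refine Finset.sum_congr rfl fun i _ => ?_
  rw [map_smul, LinearMap.smul_apply, mul_smul]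
  exact congrArg _ (hx' i)

end SlRep

/-! ### Orders of Laurent series -/

section Order

/-- Laurent series of order at least `n`. -/
def ordGE (n : ℤ) : Submodule ℂ (LaurentSeries ℂ) where
  carrier := {f | ∀ m < n, f.coeff m = 0}
  add_mem' {f g} hf hg m hm := by rw [HahnSeries.coeff_add, hf m hm, hg m hm, add_zero]
  zero_mem' _ _ := rfl
  smul_mem' c f hf m hm := by
    have : (c • f).coeff m = c • f.coeff m := HahnSeries.coeff_smul ..
    rw [this, hf m hm, smul_zero]

theorem ordGE_anti {m n : ℤ} (h : m ≤ n) : ordGE n ≤ ordGE m :=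
  fun _ hf _ hk => hf _ (hk.trans_le h)

theorem mem_regular_iff {f : LaurentSeries ℂ} : f ∈ regular ↔ f ∈ ordGE 0 := Iff.rfl

theorem mul_mem_ordGE {f g : LaurentSeries ℂ} {m n k : ℤ} (hf : f ∈ ordGE m) (hg : g ∈ ordGE n)
    (hk : k ≤ m + n) : f * g ∈ ordGE k := by
  intro l hl
  rw [HahnSeries.coeff_mul]
  refine Finset.sum_eq_zero fun p hp => ?_
  rw [Finset.mem_antidiagonal] at hp
  by_cases h : p.1 < m
  · rw [hf _ h, zero_mul]
  · rw [hg _ (by omega), mul_zero]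

theorem pow_mem_ordGE {f : LaurentSeries ℂ} {m : ℤ} (hf : f ∈ ordGE m) (n : ℕ) :
    f ^ n ∈ ordGE (n * m) := by
  induction n with
  | zero =>
    rw [pow_zero, Nat.cast_zero, zero_mul]
    exact mem_regular_iff.mp (one_mem regular)
  | succ n ih =>
    rw [pow_succ]
    refine mul_mem_ordGE ih hf ?_
    push_cast
    linarith

theorem single_mem_ordGE {n k : ℤ} (h : k ≤ n) (a : ℂ) :
    (HahnSeries.single n a : LaurentSeries ℂ) ∈ ordGE k :=
  fun _ hm => HahnSeries.coeff_single_of_ne (hm.trans_le h).ne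

theorem mem_ordGE_order (f : LaurentSeries ℂ) : f ∈ ordGE f.order :=
  fun _ hm => HahnSeries.coeff_eq_zero_of_lt_order hm

theorem D_mem_ordGE {f : LaurentSeries ℂ} {m k : ℤ} (hf : f ∈ ordGE m) (hk : k ≤ m - 1) :
    D f ∈ ordGE k := by
  intro l hl
  rw [coeff_D, hf _ (by omega), mul_zero]

theorem inv_mem_ordGE {f : LaurentSeries ℂ} {n : ℤ} (hn : f.coeff n ≠ 0) (hf : f ∈ ordGE n) :
    f⁻¹ ∈ ordGE (-n) := by
  have h0 : f ≠ 0 := by rintro rfl; exact hn rfl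
  have h1 : f.order = n := le_antisymm (HahnSeries.order_le_of_coeff_ne_zero hn) (by
    by_contra! h
    exact HahnSeries.coeff_order_eq_zero.not.mpr h0 (hf _ h))
  have h2 := HahnSeries.order_mul h0 (inv_ne_zero h0)
  rw [mul_inv_cancel₀ h0, HahnSeries.order_one, h1] at h2
  have h3 : -n = (f⁻¹).order := by omega
  rw [h3]
  exact mem_ordGE_order _

theorem res_eq_zero {f : LaurentSeries ℂ} (hf : f ∈ ordGE 0) : res f = 0 := hf _ (by omega)

theorem single_one_zpow (n : ℤ) :
    (HahnSeries.single 1 1 : LaurentSeries ℂ) ^ n = HahnSeries.single n 1 := by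
  exact (RatFunc.single_zpow n).symm

theorem scale_coeff (z : ℂˣ) (f : LaurentSeries ℂ) (n : ℤ) :
    (scale z f).coeff n = ((z ^ n : ℂˣ) : ℂ) * f.coeff n := rfl

theorem D_scale (z : ℂˣ) (f : LaurentSeries ℂ) : D (scale z f) = (z : ℂ) • scale z (D f) := by
  ext n
  have : ((z : ℂ) • scale z (D f)).coeff n = (z : ℂ) • (scale z (D f)).coeff n :=
    HahnSeries.coeff_smul ..
  rw [this, coeff_D, scale_coeff, scale_coeff, coeff_D, zpow_add, zpow_one, Units.val_mul,
    smul_eq_mul]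
  ring

end Order

/-! ### Expansions of rational functions -/

section Expand

theorem expand_X (P : OnePoint ℂ) : expand P RatFunc.X = coordAt P := subst_X _ _

theorem expand_algebraMap (P : OnePoint ℂ) (r : ℂ) :
    expand P (algebraMap ℂ (RatFunc ℂ) r) = HahnSeries.C r := (expand P).commutes r

theorem expand_injective (P : OnePoint ℂ) : Function.Injective (expand P) :=
  (expand P).toRingHom.injective

theorem coordAt_coe (c : ℂ) : coordAt (c : OnePoint ℂ) = HahnSeries.C c + HahnSeries.single 1 1 :=
  rfl

theorem coordAt_infty : coordAt OnePoint.infty = HahnSeries.single (-1) 1 := rfl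

/-- The rational function `t - a`. -/
abbrev XsubC (a : ℂ) : RatFunc ℂ := RatFunc.X - algebraMap ℂ (RatFunc ℂ) a

theorem expand_XsubC (c a : ℂ) : expand c (XsubC a) =
    HahnSeries.C (c - a) + HahnSeries.single 1 1 := by
  rw [map_sub, expand_X, expand_algebraMap, coordAt_coe, map_sub]
  ring

theorem expand_XsubC_self (c : ℂ) : expand c (XsubC c) = HahnSeries.single 1 1 := by
  rw [expand_XsubC, sub_self, map_zero, zero_add]

theorem C_add_single_mem (a : ℂ) :
    (HahnSeries.C a + HahnSeries.single 1 1 : LaurentSeries ℂ) ∈ regular :=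
  add_mem (regular.algebraMap_mem a) (single_mem_ordGE zero_le_one 1)

theorem expand_X_mem_regular (c : ℂ) : expand c RatFunc.X ∈ regular := by
  rw [expand_X]; exact C_add_single_mem c

theorem expand_XsubC_inv_mem_regular {c a : ℂ} (h : c ≠ a) : expand c (XsubC a)⁻¹ ∈ regular := by
  rw [map_inv₀, expand_XsubC, mem_regular_iff, ← neg_zero]
  refine inv_mem_ordGE ?_ (C_add_single_mem _)
  rw [HahnSeries.coeff_add, HahnSeries.C_apply, HahnSeries.coeff_single_same,
    HahnSeries.coeff_single_of_ne zero_ne_one, add_zero]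
  exact sub_ne_zero.mpr h

theorem expand_infty_XsubC (a : ℂ) : expand OnePoint.infty (XsubC a) =
    HahnSeries.single (-1) 1 - HahnSeries.C a := by
  rw [map_sub, expand_X, expand_algebraMap, coordAt_infty]

theorem expand_infty_XsubC_inv_mem (a : ℂ) : expand OnePoint.infty (XsubC a)⁻¹ ∈ ordGE 1 := by
  rw [map_inv₀, expand_infty_XsubC]
  refine inv_mem_ordGE (n := -1) ?_ (sub_mem (single_mem_ordGE le_rfl 1)
    (single_mem_ordGE (n := 0) (by norm_num) a))
  rw [HahnSeries.coeff_sub, HahnSeries.coeff_single_same,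
    HahnSeries.coeff_single_of_ne (by norm_num)]
  norm_num

/-- The truncation `∑ g_m x ^ m`, `a ≤ m < b`, of a Laurent series `g`, evaluated at a rational
function `x`. -/
def truncAt (x : RatFunc ℂ) (a b : ℤ) : LaurentSeries ℂ →ₗ[ℂ] RatFunc ℂ where
  toFun g := ∑ m ∈ Finset.Ico a b, g.coeff m • x ^ m
  map_add' f g := by simp [add_smul, Finset.sum_add_distrib]
  map_smul' c g := by
    rw [Finset.smul_sum]
    refine Finset.sum_congr rfl fun m _ => ?_
    have : (c • g).coeff m = c • g.coeff m := HahnSeries.coeff_smul ..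
    rw [this, smul_assoc]; rfl

theorem truncAt_apply (x : RatFunc ℂ) (a b : ℤ) (g : LaurentSeries ℂ) :
    truncAt x a b g = ∑ m ∈ Finset.Ico a b, g.coeff m • x ^ m := rfl

/-- The hypothesis says that `x` expands to the local parameter at `P`, so a truncation turns the
terms of `g` below order `b` into a rational function. It is used with $t$ at $0$, $1/t$ at $\infty$
and $t-c$ at a finite point $c$. -/
theorem expand_truncAt_sub_mem {P : OnePoint ℂ} {x : RatFunc ℂ}
    (hx : expand P x = HahnSeries.single 1 1) {a b : ℤ} {g : LaurentSeries ℂ} (hg : g ∈ ordGE a) :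
    expand P (truncAt x a b g) - g ∈ ordGE b := by
  intro k hk
  have h1 : expand P (truncAt x a b g) =
      ∑ m ∈ Finset.Ico a b, HahnSeries.single m (g.coeff m) := by
    rw [truncAt_apply, map_sum]
    refine Finset.sum_congr rfl fun m _ => ?_
    rw [map_smul, map_zpow₀, hx, single_one_zpow]
    ext n
    have : (g.coeff m • (HahnSeries.single m 1 : LaurentSeries ℂ)).coeff n =
      g.coeff m • (HahnSeries.single m 1 : LaurentSeries ℂ).coeff n := HahnSeries.coeff_smul ..
    rw [this, HahnSeries.coeff_single, HahnSeries.coeff_single]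
    split_ifs <;> simp
  rw [h1, HahnSeries.coeff_sub, HahnSeries.coeff_sum]
  by_cases h : k ∈ Finset.Ico a b
  · rw [Finset.sum_eq_single_of_mem k h fun m _ hm => HahnSeries.coeff_single_of_ne hm.symm,
      HahnSeries.coeff_single_same, sub_self]
  · rw [Finset.sum_eq_zero fun m hm => HahnSeries.coeff_single_of_ne (by rintro rfl; exact h hm)]
    rw [Finset.mem_Ico] at h
    rw [hg k (by omega), sub_zero]

theorem expand_polynomial (c : ℂ) (p : Polynomial ℂ) :
    expand c (algebraMap _ _ p) ∈ regular ∧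
      (expand c (algebraMap _ _ p)).coeff 0 = p.eval c := by
  induction p using Polynomial.induction_on with
  | C a =>
    rw [show algebraMap (Polynomial ℂ) (RatFunc ℂ) (Polynomial.C a) =
      algebraMap ℂ (RatFunc ℂ) a from rfl, expand_algebraMap]
    exact ⟨regular.algebraMap_mem a, by simp⟩
  | add p q hp hq =>
    rw [map_add, map_add, HahnSeries.coeff_add, hp.2, hq.2, Polynomial.eval_add]
    exact ⟨add_mem hp.1 hq.1, rfl⟩
  | monomial n a h =>
    have h1 := expand_X_mem_regular c
    have h2 : (expand c RatFunc.X).coeff 0 = c := by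
      rw [expand_X, coordAt_coe]; simp
    rw [pow_succ, ← mul_assoc, map_mul, map_mul, RatFunc.algebraMap_X,
      regular_coeff_zero_mul h.1 h1, h.2, h2]
    exact ⟨mul_mem h.1 h1, by simp⟩

theorem expand_infty_polynomial (p : Polynomial ℂ) {n : ℤ} (hn : 0 < n) :
    (expand OnePoint.infty (algebraMap _ _ p)).coeff n = 0 := by
  induction p using Polynomial.induction_on' with
  | add p q hp hq => rw [map_add, map_add, HahnSeries.coeff_add, hp, hq, add_zero]
  | monomial m a =>
    rw [← Polynomial.C_mul_X_pow_eq_monomial, map_mul, map_pow, RatFunc.algebraMap_X, map_mul,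
      map_pow, expand_X, coordAt_infty,
      show algebraMap (Polynomial ℂ) (RatFunc ℂ) (Polynomial.C a) =
        algebraMap ℂ (RatFunc ℂ) a from rfl, expand_algebraMap, HahnSeries.single_pow,
      HahnSeries.C_mul_eq_smul, HahnSeries.coeff_smul, HahnSeries.coeff_single_of_ne, smul_zero]
    simp only [nsmul_eq_mul]
    omega

/-- At a root of the denominator, regularity would force the numerator to vanish as well, against
coprimality. -/
theorem eq_polynomial_of_regular {h : RatFunc ℂ} (hh : ∀ c : ℂ, expand c h ∈ regular) :
    ∃ p : Polynomial ℂ, h = algebraMap _ _ p := by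
  have hd : h.denom.degree = 0 := by
    by_contra hne
    obtain ⟨c, hc⟩ := IsAlgClosed.exists_root _ hne
    have h0 : algebraMap (Polynomial ℂ) (RatFunc ℂ) h.num = h * algebraMap _ _ h.denom := by
      have := div_mul_cancel₀ (algebraMap (Polynomial ℂ) (RatFunc ℂ) h.num)
        (RatFunc.algebraMap_ne_zero h.denom_ne_zero)
      rw [RatFunc.num_div_denom] at this
      exact this.symm
    have h1 := congrArg (fun x => (expand c x).coeff 0) h0
    simp only [map_mul] at h1
    rw [regular_coeff_zero_mul (hh c) (expand_polynomial c _).1, (expand_polynomial c _).2,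
      (expand_polynomial c _).2, hc.eq_zero, mul_zero] at h1
    obtain ⟨a, b, hab⟩ := h.isCoprime_num_denom
    have h2 := congrArg (Polynomial.eval c) hab
    simp [h1, hc.eq_zero] at h2
  have h1 : h.denom = 1 :=
    h.monic_denom.eq_one_of_isUnit (Polynomial.isUnit_iff_degree_eq_zero.mpr hd)
  refine ⟨h.num, ?_⟩
  conv_lhs => rw [← RatFunc.num_div_denom h, h1, map_one, div_one]

end Expand

/-! ### The residue theorem -/

section Residue

/-- A rational function `h` whose poles on the affine line lie in the finite set `S` has
`∑_{c ∈ S} Res_c h dt = -Res_∞ h dt`, the right-hand side being the coefficient of `1 / t` in the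
expansion of `h` at infinity. -/
theorem sum_res_eq (S : Finset ℂ) (h : RatFunc ℂ)
    (hS : ∀ c : ℂ, c ∉ S → expand c h ∈ regular) :
    ∑ c ∈ S, res (expand c h) = (expand OnePoint.infty h).coeff 1 := by
  induction S using Finset.induction_on generalizing h with
  | empty =>
    obtain ⟨p, rfl⟩ := eq_polynomial_of_regular fun c => hS c (Finset.notMem_empty c)
    rw [Finset.sum_empty, expand_infty_polynomial p one_pos]
  | insert c S hc ih =>
    -- The bound `a` is kept negative so that the exponent $-1$, which carries the residue, occurs
    -- in the principal part.
    obtain ⟨a, ha, hg⟩ : ∃ a < 0, expand c h ∈ ordGE a :=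
      ⟨min (-1) (expand c h).order, by omega, ordGE_anti (min_le_right _ _) (mem_ordGE_order _)⟩
    -- Subtracting the principal part at `c` removes that pole and creates no other, so the
    -- induction hypothesis applies to the difference.
    set R := truncAt (XsubC c) a 0 (expand c h) with hR
    have hRc : expand c (h - R) ∈ regular := by
      rw [map_sub, ← neg_sub]
      exact neg_mem (expand_truncAt_sub_mem (expand_XsubC_self c) hg)
    have hzpow : ∀ m ∈ Finset.Ico a 0, XsubC c ^ m = ((XsubC c)⁻¹) ^ (m.natAbs) := by
      intro m hm
      rw [Finset.mem_Ico] at hm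
      rw [← zpow_natCast, inv_zpow, ← zpow_neg]
      congr 1
      omega
    have hRd : ∀ d : ℂ, d ≠ c → expand d R ∈ regular := by
      intro d hd
      rw [hR, truncAt_apply, map_sum]
      refine sum_mem fun m hm => ?_
      rw [map_smul, hzpow m hm, map_pow]
      exact regular.smul_mem (pow_mem (expand_XsubC_inv_mem_regular hd) _) _
    -- At infinity $(t-c)^{-1}=1/t+\cdots$, whereas $(t-c)^m$ with $m\le-2$ vanishes to order at
    -- least two.
    have hRinf : (expand OnePoint.infty R).coeff 1 = res (expand c h) := by
      have h1 : ∀ m ∈ Finset.Ico a 0, (expand OnePoint.infty (XsubC c ^ m)).coeff 1 =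
          if m = -1 then 1 else 0 := by
        intro m hm
        rw [hzpow m hm, map_pow]
        have hm' := Finset.mem_Ico.mp hm
        have hy := expand_infty_XsubC_inv_mem c
        split_ifs with h
        · subst h
          rw [show Int.natAbs (-1) = 1 from rfl, pow_one]
          have h2 : expand OnePoint.infty (XsubC c) * expand OnePoint.infty (XsubC c)⁻¹ = 1 := by
            rw [← map_mul, mul_inv_cancel₀, map_one]
            intro h0
            have := congrArg (fun x => (expand OnePoint.infty x).coeff (-1)) h0
            simp only [expand_infty_XsubC, map_zero, HahnSeries.coeff_sub,
              HahnSeries.coeff_single_same, HahnSeries.C_apply] at this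
            rw [HahnSeries.coeff_single_of_ne (by norm_num)] at this
            simp at this
          have h3 := congrArg (fun x => x.coeff 0) h2
          simp only [expand_infty_XsubC, sub_mul, HahnSeries.coeff_sub] at h3
          have h4 := HahnSeries.coeff_single_mul_add (r := (1 : ℂ))
            (x := expand OnePoint.infty (XsubC c)⁻¹) (a := 1) (b := -1)
          rw [show (1 : ℤ) + -1 = 0 from rfl] at h4
          rw [h4, HahnSeries.C_mul_eq_smul, HahnSeries.coeff_smul, hy 0 one_pos] at h3
          simpa using h3
        · exact pow_mem_ordGE hy _ 1 (by omega)
      rw [hR, truncAt_apply, map_sum, HahnSeries.coeff_sum]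
      have h2 : ∀ m ∈ Finset.Ico a 0,
          (expand OnePoint.infty ((expand c h).coeff m • XsubC c ^ m)).coeff 1 =
          if m = -1 then (expand c h).coeff m else 0 := by
        intro m hm
        rw [map_smul]
        have : ((expand c h).coeff m • expand OnePoint.infty (XsubC c ^ m)).coeff 1 =
          (expand c h).coeff m • (expand OnePoint.infty (XsubC c ^ m)).coeff 1 :=
            HahnSeries.coeff_smul ..
        rw [this, h1 m hm]
        split_ifs <;> simp
      rw [Finset.sum_congr rfl h2, Finset.sum_ite_eq', if_pos (Finset.mem_Ico.mpr ⟨by omega, by omega⟩)]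
      rfl
    have h3 := ih (h - R) fun d hd => by
      by_cases hdc : d = c
      · rw [hdc]; exact hRc
      · rw [map_sub]
        exact sub_mem (hS d (by simp [hdc, hd])) (hRd d hdc)
    rw [Finset.sum_insert hc, ← hRinf, ← eq_sub_iff_add_eq', ← HahnSeries.coeff_sub, ← map_sub, ← h3]
    refine Finset.sum_congr rfl fun d hd => ?_
    rw [map_sub, map_sub, res_eq_zero (hRd d (by rintro rfl; exact hc hd)), sub_zero]

theorem D_C (a : ℂ) : D (HahnSeries.C a) = 0 := by
  ext n
  rw [coeff_D, HahnSeries.C_apply]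
  by_cases hn : n + 1 = 0
  · have : (n : ℂ) + 1 = 0 := by exact_mod_cast hn
    rw [this]; simp
  · rw [HahnSeries.coeff_single_of_ne hn]; simp

/-- Every rational function has a derivative, compatible with all expansions. -/
theorem exists_deriv (x : RatFunc ℂ) :
    ∃ y : RatFunc ℂ, ∀ P, D (expand P x) = expand P y * D (coordAt P) := by
  have hpoly : ∀ p : Polynomial ℂ, ∃ y : RatFunc ℂ, ∀ P,
      D (expand P (algebraMap _ _ p)) = expand P y * D (coordAt P) := by
    intro p
    induction p using Polynomial.induction_on with
    | C a =>
      refine ⟨0, fun P => ?_⟩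
      rw [show algebraMap (Polynomial ℂ) (RatFunc ℂ) (Polynomial.C a) =
        algebraMap ℂ (RatFunc ℂ) a from rfl, expand_algebraMap, D_C, map_zero, zero_mul]
    | add p q hp hq =>
      obtain ⟨y, hy⟩ := hp
      obtain ⟨z, hz⟩ := hq
      exact ⟨y + z, fun P => by rw [map_add, map_add, map_add, hy, hz, map_add, add_mul]⟩
    | monomial n a h =>
      obtain ⟨y, hy⟩ := h
      refine ⟨y * RatFunc.X + algebraMap _ _ (Polynomial.C a * Polynomial.X ^ n), fun P => ?_⟩
      rw [pow_succ, ← mul_assoc, map_mul, map_mul, D_mul, hy, RatFunc.algebraMap_X, map_add,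
        map_mul (expand P) y, expand_X]
      ring
  induction x using RatFunc.induction_on with
  | f p q hq =>
    obtain ⟨y, hy⟩ := hpoly p
    obtain ⟨z, hz⟩ := hpoly q
    have hq0 : algebraMap (Polynomial ℂ) (RatFunc ℂ) q ≠ 0 := RatFunc.algebraMap_ne_zero hq
    set u := algebraMap (Polynomial ℂ) (RatFunc ℂ) p
    set v := algebraMap (Polynomial ℂ) (RatFunc ℂ) q
    refine ⟨(y * v - u * z) / v ^ 2, fun P => ?_⟩
    have hv : expand P v ≠ 0 := fun h => hq0 (expand_injective P (by rw [h, map_zero]))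
    have h1 : D (expand P (u / v)) * expand P v + expand P (u / v) * D (expand P v) =
        D (expand P u) := by
      rw [← D_mul, ← map_mul, div_mul_cancel₀ _ hq0]
    rw [hy, hz, map_div₀] at h1
    rw [map_div₀ (expand P) u, map_div₀ (expand P) (y * v - u * z), map_sub, map_mul, map_mul, map_pow]
    have h2 : D (expand P u / expand P v) * expand P v = expand P y * D (coordAt P) -
        expand P u / expand P v * (expand P z * D (coordAt P)) := by
      rw [← h1]; ring
    rw [eq_div_of_mul_eq hv h2]
    field_simp

/-- The derivative of a rational function. -/
def ratDeriv (x : RatFunc ℂ) : RatFunc ℂ := (exists_deriv x).choose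

theorem D_expand (P : OnePoint ℂ) (x : RatFunc ℂ) :
    D (expand P x) = expand P (ratDeriv x) * D (coordAt P) := (exists_deriv x).choose_spec P

theorem D_coordAt_coe (c : ℂ) : D (coordAt c) = 1 := by
  rw [coordAt_coe, map_add, D_C, zero_add]
  ext n
  rw [coeff_D]
  by_cases hn : n = 0
  · subst hn; simp
  · rw [HahnSeries.coeff_single_of_ne (by omega), HahnSeries.coeff_one, if_neg hn, mul_zero]

/-- With $s=1/t$ one has $dt=-s^{-2}ds$; this is why the residue at infinity is minus a coefficient
of index $1$. -/
theorem D_coordAt_infty : D (coordAt OnePoint.infty) = HahnSeries.single (-2) (-1) := by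
  rw [coordAt_infty]
  ext n
  rw [coeff_D]
  by_cases hn : n = -2
  · subst hn
    rw [show (-2 : ℤ) + 1 = -1 from rfl, HahnSeries.coeff_single_same,
      HahnSeries.coeff_single_same]
    norm_num
  · rw [HahnSeries.coeff_single_of_ne (by omega), HahnSeries.coeff_single_of_ne hn, mul_zero]

theorem rotate_X (N : ℕ) : rotate N RatFunc.X = algebraMap ℂ (RatFunc ℂ) (eps N) * RatFunc.X :=
  subst_X _ _

/-- The substitution $t\mapsto\varepsilon t$ carries $t-\varepsilon c$ to $\varepsilon(t-c)$. -/
theorem expand_rotate (N : ℕ) (c : ℂ) (x : RatFunc ℂ) :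
    expand c (rotate N x) = scale (eps N) (expand ((eps N * c : ℂ) : OnePoint ℂ) x) := by
  have : (expand (c : OnePoint ℂ)).comp (rotate N) =
      (scale (eps N)).comp (expand ((eps N * c : ℂ) : OnePoint ℂ)) := by
    apply ratFunc_hom_ext
    rw [AlgHom.comp_apply, AlgHom.comp_apply, rotate_X, map_mul, expand_X, expand_X,
      expand_algebraMap, coordAt_coe, coordAt_coe]
    ext n
    rw [scale_coeff, HahnSeries.C_mul_eq_smul, HahnSeries.coeff_smul, HahnSeries.coeff_add,
      HahnSeries.coeff_add, HahnSeries.C_apply, HahnSeries.C_apply]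
    by_cases h0 : n = 0
    · subst h0
      simp
    · by_cases h1 : n = 1
      · subst h1; simp
      · rw [HahnSeries.coeff_single_of_ne h0, HahnSeries.coeff_single_of_ne h0,
          HahnSeries.coeff_single_of_ne h1]; simp
  exact DFunLike.congr_fun this x

theorem res_expand_rotate (N : ℕ) (c : ℂ) (x : RatFunc ℂ) :
    (eps N : ℂ) * res (expand c (rotate N x)) =
      res (expand ((eps N * c : ℂ) : OnePoint ℂ) x) := by
  rw [expand_rotate]
  change (eps N : ℂ) * ((eps N ^ (-1 : ℤ) : ℂˣ) * _) = _
  rw [← mul_assoc, ← Units.val_mul, zpow_neg_one, mul_inv_cancel, Units.val_one, one_mul]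
  rfl

theorem rotate_ratDeriv (N : ℕ) (x : RatFunc ℂ) :
    ratDeriv (rotate N x) = (eps N : ℂ) • rotate N (ratDeriv x) := by
  apply expand_injective ((0 : ℂ) : OnePoint ℂ)
  have h := D_expand ((0 : ℂ) : OnePoint ℂ) (rotate N x)
  rw [D_coordAt_coe, mul_one, expand_rotate, D_scale, D_expand, D_coordAt_coe, mul_one,
    ← expand_rotate] at h
  rw [← h, map_smul]

end Residue

/-! ### Equivariance, entry by entry -/

section Equivariance

/-- The eigenvalue of `Ad γ` on the `(j, k)` entry. -/
def gammaWt {N : ℕ} (j k : Fin N) : ℂˣ := (eps N)⁻¹ ^ (j : ℕ) * eps N ^ (k : ℕ)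

theorem Ad_gamma_apply {N : ℕ} {R : Type*} [CommRing R] [Algebra ℂ R] (A : Mat N R)
    (j k : Fin N) : Ad R (gamma N) A j k = (gammaWt j k : ℂ) • A j k := by
  have h1 : ((toR R (gamma N) : (Mat N R)ˣ) : Mat N R) =
      Matrix.diagonal fun i : Fin N => algebraMap ℂ R (((eps N)⁻¹ ^ (i : ℕ) : ℂˣ) : ℂ) := by
    ext a b
    change algebraMap ℂ R (Matrix.diagonal _ a b) = _
    by_cases h : a = b
    · subst h; simp
    · simp [Matrix.diagonal_apply_ne _ h]
  have h2 : ((toR R (gamma N)⁻¹ : (Mat N R)ˣ) : Mat N R) =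
      Matrix.diagonal fun i : Fin N => algebraMap ℂ R ((eps N ^ (i : ℕ) : ℂˣ) : ℂ) := by
    ext a b
    change algebraMap ℂ R (Matrix.diagonal _ a b) = _
    by_cases h : a = b
    · subst h; simp
    · simp [Matrix.diagonal_apply_ne _ h]
  change ((toR R (gamma N) : Mat N R) * A * ((toR R (gamma N))⁻¹ : (Mat N R)ˣ)) j k = _
  rw [toR_inv, h1, h2, Matrix.mul_diagonal, Matrix.diagonal_mul, gammaWt, Units.val_mul,
    Algebra.smul_def, map_mul]
  ring

theorem mem_meroOrb {N : ℕ} {f : Mat N (RatFunc ℂ)} : f ∈ meroOrb N ↔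
    f.trace = 0 ∧ ∀ j k, rotate N (f j k) = (gammaWt j k : ℂ) • f j k := by
  refine and_congr Iff.rfl ⟨fun h j k => ?_, fun h => ?_⟩
  · exact (congrFun (congrFun h j) k).trans (Ad_gamma_apply _ j k)
  · ext1 j k
    exact (h j k).trans (Ad_gamma_apply _ j k).symm

theorem mem_twLoop {N : ℕ} {z : ℂˣ} {A : Mat N (LaurentSeries ℂ)} : A ∈ twLoop N z ↔
    A.trace = 0 ∧ ∀ j k, scale z (A j k) = (gammaWt j k : ℂ) • A j k := by
  refine and_congr Iff.rfl ⟨fun h j k => ?_, fun h => ?_⟩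
  · exact (congrFun (congrFun h j) k).trans (Ad_gamma_apply _ j k)
  · ext1 j k
    exact (h j k).trans (Ad_gamma_apply (R := LaurentSeries ℂ) A j k).symm

variable {N : ℕ}

theorem isPrimitiveRoot_eps (hN : N ≠ 0) : IsPrimitiveRoot (eps N : ℂ) N :=
  Complex.isPrimitiveRoot_exp N hN

theorem gammaWt_self (j : Fin N) : gammaWt j j = 1 := by
  rw [gammaWt, ← mul_pow, inv_mul_cancel, one_pow]

theorem gammaWt_mul_gammaWt (j k : Fin N) : gammaWt j k * gammaWt k j = 1 := by
  rw [gammaWt, gammaWt, inv_pow, inv_pow, mul_mul_mul_comm, mul_comm (eps N ^ (k : ℕ)),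
    mul_mul_mul_comm, inv_mul_cancel, inv_mul_cancel, one_mul]

theorem eps_pow (hN : N ≠ 0) : eps N ^ N = 1 :=
  Units.ext (by simpa using (isPrimitiveRoot_eps hN).pow_eq_one)

theorem gammaWt_pow (j k : Fin N) : gammaWt j k ^ N = 1 := by
  have hN : N ≠ 0 := j.pos.ne'
  rw [gammaWt, mul_pow, ← pow_mul, ← pow_mul, mul_comm _ N, mul_comm _ N, pow_mul, pow_mul,
    inv_pow, eps_pow hN]
  simp

theorem gammaWt_ne_one {j k : Fin N} (h : j ≠ k) : gammaWt j k ≠ 1 := by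
  intro h1
  have hN : N ≠ 0 := j.pos.ne'
  rw [gammaWt, inv_pow, inv_mul_eq_one] at h1
  have h2 : (eps N : ℂ) ^ (j : ℕ) = (eps N : ℂ) ^ (k : ℕ) := by
    have := congrArg Units.val h1
    simpa using this
  exact h (Fin.ext ((isPrimitiveRoot_eps hN).pow_inj j.2 k.2 h2))

/-- The constant term of a twisted loop lies in the Cartan subalgebra. -/
theorem map_coeff_zero_mem_cartan {z : ℂˣ} {A : Mat N (LaurentSeries ℂ)} (hA : A ∈ twLoop N z) :
    A.map (fun x => x.coeff 0) ∈ cartan N := by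
  rw [mem_twLoop] at hA
  refine ⟨fun j k hjk => ?_, ?_⟩
  · have h := congrArg (fun x => x.coeff 0) (hA.2 j k)
    change (scale z (A j k)).coeff 0 = _ at h
    rw [scale_coeff] at h
    change (A j k).coeff 0 = 0
    have h1 : ((gammaWt j k : ℂ) • A j k).coeff 0 = (gammaWt j k : ℂ) • (A j k).coeff 0 :=
      HahnSeries.coeff_smul ..
    rw [h1, zpow_zero, Units.val_one, smul_eq_mul, ← sub_eq_zero, ← sub_mul, mul_eq_zero] at h
    refine h.resolve_left fun h2 => gammaWt_ne_one hjk (Units.ext ?_)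
    exact (sub_eq_zero.mp h2).symm
  · have h := congrArg (fun x => x.coeff 0) hA.1
    simpa [Matrix.trace] using h

theorem valueAt_zero_mem_cartan (f : meroOrb N) :
    valueAt ((0 : ℂ) : OnePoint ℂ) (f : Mat N (RatFunc ℂ)) ∈ cartan N :=
  map_coeff_zero_mem_cartan (germZero N f).1.2

theorem valueAt_infty_mem_cartan (f : meroOrb N) :
    valueAt OnePoint.infty (f : Mat N (RatFunc ℂ)) ∈ cartan N :=
  map_coeff_zero_mem_cartan (germInfty N f).1.2

/-- A Cartan element as a constant section. -/
def constSec (H : cartan N) : meroOrb N :=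
  ⟨(H : Mat N ℂ).map (algebraMap ℂ (RatFunc ℂ)), mem_meroOrb.mpr ⟨by
    have := congrArg (algebraMap ℂ (RatFunc ℂ)) H.2.2
    simpa [Matrix.trace] using this, fun j k => by
    rw [Matrix.map_apply, AlgHom.commutes]
    by_cases h : j = k
    · rw [h, gammaWt_self, Units.val_one, one_smul]
    · rw [H.2.1 h, map_zero, smul_zero]⟩⟩

theorem constSec_apply (H : cartan N) (j k : Fin N) :
    (constSec H : Mat N (RatFunc ℂ)) j k = algebraMap ℂ (RatFunc ℂ) ((H : Mat N ℂ) j k) := rfl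

theorem holoAt_constSec (H : cartan N) (P : OnePoint ℂ) :
    HoloAt P (constSec H : Mat N (RatFunc ℂ)) := fun j k => by
  rw [constSec_apply, expand_algebraMap]
  exact regular.algebraMap_mem _

theorem constSec_mem_gOrb (H : cartan N) (S : Set (OnePoint ℂ)) :
    (constSec H : Mat N (RatFunc ℂ)) ∈ gOrb N S := ⟨(constSec H).2, fun P _ => holoAt_constSec H P⟩

theorem valueAt_constSec (H : cartan N) (P : OnePoint ℂ) :
    valueAt P (constSec H : Mat N (RatFunc ℂ)) = H := by
  ext j k
  change (expand P (algebraMap ℂ (RatFunc ℂ) ((H : Mat N ℂ) j k))).coeff 0 = _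
  rw [expand_algebraMap, HahnSeries.C_apply, HahnSeries.coeff_single_same]

end Equivariance

/-! ### The residue theorem for a pair of sections -/

section Reciprocity

variable {N : ℕ}

theorem ratDeriv_smul (c : ℂ) (x : RatFunc ℂ) : ratDeriv (c • x) = c • ratDeriv x := by
  apply expand_injective ((0 : ℂ) : OnePoint ℂ)
  have h := D_expand ((0 : ℂ) : OnePoint ℂ) (c • x)
  rw [D_coordAt_coe, mul_one, map_smul, map_smul, D_expand, D_coordAt_coe, mul_one] at h
  rw [← h, map_smul]

/-- The trace of `df · g`, as a rational function. -/
def traceForm (f g : Mat N (RatFunc ℂ)) : RatFunc ℂ := ∑ j, ∑ k, ratDeriv (f j k) * g k j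

theorem trace_matD_mul (P : OnePoint ℂ) (f g : Mat N (RatFunc ℂ)) :
    (matD (f.map (expand P)) * g.map (expand P)).trace =
      expand P (traceForm f g) * D (coordAt P) := by
  simp only [Matrix.trace, Matrix.diag_apply, Matrix.mul_apply, matD, Matrix.map_apply, D_expand,
    traceForm, map_sum, map_mul, Finset.sum_mul]
  refine Finset.sum_congr rfl fun j _ => Finset.sum_congr rfl fun k _ => ?_
  ring

/-- The $\operatorname{Ad}\gamma$-eigenvalues of the entries $(j,k)$ and $(k,j)$ are inverse to each
other, so the one-form $\operatorname{tr}(df\,g)$ is invariant under rotation; its coefficient of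
$dt$ therefore absorbs a factor $\varepsilon$. Consequently all points of a rotation orbit have the
same residue. -/
theorem rotate_traceForm (f g : meroOrb N) : (eps N : ℂ) •
    rotate N (traceForm (f : Mat N (RatFunc ℂ)) g) = traceForm (f : Mat N (RatFunc ℂ)) g := by
  simp only [traceForm, map_sum, map_mul, Finset.smul_sum]
  refine Finset.sum_congr rfl fun j _ => Finset.sum_congr rfl fun k _ => ?_
  rw [← smul_mul_assoc, ← rotate_ratDeriv, (mem_meroOrb.mp f.2).2, (mem_meroOrb.mp g.2).2,
    ratDeriv_smul, smul_mul_smul_comm, ← Units.val_mul, gammaWt_mul_gammaWt, Units.val_one,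
    one_smul]

theorem D_mem_regular {x : LaurentSeries ℂ} (hx : x ∈ regular) : D x ∈ regular := by
  intro n hn
  rw [coeff_D]
  by_cases h : n = -1
  · subst h; simp
  · rw [hx _ (by omega), mul_zero]

theorem traceForm_mem_regular {c : ℂ} {f g : Mat N (RatFunc ℂ)} (hf : HoloAt c f)
    (hg : HoloAt c g) : expand c (traceForm f g) ∈ regular := by
  simp only [traceForm, map_sum, map_mul]
  refine sum_mem fun j _ => sum_mem fun k _ => mul_mem ?_ (hg k j)
  have := D_expand c (f j k)
  rw [D_coordAt_coe, mul_one] at this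
  rw [← this]
  exact D_mem_regular (hf j k)

theorem res_traceForm_rotate (f g : meroOrb N) (c : ℂ) (a : ℕ) :
    res (expand (((eps N : ℂ) ^ a * c : ℂ) : OnePoint ℂ)
      (traceForm (f : Mat N (RatFunc ℂ)) g)) =
      res (expand c (traceForm (f : Mat N (RatFunc ℂ)) g)) := by
  induction a with
  | zero => rw [pow_zero, one_mul]
  | succ a ih =>
    rw [pow_succ', mul_assoc, ← res_expand_rotate, ← ih, ← smul_eq_mul, ← map_smul, ← map_smul,
      rotate_traceForm]

theorem not_mem_markedZeroInfty {L : ℕ} {t : Fin L → ℂ} {c : ℂ} (hc : c ≠ 0)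
    (h : ∀ i a, c ≠ (eps N : ℂ) ^ a * t i) : (c : OnePoint ℂ) ∉ markedZeroInfty N t := by
  rintro (⟨i, a, hia⟩ | h0 | h0)
  · exact h i a (OnePoint.coe_injective hia)
  · exact hc (OnePoint.coe_injective h0)
  · exact OnePoint.coe_ne_infty _ h0

/-- The cocycles of the germs of two sections of `g^orb` add up to zero. -/
theorem sum_cocycle_germ (hN : N ≠ 0) {L : ℕ} {t : Fin L → ℂ} (ht0 : ∀ i, t i ≠ 0)
    (htne : ∀ i j, i ≠ j → ∀ a : ℕ, t i ≠ (eps N : ℂ) ^ a * t j) (f g : meroOrb N)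
    (hf : (f : Mat N (RatFunc ℂ)) ∈ gOrb N (markedZeroInfty N t))
    (hg : (g : Mat N (RatFunc ℂ)) ∈ gOrb N (markedZeroInfty N t)) :
    ∑ i, cocycle 1 ((germ N (t i) f).1 : Mat N (LaurentSeries ℂ)) (germ N (t i) g).1 +
      (cocycle (1 / (N : ℂ)) ((germZero N f).1 : Mat N (LaurentSeries ℂ)) (germZero N g).1 +
      cocycle (1 / (N : ℂ)) ((germInfty N f).1 : Mat N (LaurentSeries ℂ)) (germInfty N g).1) =
      0 := by
  classical
  have hprim := isPrimitiveRoot_eps hN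
  set h := traceForm (f : Mat N (RatFunc ℂ)) g with hh
  have hfin : ∀ c : ℂ, (matD ((f : Mat N (RatFunc ℂ)).map (expand c)) *
      (g : Mat N (RatFunc ℂ)).map (expand c)).trace = expand c h := fun c => by
    rw [trace_matD_mul, D_coordAt_coe, mul_one]
  -- The full rotation orbits of the marked points, the only possible poles besides $0$ and
  -- $\infty$.
  let S₁ : Finset ℂ := (Finset.univ ×ˢ Finset.range N).image
    fun p : Fin L × ℕ => (eps N : ℂ) ^ p.2 * t p.1
  have h0 : (0 : ℂ) ∉ S₁ := by
    simp only [S₁, Finset.mem_image, not_exists, not_and]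
    rintro ⟨i, a⟩ - h
    exact mul_ne_zero (pow_ne_zero _ (eps N).ne_zero) (ht0 i) h
  have hres := sum_res_eq (insert 0 S₁) h fun c hc => by
    rw [Finset.mem_insert, not_or] at hc
    have hP : (c : OnePoint ℂ) ∉ markedZeroInfty N t := by
      refine not_mem_markedZeroInfty hc.1 fun i a hia => hc.2 ?_
      refine Finset.mem_image.mpr ⟨(i, a % N), ?_, ?_⟩
      · exact Finset.mem_product.mpr ⟨Finset.mem_univ _,
          Finset.mem_range.mpr (Nat.mod_lt _ (Nat.pos_of_ne_zero hN))⟩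
      · rw [hia]
        change (eps N : ℂ) ^ (a % N) * t i = _
        rw [← pow_mod_orderOf (eps N : ℂ) a, ← hprim.eq_orderOf]
    exact traceForm_mem_regular (hf.2 _ hP) (hg.2 _ hP)
  rw [Finset.sum_insert h0, Finset.sum_image, Finset.sum_product] at hres
  -- Each orbit contributes $N$ equal residues, while $0$ and $\infty$ are fixed points and
  -- contribute one each: this is the origin of the factor $1/N$ in their cocycles.
  · have h1 : ∀ i, ∑ a ∈ Finset.range N, res (expand (((eps N : ℂ) ^ a * t i : ℂ) : OnePoint ℂ) h)
        = N * res (expand (t i) h) := fun i => by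
      rw [Finset.sum_congr rfl fun a _ => res_traceForm_rotate f g (t i) a]
      simp [hh]
    simp only [h1, ← Finset.mul_sum] at hres
    have h2 : ∀ c, cocycle 1 ((germ N c f).1 : Mat N (LaurentSeries ℂ)) (germ N c g).1 =
        res (expand c h) := fun c => by
      rw [← hfin c, cocycle, one_mul]; rfl
    have h3 : cocycle (1 / (N : ℂ)) ((germZero N f).1 : Mat N (LaurentSeries ℂ)) (germZero N g).1 =
        1 / (N : ℂ) * res (expand ((0 : ℂ) : OnePoint ℂ) h) := by
      rw [← hfin 0, cocycle]; rfl
    have h4 : cocycle (1 / (N : ℂ)) ((germInfty N f).1 : Mat N (LaurentSeries ℂ))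
        (germInfty N g).1 = 1 / (N : ℂ) * -(expand OnePoint.infty h).coeff 1 := by
      have h5 := trace_matD_mul OnePoint.infty (f : Mat N (RatFunc ℂ)) g
      have h6 : res (expand OnePoint.infty h * D (coordAt OnePoint.infty)) =
          -(expand OnePoint.infty h).coeff 1 := by
        have := HahnSeries.coeff_mul_single_add (r := (-1 : ℂ)) (x := expand OnePoint.infty h)
          (a := 1) (b := -2)
        rw [D_coordAt_infty]
        exact this.trans (mul_neg_one _)
      rw [cocycle, ← h6, hh, ← h5]; rfl
    rw [h3, h4, ← hres, Finset.sum_congr rfl fun i _ => h2 (t i)]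
    have : (N : ℂ) ≠ 0 := Nat.cast_ne_zero.mpr hN
    field_simp
    ring
  · rintro ⟨i, a⟩ hi ⟨j, b⟩ hj hij
    simp only [Finset.coe_product, Finset.coe_univ, Set.mem_prod, Set.mem_univ, true_and,
      Finset.coe_range, Set.mem_Iio] at hi hj hij
    -- Multiplying $\varepsilon^at_i=\varepsilon^bt_j$ by $\varepsilon^{N-a}$ would give
    -- $t_i=\varepsilon^{N-a+b}t_j$, excluded for $i\ne j$.
    have hij' : i = j := by
      by_contra hne
      refine htne i j hne (N - a + b) ?_
      rw [pow_add, mul_assoc, ← hij, ← mul_assoc, ← pow_add, Nat.sub_add_cancel hi.le,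
        hprim.pow_eq_one, one_mul]
    subst hij'
    rw [hprim.pow_inj hi hj (mul_right_cancel₀ (ht0 i) hij)]

end Reciprocity

/-! ### Sections with prescribed expansions at `0` and `∞` -/

section ZeroInfty

variable {N : ℕ}

theorem one_sub_one_sub_pow_mem {v : LaurentSeries ℂ} {m : ℤ} (hm : 0 ≤ m) (hv : v ∈ ordGE m)
    (p : ℕ) : 1 - (1 - v) ^ p ∈ ordGE m := by
  induction p with
  | zero => rw [pow_zero, sub_self]; exact zero_mem _
  | succ p ih =>
    have h1 : (1 - v) ^ p ∈ ordGE 0 :=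
      mem_regular_iff.mp (pow_mem (sub_mem (one_mem regular) (ordGE_anti hm hv)) p)
    have : 1 - (1 - v) ^ (p + 1) = (1 - (1 - v) ^ p) + (1 - v) ^ p * v := by ring
    rw [this]
    exact add_mem ih (mul_mem_ordGE h1 hv (by omega))

theorem expand_X_pow_sub_inv_mem {c a : ℂ} (h : c ^ N ≠ a) :
    expand c (RatFunc.X ^ N - algebraMap ℂ (RatFunc ℂ) a)⁻¹ ∈ regular := by
  have h1 : (RatFunc.X ^ N - algebraMap ℂ (RatFunc ℂ) a : RatFunc ℂ) =
      algebraMap (Polynomial ℂ) (RatFunc ℂ) (Polynomial.X ^ N - Polynomial.C a) := by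
    rw [map_sub, map_pow, RatFunc.algebraMap_X]; rfl
  have h2 := expand_polynomial c (Polynomial.X ^ N - Polynomial.C a)
  rw [h1, map_inv₀, mem_regular_iff, ← neg_zero]
  refine inv_mem_ordGE ?_ h2.1
  rw [h2.2]
  simpa [sub_eq_zero] using h

theorem expand_zero_X : expand ((0 : ℂ) : OnePoint ℂ) RatFunc.X = HahnSeries.single 1 1 := by
  rw [expand_X, coordAt_coe, map_zero, zero_add]

theorem expand_infty_X : expand OnePoint.infty RatFunc.X = HahnSeries.single (-1) 1 := by
  rw [expand_X, coordAt_infty]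

theorem expand_infty_X_inv : expand OnePoint.infty (RatFunc.X)⁻¹ = HahnSeries.single 1 1 := by
  rw [map_inv₀, expand_infty_X, ← single_one_zpow (-1), zpow_neg_one, inv_inv]

/-- A rotation-invariant rational function close to `1` at `0` and close to `0` at `∞`. -/
theorem exists_cutoff (hN : N ≠ 0) {s : ℂ} (hs : s ≠ 0) (p : ℕ) :
    ∃ x : RatFunc ℂ, rotate N x = x ∧ (∀ c : ℂ, c ^ N ≠ s → expand c x ∈ regular) ∧
      expand ((0 : ℂ) : OnePoint ℂ) (1 - x) ∈ ordGE p ∧ expand OnePoint.infty x ∈ ordGE p := by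
  set w : RatFunc ℂ := (RatFunc.X ^ N - algebraMap ℂ (RatFunc ℂ) s)⁻¹ with hw
  -- The function $t^N/(t^N-s)$ is rotation-invariant, vanishes at $0$ and equals $1$ at $\infty$;
  -- its poles are the $N$-th roots of `s`.
  set u : RatFunc ℂ := RatFunc.X ^ N * w with hu
  have hinf : expand OnePoint.infty w ∈ ordGE 1 := by
    have h1 : expand OnePoint.infty (RatFunc.X ^ N - algebraMap ℂ (RatFunc ℂ) s) =
        HahnSeries.single (-N : ℤ) 1 - HahnSeries.single 0 s := by
      rw [map_sub, map_pow, expand_infty_X, expand_algebraMap, HahnSeries.single_pow,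
        HahnSeries.C_apply, one_pow]
      simp
    have hN' : 0 < N := Nat.pos_of_ne_zero hN
    rw [hw, map_inv₀, h1]
    refine ordGE_anti (m := 1) (n := -(-N : ℤ)) (by omega) (inv_mem_ordGE ?_
      (sub_mem (single_mem_ordGE le_rfl 1) (single_mem_ordGE (by omega) s)))
    rw [HahnSeries.coeff_sub, HahnSeries.coeff_single_same,
      HahnSeries.coeff_single_of_ne (by omega), sub_zero]
    exact one_ne_zero
  have hne : (RatFunc.X ^ N - algebraMap ℂ (RatFunc ℂ) s : RatFunc ℂ) ≠ 0 := by
    intro h0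
    have h1 := expand_polynomial 0 (Polynomial.X ^ N - Polynomial.C s)
    have h2 : algebraMap (Polynomial ℂ) (RatFunc ℂ) (Polynomial.X ^ N - Polynomial.C s) = 0 := by
      rw [← h0, map_sub, map_pow, RatFunc.algebraMap_X]; rfl
    rw [h2, map_zero] at h1
    have h3 := h1.2
    rw [HahnSeries.coeff_zero] at h3
    simp [hN] at h3
    exact hs h3
  have hrw : rotate N w = w := by
    rw [hw, map_inv₀, map_sub, map_pow, rotate_X, AlgHom.commutes, mul_pow, ← map_pow,
      (isPrimitiveRoot_eps hN).pow_eq_one, map_one, one_mul]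
  have hru : rotate N u = u := by
    rw [hu, map_mul, hrw, map_pow, rotate_X, mul_pow, ← map_pow,
      (isPrimitiveRoot_eps hN).pow_eq_one, map_one, one_mul]
  have hreg : ∀ c : ℂ, c ^ N ≠ s → expand c u ∈ regular := fun c hc => by
    rw [hu, map_mul, map_pow]
    exact mul_mem (pow_mem (expand_X_mem_regular c) N) (expand_X_pow_sub_inv_mem hc)
  -- The inner power makes this close to $1$ at $0$, where $u^p$ has order at least $p$. The outer
  -- power makes it close to $0$ at $\infty$, where $1-u^p$ is divisible by $1-u$ and so has order
  -- at least one.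
  refine ⟨(1 - u ^ p) ^ p, by simp [hru], fun c hc => ?_, ?_, ?_⟩
  · simp only [map_pow, map_sub, map_one]
    exact pow_mem (sub_mem (one_mem _) (pow_mem (hreg c hc) p)) p
  · simp only [map_pow, map_sub, map_one]
    refine one_sub_one_sub_pow_mem (by omega) ?_ p
    have h1 : expand ((0 : ℂ) : OnePoint ℂ) u ∈ ordGE 1 := by
      rw [hu, map_mul, map_pow, expand_zero_X, HahnSeries.single_pow]
      refine mul_mem_ordGE (m := 1) (single_mem_ordGE ?_ _)
        (expand_X_pow_sub_inv_mem (by rw [zero_pow hN]; exact hs.symm)) (by omega)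
      simp only [nsmul_eq_mul, mul_one]
      omega
    simpa using pow_mem_ordGE h1 p
  · have h1 : 1 - u = algebraMap ℂ (RatFunc ℂ) (-s) * w := by
      rw [hu, hw]
      field_simp
      rw [map_neg]; ring
    have h2 : expand OnePoint.infty (1 - u) ∈ ordGE 1 := by
      rw [h1, map_mul, expand_algebraMap]
      exact mul_mem_ordGE (m := 0) (single_mem_ordGE le_rfl _) hinf (by omega)
    have h3 : expand OnePoint.infty (1 - u ^ p) ∈ ordGE 1 := by
      have := one_sub_one_sub_pow_mem (by omega) h2 p
      rwa [map_sub, map_one, sub_sub_cancel, ← map_pow, ← map_one (expand OnePoint.infty),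
        ← map_sub] at this
    rw [map_pow]
    simpa using pow_mem_ordGE h3 p

/-- Truncation intertwines scaling of series with rotation, so the twisted equivariance of a loop
passes to its truncations. -/
theorem rotate_truncAt {x : RatFunc ℂ} {z : ℂˣ} (hx : rotate N x = (z : ℂ) • x) (a b : ℤ)
    (g : LaurentSeries ℂ) : rotate N (truncAt x a b g) = truncAt x a b (scale z g) := by
  rw [truncAt_apply, truncAt_apply, map_sum]
  refine Finset.sum_congr rfl fun m _ => ?_
  have h1 : rotate N (g.coeff m • x ^ m) = g.coeff m • rotate N (x ^ m) :=
    (rotate N).toLinearMap.map_smul _ _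
  have h2 : ((z : ℂ) • x) ^ m = ((z ^ m : ℂˣ) : ℂ) • x ^ m := by
    rw [Algebra.smul_def, Algebra.smul_def, mul_zpow, ← map_zpow₀, Units.val_zpow_eq_zpow_val]
  rw [h1, map_zpow₀, hx, h2, scale_coeff, smul_smul, mul_comm]

theorem expand_truncAt_mem {P : OnePoint ℂ} {x : RatFunc ℂ}
    (hx : expand P x = HahnSeries.single (-1) 1) {a b k : ℤ} (hk : k ≤ -b) (g : LaurentSeries ℂ) :
    expand P (truncAt x a b g) ∈ ordGE k := by
  rw [truncAt_apply, map_sum]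
  refine sum_mem fun m hm => ?_
  rw [Finset.mem_Ico] at hm
  rw [map_smul, map_zpow₀, hx, ← single_one_zpow (-1), ← zpow_mul, single_one_zpow]
  exact Submodule.smul_mem _ _ (single_mem_ordGE (by omega) 1)

theorem expand_truncAt_mem_regular {P : OnePoint ℂ} {x : RatFunc ℂ} (hx : expand P x ∈ regular)
    (hx' : expand P x⁻¹ ∈ regular) (a b : ℤ) (g : LaurentSeries ℂ) :
    expand P (truncAt x a b g) ∈ regular := by
  rw [truncAt_apply, map_sum]
  refine sum_mem fun m _ => ?_
  rw [map_smul]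
  refine regular.smul_mem ?_ _
  rcases m with m | m
  · rw [Int.ofNat_eq_natCast, zpow_natCast, map_pow]
    exact pow_mem hx m
  · rw [zpow_negSucc, ← inv_pow, map_pow]
    exact pow_mem hx' _

/-- Entrywise order of vanishing. -/
def MatOrdGE (n : ℤ) (A : Mat N (LaurentSeries ℂ)) : Prop := ∀ j k, A j k ∈ ordGE n

theorem exists_matOrdGE (A : Mat N (LaurentSeries ℂ)) : ∃ q : ℕ, ∀ j k, A j k ∈ ordGE (-q) := by
  refine ⟨∑ j, ∑ k, (A j k).order.natAbs, fun j k => ordGE_anti ?_ (mem_ordGE_order (A j k))⟩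
  have h1 : (A j k).order.natAbs ≤ ∑ j, ∑ k, (A j k).order.natAbs :=
    (Finset.single_le_sum (f := fun k => (A j k).order.natAbs) (fun _ _ => Nat.zero_le _)
      (Finset.mem_univ k)).trans
    (Finset.single_le_sum (f := fun j => ∑ k, (A j k).order.natAbs) (fun _ _ => Nat.zero_le _)
      (Finset.mem_univ j))
  omega

/-- Twisted loops at `0` and `∞` can be approximated simultaneously by sections of `g^orb` with
poles at the marked points. -/
theorem exists_approx (hN : N ≠ 0) {L : ℕ} (hL : 1 ≤ L) {t : Fin L → ℂ} (ht0 : ∀ i, t i ≠ 0)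
    {A B : Mat N (LaurentSeries ℂ)} (hA : A ∈ twLoop N (eps N)) (hB : B ∈ twLoop N (eps N)⁻¹)
    (n : ℕ) : ∃ f : meroOrb N, (f : Mat N (RatFunc ℂ)) ∈ gOrb N (markedZeroInfty N t) ∧
      (∀ j k, expand ((0 : ℂ) : OnePoint ℂ) ((f : Mat N (RatFunc ℂ)) j k) - A j k ∈ ordGE n) ∧
      (∀ j k, expand OnePoint.infty ((f : Mat N (RatFunc ℂ)) j k) - B j k ∈ ordGE n) := by
  obtain ⟨qA, hqA⟩ := exists_matOrdGE A
  obtain ⟨qB, hqB⟩ := exists_matOrdGE B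
  -- With $s=t_0^N$ the cutoff has poles only on the orbit of the first marked point. Its precision
  -- absorbs the poles of order at most $n$, `qA` or `qB` that it multiplies in the error terms and
  -- still leaves order $n$.
  obtain ⟨x, hrot, hreg, hx0, hx1⟩ := exists_cutoff hN (pow_ne_zero N (ht0 ⟨0, hL⟩))
    (2 * n + qA + qB)
  rw [mem_twLoop] at hA hB
  have hX : rotate N RatFunc.X = (eps N : ℂ) • RatFunc.X := by
    rw [rotate_X, Algebra.smul_def]
  have hX' : rotate N (RatFunc.X)⁻¹ = (((eps N)⁻¹ : ℂˣ) : ℂ) • (RatFunc.X)⁻¹ := by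
    rw [map_inv₀, hX, Algebra.smul_def, Algebra.smul_def, mul_inv, ← map_inv₀,
      Units.val_inv_eq_inv_val]
  set a : LaurentSeries ℂ →ₗ[ℂ] RatFunc ℂ := truncAt RatFunc.X (-qA) n with ha
  set b : LaurentSeries ℂ →ₗ[ℂ] RatFunc ℂ := truncAt (RatFunc.X)⁻¹ (-qB) n with hb
  -- The cutoff glues the truncation of `A`, good at $0$, to that of `B`, good at $\infty$.
  let F : Mat N (RatFunc ℂ) := fun j k => x * a (A j k) + (1 - x) * b (B j k)
  have hF : F ∈ meroOrb N := by
    rw [mem_meroOrb]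
    refine ⟨?_, fun j k => ?_⟩
    · have h1 : ∑ j, A j j = 0 := hA.1
      have h2 : ∑ j, B j j = 0 := hB.1
      change ∑ j, (x * a (A j j) + (1 - x) * b (B j j)) = 0
      rw [Finset.sum_add_distrib, ← Finset.mul_sum, ← Finset.mul_sum, ← map_sum, ← map_sum, h1, h2,
        map_zero, map_zero, mul_zero, mul_zero, add_zero]
    · change rotate N (x * a (A j k) + (1 - x) * b (B j k)) = _ • (x * a (A j k) + (1 - x) * b (B j k))
      rw [map_add, map_mul, map_mul, map_sub, map_one, hrot, ha, hb, rotate_truncAt hX,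
        rotate_truncAt hX', hA.2, hB.2]
      have h1 : truncAt RatFunc.X (-qA) n ((gammaWt j k : ℂ) • A j k) =
        (gammaWt j k : ℂ) • truncAt RatFunc.X (-qA) n (A j k) := map_smul _ _ _
      have h2 : truncAt (RatFunc.X)⁻¹ (-qB) n ((gammaWt j k : ℂ) • B j k) =
        (gammaWt j k : ℂ) • truncAt (RatFunc.X)⁻¹ (-qB) n (B j k) := map_smul _ _ _
      rw [h1, h2, mul_smul_comm, mul_smul_comm, smul_add]
  have hA0 : ∀ j k, expand ((0 : ℂ) : OnePoint ℂ) (a (A j k)) - A j k ∈ ordGE n := fun j k =>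
    expand_truncAt_sub_mem expand_zero_X (hqA j k)
  have hB0 : ∀ j k, expand OnePoint.infty (b (B j k)) - B j k ∈ ordGE n := fun j k =>
    expand_truncAt_sub_mem expand_infty_X_inv (hqB j k)
  have hA1 : ∀ j k, expand OnePoint.infty (a (A j k)) ∈ ordGE (-n) := fun j k =>
    expand_truncAt_mem expand_infty_X le_rfl _
  have hB1 : ∀ j k, expand ((0 : ℂ) : OnePoint ℂ) (b (B j k)) ∈ ordGE (-n) := fun j k =>
    expand_truncAt_mem (by rw [map_inv₀, expand_zero_X, ← zpow_neg_one, single_one_zpow]) le_rfl _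
  have hA2 : ∀ j k, expand ((0 : ℂ) : OnePoint ℂ) (a (A j k)) ∈ ordGE (-qA) := fun j k => by
    rw [← sub_add_cancel (expand ((0 : ℂ) : OnePoint ℂ) (a (A j k))) (A j k)]
    exact add_mem (ordGE_anti (by omega) (hA0 j k)) (hqA j k)
  have hB2 : ∀ j k, expand OnePoint.infty (b (B j k)) ∈ ordGE (-qB) := fun j k => by
    rw [← sub_add_cancel (expand OnePoint.infty (b (B j k))) (B j k)]
    exact add_mem (ordGE_anti (by omega) (hB0 j k)) (hqB j k)
  refine ⟨⟨F, hF⟩, ⟨hF, fun P hP j k => ?_⟩, fun j k => ?_, fun j k => ?_⟩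
  · induction P using OnePoint.rec with
    | infty => exact absurd (Or.inr (Or.inr rfl)) hP
    | coe c =>
      have hc0 : c ≠ 0 := by
        rintro rfl
        exact hP (Or.inr (Or.inl rfl))
      have hxc : expand c x ∈ regular := hreg c fun hc => hP (Or.inl (by
        have h1 : (c / t ⟨0, hL⟩) ^ N = 1 := by
          rw [div_pow, hc, div_self (pow_ne_zero N (ht0 _))]
        have : NeZero N := ⟨hN⟩
        obtain ⟨i, -, hi⟩ := (isPrimitiveRoot_eps hN).eq_pow_of_pow_eq_one h1
        exact ⟨⟨0, hL⟩, i, by rw [hi, div_mul_cancel₀ _ (ht0 _)]⟩))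
      have h0 := expand_X_mem_regular c
      have h1 : expand c (RatFunc.X)⁻¹ ∈ regular := by
        have := expand_XsubC_inv_mem_regular hc0
        rwa [XsubC, map_zero, sub_zero] at this
      change expand c (x * a (A j k) + (1 - x) * b (B j k)) ∈ regular
      rw [map_add, map_mul, map_mul, map_sub, map_one]
      exact add_mem (mul_mem hxc (expand_truncAt_mem_regular h0 h1 _ _ _))
        (mul_mem (sub_mem (one_mem _) hxc)
          (expand_truncAt_mem_regular h1 (by rwa [inv_inv]) _ _ _))
  · change expand ((0 : ℂ) : OnePoint ℂ) (x * a (A j k) + (1 - x) * b (B j k)) - A j k ∈ ordGE n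
    have : expand ((0 : ℂ) : OnePoint ℂ) (x * a (A j k) + (1 - x) * b (B j k)) - A j k =
        (expand ((0 : ℂ) : OnePoint ℂ) (a (A j k)) - A j k) +
        expand ((0 : ℂ) : OnePoint ℂ) (1 - x) * (expand ((0 : ℂ) : OnePoint ℂ) (b (B j k)) -
          expand ((0 : ℂ) : OnePoint ℂ) (a (A j k))) := by
      simp only [map_add, map_mul, map_sub, map_one]; ring
    rw [this]
    refine add_mem (hA0 j k) ?_
    rw [mul_sub]
    exact sub_mem (mul_mem_ordGE hx0 (hB1 j k) (by push_cast; omega))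
      (mul_mem_ordGE hx0 (hA2 j k) (by push_cast; omega))
  · change expand OnePoint.infty (x * a (A j k) + (1 - x) * b (B j k)) - B j k ∈ ordGE n
    have : expand OnePoint.infty (x * a (A j k) + (1 - x) * b (B j k)) - B j k =
        (expand OnePoint.infty (b (B j k)) - B j k) +
        expand OnePoint.infty x * (expand OnePoint.infty (a (A j k)) -
          expand OnePoint.infty (b (B j k))) := by
      simp only [map_add, map_mul, map_sub, map_one]; ring
    rw [this]
    refine add_mem (hB0 j k) ?_
    rw [mul_sub]
    exact sub_mem (mul_mem_ordGE hx1 (hA1 j k) (by push_cast; omega))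
      (mul_mem_ordGE hx1 (hB2 j k) (by push_cast; omega))

end ZeroInfty

/-! ### Sections of `g^trig` with prescribed principal parts -/

section Trig

variable {N : ℕ}

theorem expand_rotate_infty (N : ℕ) (x : RatFunc ℂ) :
    expand OnePoint.infty (rotate N x) = scale (eps N)⁻¹ (expand OnePoint.infty x) := by
  have : (expand OnePoint.infty).comp (rotate N) =
      (scale (eps N)⁻¹).comp (expand OnePoint.infty) := by
    apply ratFunc_hom_ext
    rw [AlgHom.comp_apply, AlgHom.comp_apply, rotate_X, map_mul, expand_X, expand_algebraMap,
      scale_coordAt_infty]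
    rfl
  exact DFunLike.congr_fun this x

theorem scale_mem_ordGE {z : ℂˣ} {f : LaurentSeries ℂ} {n : ℤ} (hf : f ∈ ordGE n) :
    scale z f ∈ ordGE n := fun m hm => by rw [scale_coeff, hf m hm, mul_zero]

theorem expand_iterate_rotate_mem (a : ℕ) (c : ℂ) {x : RatFunc ℂ} {n : ℤ}
    (h : expand (((eps N : ℂ) ^ a * c : ℂ) : OnePoint ℂ) x ∈ ordGE n) :
    expand c ((rotate N)^[a] x) ∈ ordGE n := by
  induction a generalizing c with
  | zero => simpa using h
  | succ a ih =>
    rw [Function.iterate_succ_apply', expand_rotate]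
    refine scale_mem_ordGE (ih _ ?_)
    rwa [← mul_assoc, ← pow_succ]

theorem expand_infty_iterate_rotate_mem (a : ℕ) {x : RatFunc ℂ} {n : ℤ}
    (h : expand OnePoint.infty x ∈ ordGE n) :
    expand OnePoint.infty ((rotate N)^[a] x) ∈ ordGE n := by
  induction a with
  | zero => exact h
  | succ a ih =>
    rw [Function.iterate_succ_apply', expand_rotate_infty]
    exact scale_mem_ordGE ih

theorem iterate_rotate_self (hN : N ≠ 0) (x : RatFunc ℂ) : (rotate N)^[N] x = x := by
  apply expand_injective OnePoint.infty
  have h : ∀ (a : ℕ) (n : ℤ), (expand OnePoint.infty ((rotate N)^[a] x)).coeff n =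
      ((((eps N)⁻¹ ^ a) ^ n : ℂˣ) : ℂ) * (expand OnePoint.infty x).coeff n := by
    intro a n
    induction a with
    | zero => simp
    | succ a ih =>
      rw [Function.iterate_succ_apply', expand_rotate_infty, scale_coeff, ih, ← mul_assoc,
        ← Units.val_mul, ← mul_zpow, ← pow_succ']
  ext n
  rw [h, inv_pow, eps_pow hN]
  simp

/-- The projection of a rational function to the `u`-eigenspace of the rotation (up to a
factor `N`). -/
def isotypic (N : ℕ) (u : ℂˣ) : RatFunc ℂ →ₗ[ℂ] RatFunc ℂ :=
  ∑ a ∈ Finset.range N, ((u⁻¹ ^ a : ℂˣ) : ℂ) • (rotate N).toLinearMap ^ a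

theorem isotypic_apply (u : ℂˣ) (x : RatFunc ℂ) : isotypic N u x =
    ∑ a ∈ Finset.range N, ((u⁻¹ ^ a : ℂˣ) : ℂ) • (rotate N)^[a] x := by
  rw [isotypic, LinearMap.sum_apply]
  refine Finset.sum_congr rfl fun a _ => ?_
  rw [LinearMap.smul_apply, Module.End.pow_apply]
  rfl

/-- Rotation shifts the summation index, and $u^N=1$ identifies the term of index $N$ with that of
index $0$. -/
theorem rotate_isotypic (hN : N ≠ 0) {u : ℂˣ} (hu : u ^ N = 1) (x : RatFunc ℂ) :
    rotate N (isotypic N u x) = (u : ℂ) • isotypic N u x := by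
  have h1 : ∀ a : ℕ, rotate N (((u⁻¹ ^ a : ℂˣ) : ℂ) • (rotate N)^[a] x) =
      (u : ℂ) • (((u⁻¹ ^ (a + 1) : ℂˣ) : ℂ) • (rotate N)^[a + 1] x) := by
    intro a
    have h2 : rotate N (((u⁻¹ ^ a : ℂˣ) : ℂ) • (rotate N)^[a] x) =
      ((u⁻¹ ^ a : ℂˣ) : ℂ) • rotate N ((rotate N)^[a] x) := (rotate N).toLinearMap.map_smul _ _
    rw [h2, Function.iterate_succ_apply', smul_smul, ← Units.val_mul, pow_succ', mul_inv_cancel_left]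
  rw [isotypic_apply, map_sum, Finset.sum_congr rfl fun a _ => h1 a, ← Finset.smul_sum]
  congr 1
  have h3 := Finset.sum_range_succ (fun a => ((u⁻¹ ^ a : ℂˣ) : ℂ) • (rotate N)^[a] x) N
  rw [Finset.sum_range_succ'] at h3
  rw [iterate_rotate_self hN, inv_pow u N, hu, inv_one, pow_zero] at h3
  exact add_right_cancel h3

theorem expand_isotypic_mem {P : OnePoint ℂ} (u : ℂˣ) {x : RatFunc ℂ} {n : ℤ}
    (h : ∀ a < N, expand P ((rotate N)^[a] x) ∈ ordGE n) : expand P (isotypic N u x) ∈ ordGE n := by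
  rw [isotypic_apply, map_sum]
  refine sum_mem fun a ha => ?_
  rw [map_smul]
  exact Submodule.smul_mem _ _ (h a (Finset.mem_range.mp ha))

/-- The Laurent polynomial `∑ g_m x ^ m`, `-q ≤ m < 0`, in `x = t - c` is regular away
from `c`. -/
theorem expand_principal_mem {c d : ℂ} (h : d ≠ c) (q : ℤ) (g : LaurentSeries ℂ) :
    expand d (truncAt (XsubC c) q 0 g) ∈ regular := by
  rw [truncAt_apply, map_sum]
  refine sum_mem fun m hm => ?_
  rw [Finset.mem_Ico] at hm
  rw [map_smul, show m = -(m.natAbs : ℤ) by omega, zpow_neg, ← inv_zpow, zpow_natCast, map_pow]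
  exact regular.smul_mem (pow_mem (expand_XsubC_inv_mem_regular h) _) _

theorem expand_infty_principal_mem (c : ℂ) (q : ℤ) (g : LaurentSeries ℂ) :
    expand OnePoint.infty (truncAt (XsubC c) q 0 g) ∈ ordGE 1 := by
  rw [truncAt_apply, map_sum]
  refine sum_mem fun m hm => ?_
  rw [Finset.mem_Ico] at hm
  rw [map_smul, show m = -(m.natAbs : ℤ) by omega, zpow_neg, ← inv_zpow, zpow_natCast, map_pow]
  exact Submodule.smul_mem _ _ (ordGE_anti (by rw [mul_one]; omega)
    (pow_mem_ordGE (expand_infty_XsubC_inv_mem c) _))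

/-- A loop at the `i`-th marked point is, modulo regular loops at all marked points, the germ of a
section of `g^trig`. -/
theorem exists_gTrig_principal (hN : N ≠ 0) {L : ℕ} {t : Fin L → ℂ} (ht0 : ∀ i, t i ≠ 0)
    (htne : ∀ i j, i ≠ j → ∀ a : ℕ, t i ≠ (eps N : ℂ) ^ a * t j) (i : Fin L)
    {A : Mat N (LaurentSeries ℂ)} (hA : A.trace = 0) :
    ∃ f : meroOrb N, (f : Mat N (RatFunc ℂ)) ∈ gTrig N (marked N t) ∧
      (∀ j k, expand (t i) ((f : Mat N (RatFunc ℂ)) j k) - A j k ∈ regular) ∧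
      ∀ l, l ≠ i → HoloAt (t l) (f : Mat N (RatFunc ℂ)) := by
  have hprim := isPrimitiveRoot_eps hN
  have hNpos : 0 < N := Nat.pos_of_ne_zero hN
  obtain ⟨q, hq⟩ := exists_matOrdGE A
  let p : LaurentSeries ℂ →ₗ[ℂ] RatFunc ℂ := truncAt (XsubC (t i)) (-q) 0
  -- Averaging each entry with its own eigenvalue makes the principal part equivariant. At `t i`
  -- only the summand $a=0$ has a pole, since the others have their poles elsewhere on the orbit, so
  -- the principal part is unchanged.
  let F : Mat N (RatFunc ℂ) := fun j k => isotypic N (gammaWt j k) (p (A j k))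
  have hF : F ∈ meroOrb N := by
    refine mem_meroOrb.mpr ⟨?_, fun j k => rotate_isotypic hN (gammaWt_pow j k) _⟩
    have h1 : ∑ j, A j j = 0 := hA
    change ∑ j, isotypic N (gammaWt j j) (p (A j j)) = 0
    simp only [gammaWt_self]
    rw [← map_sum, ← map_sum, h1, map_zero, map_zero]
  have hFreg : ∀ c : ℂ, (∀ a < N, (eps N : ℂ) ^ a * c ≠ t i) → HoloAt c F := fun c hc j k =>
    expand_isotypic_mem _ fun a ha =>
      expand_iterate_rotate_mem a c (expand_principal_mem (hc a ha) _ _)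
  have hFinf : ∀ j k, expand OnePoint.infty (F j k) ∈ ordGE 1 := fun j k =>
    expand_isotypic_mem _ fun a _ =>
      expand_infty_iterate_rotate_mem a (expand_infty_principal_mem _ _ _)
  have hinv : ∀ a < N, ∀ c, (eps N : ℂ) ^ a * c = t i → c = (eps N : ℂ) ^ (N - a) * t i := by
    intro a ha c hc
    rw [← hc, ← mul_assoc, ← pow_add, Nat.sub_add_cancel ha.le, hprim.pow_eq_one, one_mul]
  have hF0 : HoloAt ((0 : ℂ) : OnePoint ℂ) F := hFreg 0 fun a _ => by
    rw [mul_zero]; exact (ht0 i).symm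
  have hFt : ∀ j k, expand (t i) (F j k) - A j k ∈ regular := by
    intro j k
    change expand (t i) (isotypic N (gammaWt j k) (p (A j k))) - A j k ∈ regular
    rw [isotypic_apply, ← Finset.add_sum_erase _ _ (Finset.mem_range.mpr hNpos), map_add, pow_zero,
      Units.val_one, one_smul, Function.iterate_zero, id, add_sub_right_comm]
    refine add_mem (expand_truncAt_sub_mem (expand_XsubC_self (t i)) (hq j k)) ?_
    rw [map_sum]
    refine sum_mem fun a ha => ?_
    rw [Finset.mem_erase, Finset.mem_range] at ha
    rw [map_smul]
    refine regular.smul_mem ?_ _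
    refine expand_iterate_rotate_mem a (t i) (expand_principal_mem (fun h => ?_) _ _)
    have h1 : (eps N : ℂ) ^ a = 1 := mul_right_cancel₀ (ht0 i) (by rw [h, one_mul])
    exact absurd (hprim.pow_eq_one_iff_dvd a |>.mp h1)
      (Nat.not_dvd_of_pos_of_lt (Nat.pos_of_ne_zero ha.1) ha.2)
  let H0 : cartan N := ⟨valueAt ((0 : ℂ) : OnePoint ℂ) F, valueAt_zero_mem_cartan ⟨F, hF⟩⟩
  -- Since `F` vanishes at $\infty$, adding a constant `H` gives the values $F(0)+H$ at $0$ and $H$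
  -- at $\infty$. The gluing condition is then
  -- $(1-\operatorname{Ad}\beta)H=\operatorname{Ad}\beta\,F(0)$, which is solvable.
  let H : cartan N := (oneSubAdBeta N).symm (adBeta N H0)
  have hH : H = adBeta N (H0 + H) := by
    have h1 : oneSubAdBeta N H = adBeta N H0 := LinearEquiv.apply_symm_apply _ _
    have h2 : oneSubAdBeta N H = H - adBeta N H := rfl
    rw [map_add, ← h1, h2, sub_add_cancel]
  let f : meroOrb N := ⟨F, hF⟩ + constSec H
  have hf : ∀ j k, (f : Mat N (RatFunc ℂ)) j k =
    F j k + (constSec H : Mat N (RatFunc ℂ)) j k := fun j k => rfl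
  have hholo : ∀ P, HoloAt P F → HoloAt P (f : Mat N (RatFunc ℂ)) := fun P hP j k => by
    rw [hf, map_add]
    exact add_mem (hP j k) (holoAt_constSec H P j k)
  have hFinf' : HoloAt OnePoint.infty F := fun j k => ordGE_anti zero_le_one (hFinf j k)
  refine ⟨f, ⟨⟨f.2, fun P hP => hholo P ?_⟩, hholo _ hF0, hholo _ hFinf', ?_⟩, fun j k => ?_,
    fun l hl => hholo _ (hFreg _ fun a ha h => htne l i hl _ (hinv a ha _ h))⟩
  · induction P using OnePoint.rec with
    | infty => exact hFinf'
    | coe c => exact hFreg c fun a ha h => hP ⟨i, N - a, by rw [hinv a ha c h]⟩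
  · have h1 : (f : Mat N (RatFunc ℂ)) = F + (constSec H : Mat N (RatFunc ℂ)) := rfl
    rw [h1, valueAt_add, valueAt_add, valueAt_constSec, valueAt_constSec]
    have h2 : valueAt OnePoint.infty F = 0 := by
      ext j k
      exact hFinf j k 0 one_pos
    rw [h2, zero_add]
    exact congrArg Subtype.val hH
  · rw [hf, map_add, add_sub_right_comm]
    exact add_mem (hFt j k) (holoAt_constSec H _ j k)

end Trig

/-! ### The action of sections on `M_1 ⊗ ⋯ ⊗ M_L` -/

section Action

variable {N : ℕ}

theorem Affine.ext' {K : LieSubalgebra ℂ (Mat N (LaurentSeries ℂ))} {c : ℂ} {x y : Affine K c}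
    (h1 : ∀ j k, (x.1 : Mat N (LaurentSeries ℂ)) j k = (y.1 : Mat N (LaurentSeries ℂ)) j k)
    (h2 : x.2 = y.2) : x = y :=
  Prod.ext (Subtype.ext (Matrix.ext h1)) h2

theorem germ_add (c : ℂ) (f g : meroOrb N) : germ N c (f + g) = germ N c f + germ N c g :=
  Affine.ext' (fun _ _ => map_add (expand c) _ _) (add_zero (0 : ℂ)).symm

theorem germ_smul (c r : ℂ) (f : meroOrb N) : germ N c (r • f) = r • germ N c f :=
  Affine.ext' (fun _ _ => map_smul (expand c) r _) (mul_zero r).symm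

theorem lie_map_expand (P : OnePoint ℂ) (f g : Mat N (RatFunc ℂ)) (j k : Fin N) :
    expand P (⁅f, g⁆ j k) = ⁅f.map (expand P), g.map (expand P)⁆ j k := by
  change (expand P).mapMatrix (f * g - g * f) j k =
    ((expand P).mapMatrix f * (expand P).mapMatrix g -
      (expand P).mapMatrix g * (expand P).mapMatrix f) j k
  rw [map_sub, map_mul, map_mul]

theorem lie_germ (c : ℂ) (f g : meroOrb N) : ⁅germ N c f, germ N c g⁆ = germ N c ⁅f, g⁆ +
    cocycle 1 ((germ N c f).1 : Mat N (LaurentSeries ℂ)) (germ N c g).1 • Affine.khat := by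
  refine Affine.ext' (fun j k => ?_) ?_
  · have h1 := lie_map_expand c (f : Mat N (RatFunc ℂ)) g j k
    change ⁅(f : Mat N (RatFunc ℂ)).map (expand c), (g : Mat N (RatFunc ℂ)).map (expand c)⁆ j k =
      expand c (⁅(f : Mat N (RatFunc ℂ)), (g : Mat N (RatFunc ℂ))⁆ j k) +
        (cocycle 1 ((germ N c f).1 : Mat N (LaurentSeries ℂ)) (germ N c g).1 : ℂ) •
          (0 : LaurentSeries ℂ)
    rw [h1, smul_zero, add_zero]
  · change cocycle 1 ((germ N c f).1 : Mat N (LaurentSeries ℂ)) (germ N c g).1 =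
      0 + cocycle 1 ((germ N c f).1 : Mat N (LaurentSeries ℂ)) (germ N c g).1 * 1
    rw [zero_add, mul_one]

variable {L : ℕ} (t : Fin L → ℂ)
variable (M : Fin L → Type*) [∀ i, AddCommGroup (M i)] [∀ i, Module ℂ (M i)]
  [∀ i, LieRingModule (AffineSl N) (M i)] [∀ i, LieModule ℂ (AffineSl N) (M i)]

theorem actM_add (f g : meroOrb N) : actM N t M (f + g) = actM N t M f + actM N t M g := by
  rw [actM, actM, actM, ← Finset.sum_add_distrib]
  refine Finset.sum_congr rfl fun i _ => ?_
  rw [germ_add, map_add]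
  exact (actFactorₗ M i).map_add _ _

theorem actM_smul (r : ℂ) (f : meroOrb N) : actM N t M (r • f) = r • actM N t M f := by
  rw [actM, actM, Finset.smul_sum]
  refine Finset.sum_congr rfl fun i _ => ?_
  rw [germ_smul, map_smul]
  exact (actFactorₗ M i).map_smul _ _

variable {M} {k : ℂ}

/-- Operators on different tensor factors commute, so only the central terms of the separate factors
appear besides the bracket of sections. -/
theorem actM_commutator
    (hlevel : ∀ (i : Fin L) (v : M i), ⁅(Affine.khat : AffineSl N), v⁆ = k • v) (f g : meroOrb N) :
    actM N t M f * actM N t M g - actM N t M g * actM N t M f = actM N t M ⁅f, g⁆ +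
      (k * ∑ i, cocycle 1 ((germ N (t i) f).1 : Mat N (LaurentSeries ℂ)) (germ N (t i) g).1) •
        (1 : Module.End ℂ (⨂[ℂ] i, M i)) := by
  have h : ∀ i, LieModule.toEnd ℂ (AffineSl N) (M i) (germ N (t i) f) *
      LieModule.toEnd ℂ (AffineSl N) (M i) (germ N (t i) g) -
      LieModule.toEnd ℂ (AffineSl N) (M i) (germ N (t i) g) *
      LieModule.toEnd ℂ (AffineSl N) (M i) (germ N (t i) f) =
      LieModule.toEnd ℂ (AffineSl N) (M i) (germ N (t i) ⁅f, g⁆) +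
      (k * cocycle 1 ((germ N (t i) f).1 : Mat N (LaurentSeries ℂ)) (germ N (t i) g).1) • 1 := by
    intro i
    have h1 : LieModule.toEnd ℂ (AffineSl N) (M i) Affine.khat = k • 1 :=
      LinearMap.ext fun v => hlevel i v
    have h2 := (LieModule.toEnd ℂ (AffineSl N) (M i)).map_lie (germ N (t i) f) (germ N (t i) g)
    rw [lie_germ, map_add, map_smul, h1, smul_smul, mul_comm] at h2
    exact h2.symm
  rw [actM, actM, sum_actFactor_commutator, actM, Finset.mul_sum, Finset.sum_smul,
    ← Finset.sum_add_distrib]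
  refine Finset.sum_congr rfl fun i _ => ?_
  rw [h]
  refine ((actFactorₗ M i).map_add _ _).trans (congrArg₂ _ rfl ?_)
  refine ((actFactorₗ M i).map_smul _ _).trans (congrArg₂ _ rfl (actFactor_one i))

variable (N M) in
/-- The subspace `g_out^trig M`. -/
abbrev trigSpan : Submodule ℂ (⨂[ℂ] i, M i) := Submodule.span ℂ
  {w | ∃ f : meroOrb N, (f : Mat N (RatFunc ℂ)) ∈ gTrig N (marked N t) ∧ ∃ v, w = actM N t M f v}

theorem actM_mem_trigSpan {f : meroOrb N} (hf : (f : Mat N (RatFunc ℂ)) ∈ gTrig N (marked N t))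
    (v : ⨂[ℂ] i, M i) : actM N t M f v ∈ trigSpan N t M :=
  Submodule.subset_span ⟨f, hf, v, rfl⟩

theorem cocycle_constSec (c : ℂ) (H : cartan N) (B : Mat N (LaurentSeries ℂ)) :
    cocycle 1 ((germ N c (constSec H)).1 : Mat N (LaurentSeries ℂ)) B = 0 := by
  have : matD ((germ N c (constSec H)).1 : Mat N (LaurentSeries ℂ)) = 0 := by
    ext1 j k
    change D (expand c (algebraMap ℂ (RatFunc ℂ) _)) = 0
    rw [expand_algebraMap, D_C]
  rw [cocycle, this, zero_mul, Matrix.trace_zero, map_zero, mul_zero]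

theorem cartan_mul_comm {A B : Mat N ℂ} (hA : A ∈ cartan N) (hB : B ∈ cartan N) :
    A * B = B * A := by
  rw [← hA.1.diagonal_diag, ← hB.1.diagonal_diag, Matrix.diagonal_mul_diagonal,
    Matrix.diagonal_mul_diagonal]
  simp only [mul_comm]

/-- Equivariance forces the values at $0$ and $\infty$ into the commutative Cartan subalgebra. The
bracket with a constant vanishes at both points, where the gluing condition becomes trivial. -/
theorem lie_constSec_mem_gTrig (H : cartan N) {f : meroOrb N} {S : Set (OnePoint ℂ)}
    (hf : (f : Mat N (RatFunc ℂ)) ∈ gTrig N S) :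
    ((⁅constSec H, f⁆ : meroOrb N) : Mat N (RatFunc ℂ)) ∈ gTrig N S := by
  have h : ∀ P, HoloAt P (f : Mat N (RatFunc ℂ)) →
      valueAt P (f : Mat N (RatFunc ℂ)) ∈ cartan N →
      valueAt P ((⁅constSec H, f⁆ : meroOrb N) : Mat N (RatFunc ℂ)) = 0 := by
    intro P hP hc
    change valueAt P ((constSec H : Mat N (RatFunc ℂ)) * (f : Mat N (RatFunc ℂ)) -
      (f : Mat N (RatFunc ℂ)) * (constSec H : Mat N (RatFunc ℂ))) = 0
    rw [valueAt_sub, valueAt_mul (holoAt_constSec H P) hP, valueAt_mul hP (holoAt_constSec H P),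
      valueAt_constSec, cartan_mul_comm H.2 hc, sub_self]
  refine ⟨LieSubalgebra.lie_mem _ (constSec_mem_gOrb H S) hf.1, (holoAt_constSec H _).lie hf.2.1,
    (holoAt_constSec H _).lie hf.2.2.1, ?_⟩
  rw [h _ hf.2.1 (valueAt_zero_mem_cartan f), h _ hf.2.2.1 (valueAt_infty_mem_cartan f), map_zero]

theorem actM_constSec_mul
    (hlevel : ∀ (i : Fin L) (v : M i), ⁅(Affine.khat : AffineSl N), v⁆ = k • v) (H : cartan N)
    (f : meroOrb N) : actM N t M (constSec H) * actM N t M f =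
      actM N t M ⁅constSec H, f⁆ + actM N t M f * actM N t M (constSec H) := by
  have h := actM_commutator t hlevel (constSec H) f
  have h0 : ∑ i, cocycle 1 ((germ N (t i) (constSec H)).1 : Mat N (LaurentSeries ℂ))
      (germ N (t i) f).1 = 0 := Finset.sum_eq_zero fun i _ => cocycle_constSec _ H _
  rw [h0, mul_zero, zero_smul, add_zero] at h
  exact sub_eq_iff_eq_add.mp h

theorem constSec_act_trigSpan_le
    (hlevel : ∀ (i : Fin L) (v : M i), ⁅(Affine.khat : AffineSl N), v⁆ = k • v) (H : cartan N) :
    trigSpan N t M ≤ (trigSpan N t M).comap (actM N t M (constSec H)) := by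
  refine Submodule.span_le.mpr ?_
  rintro _ ⟨f, hf, v, rfl⟩
  have h := LinearMap.congr_fun (actM_constSec_mul t hlevel H f) v
  rw [Module.End.mul_apply, LinearMap.add_apply, Module.End.mul_apply] at h
  rw [SetLike.mem_coe, Submodule.mem_comap, h]
  exact add_mem (actM_mem_trigSpan t (lie_constSec_mem_gTrig H hf) v) (actM_mem_trigSpan t hf _)

/-- The action of the Cartan subalgebra on `M / g_out^trig M`. -/
def cartanCC (hlevel : ∀ (i : Fin L) (v : M i), ⁅(Affine.khat : AffineSl N), v⁆ = k • v)
    (H : cartan N) : Module.End ℂ ((⨂[ℂ] i, M i) ⧸ trigSpan N t M) :=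
  (trigSpan N t M).mapQ _ (actM N t M (constSec H)) (constSec_act_trigSpan_le t hlevel H)

end Action

/-! ### Finiteness of the coinvariants of `g^trig` -/

section Generation

variable {N L : ℕ} {t : Fin L → ℂ} {M : Fin L → Type*} [∀ i, AddCommGroup (M i)]
  [∀ i, Module ℂ (M i)] [∀ i, LieRingModule (AffineSl N) (M i)]
  [∀ i, LieModule ℂ (AffineSl N) (M i)]

theorem germ_mem_affinePlus {c : ℂ} {f : meroOrb N} (hf : HoloAt c (f : Mat N (RatFunc ℂ))) :
    germ N c f ∈ affinePlus N := hf

/-- If `V` is stable under regular loops and generates the module, then every subspace `Y ⊇ V`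
such that `⁅a, y⁆ ∈ Y` whenever all `⁅r, y⁆`, `r` regular, stay in a regular-stable subspace of
`Y` containing `y`, is everything. -/
theorem eq_top_of_lie_mem {X : Type*} [AddCommGroup X] [Module ℂ X] [LieRingModule (AffineSl N) X]
    [LieModule ℂ (AffineSl N) X] (V : LieSubmodule ℂ (affinePlus N) X)
    (hgen : LieSubmodule.lieSpan ℂ (AffineSl N) (V : Set X) = ⊤) (Y : Submodule ℂ X)
    (hV : V.toSubmodule ≤ Y)
    (hY : ∀ U : LieSubmodule ℂ (affinePlus N) X, U.toSubmodule ≤ Y →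
      ∀ a : AffineSl N, ∀ y ∈ U, ⁅a, y⁆ ∈ Y) : Y = ⊤ := by
  -- The largest regular-stable subspace inside `Y`; it contains `V`.
  let G : LieSubmodule ℂ (affinePlus N) X :=
    sSup {U : LieSubmodule ℂ (affinePlus N) X | U.toSubmodule ≤ Y}
  have hG : G.toSubmodule ≤ Y := by
    rw [LieSubmodule.sSup_toSubmodule]
    refine sSup_le ?_
    rintro _ ⟨U, hU, rfl⟩
    exact hU
  -- Enlarging `G` by all brackets with its elements keeps it regular-stable, by the Leibniz rule,
  -- and inside `Y`, by `hY`. Maximality then makes `G` stable under the whole affine algebra.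
  let U : LieSubmodule ℂ (affinePlus N) X :=
    { G.toSubmodule ⊔ Submodule.span ℂ {x | ∃ a : AffineSl N, ∃ y ∈ G, x = ⁅a, y⁆} with
      lie_mem := fun {r x} hx => by
        change x ∈ G.toSubmodule ⊔ Submodule.span ℂ {x | ∃ a : AffineSl N, ∃ y ∈ G, x = ⁅a, y⁆} at hx
        change ⁅r, x⁆ ∈ G.toSubmodule ⊔
          Submodule.span ℂ {x | ∃ a : AffineSl N, ∃ y ∈ G, x = ⁅a, y⁆}
        obtain ⟨y, hy, z, hz, rfl⟩ := Submodule.mem_sup.mp hx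
        rw [lie_add]
        refine add_mem (Submodule.mem_sup_left (G.lie_mem hy)) (Submodule.mem_sup_right ?_)
        induction hz using Submodule.span_induction with
        | mem z hz =>
          obtain ⟨a, w, hw, rfl⟩ := hz
          change ⁅(r : AffineSl N), ⁅a, w⁆⁆ ∈ _
          rw [leibniz_lie]
          exact add_mem (Submodule.subset_span ⟨_, w, hw, rfl⟩)
            (Submodule.subset_span ⟨a, _, G.lie_mem (x := r) hw, rfl⟩)
        | zero => rw [lie_zero]; exact zero_mem _
        | add z w _ _ hz hw => rw [lie_add]; exact add_mem (hz (by
            exact Submodule.mem_sup.mpr ⟨y, hy, z, ‹_›, rfl⟩)) (hw (by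
            exact Submodule.mem_sup.mpr ⟨y, hy, w, ‹_›, rfl⟩))
        | smul c z _ hz => rw [lie_smul]; exact Submodule.smul_mem _ _ (hz (by
            exact Submodule.mem_sup.mpr ⟨y, hy, z, ‹_›, rfl⟩)) }
  have hU : U.toSubmodule ≤ Y := by
    change G.toSubmodule ⊔ Submodule.span ℂ {x | ∃ a : AffineSl N, ∃ y ∈ G, x = ⁅a, y⁆} ≤ Y
    refine sup_le hG (Submodule.span_le.mpr ?_)
    rintro _ ⟨a, y, hy, rfl⟩
    exact hY G hG a y hy
  have hUG : U ≤ G := le_sSup hU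
  let G' : LieSubmodule ℂ (AffineSl N) X :=
    { G.toSubmodule with
      lie_mem := fun {a x} hx => hUG (show ⁅a, x⁆ ∈ G.toSubmodule ⊔ Submodule.span ℂ
        {x | ∃ a : AffineSl N, ∃ y ∈ G, x = ⁅a, y⁆} from
          Submodule.mem_sup_right (Submodule.subset_span ⟨a, x, hx, rfl⟩)) }
  have h1 : LieSubmodule.lieSpan ℂ (AffineSl N) (V : Set X) ≤ G' :=
    LieSubmodule.lieSpan_le.mpr fun x hx =>
      (le_sSup (show V ∈ {U : LieSubmodule ℂ (affinePlus N) X | U.toSubmodule ≤ Y} from hV) :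
        V ≤ G) hx
  rw [hgen] at h1
  exact top_unique fun x _ => hG (h1 (LieSubmodule.mem_top x))

/-- `M` is spanned by `V_1 ⊗ ⋯ ⊗ V_L` and `g_out^trig M`. -/
theorem range_sup_trigSpan_eq_top (hN : N ≠ 0) (ht0 : ∀ i, t i ≠ 0)
    (htne : ∀ i j, i ≠ j → ∀ a : ℕ, t i ≠ (eps N : ℂ) ^ a * t j)
    (V : ∀ i, LieSubmodule ℂ (affinePlus N) (M i))
    (hVgen : ∀ i, LieSubmodule.lieSpan ℂ (AffineSl N) (V i : Set (M i)) = ⊤) :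
    LinearMap.range (PiTensorProduct.map fun i => (V i).toSubmodule.subtype) ⊔ trigSpan N t M =
      ⊤ := by
  set P := LinearMap.range (PiTensorProduct.map fun i => (V i).toSubmodule.subtype) ⊔ trigSpan N t M
    with hP
  -- Induction on the set of positions whose vectors are not required to lie in the `V i`.
  have main : ∀ s : Finset (Fin L), ∀ x : ∀ i, M i, (∀ i, i ∉ s → x i ∈ V i) →
      PiTensorProduct.tprod ℂ x ∈ P := by
    intro s
    induction s using Finset.induction_on with
    | empty =>
      intro x hx
      refine Submodule.mem_sup_left ⟨PiTensorProduct.tprod ℂ fun i => ⟨x i, hx i (by simp)⟩, ?_⟩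
      rw [PiTensorProduct.map_tprod]
      rfl
    | insert i s his ih =>
      let Y : Submodule ℂ (M i) :=
        { carrier := {y | ∀ x : ∀ i, M i, (∀ j, j ∉ insert i s → x j ∈ V j) →
            PiTensorProduct.tprod ℂ (Function.update x i y) ∈ P}
          add_mem' := fun {y z} hy hz x hx => by
            rw [MultilinearMap.map_update_add]; exact add_mem (hy x hx) (hz x hx)
          zero_mem' := fun x hx => by
            rw [MultilinearMap.map_update_zero]; exact zero_mem _
          smul_mem' := fun c y hy x hx => by
            rw [MultilinearMap.map_update_smul]; exact Submodule.smul_mem _ _ (hy x hx) }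
      have hYmem : ∀ y, y ∈ Y ↔ ∀ x : ∀ i, M i, (∀ j, j ∉ insert i s → x j ∈ V j) →
            PiTensorProduct.tprod ℂ (Function.update x i y) ∈ P := fun y => Iff.rfl
      have hY : Y = ⊤ := by
        refine eq_top_of_lie_mem (V i) (hVgen i) Y (fun y hy x hx => ih _ fun j hj => ?_) ?_
        · by_cases hji : j = i
          · subst hji; rw [Function.update_self]; exact hy
          · rw [Function.update_of_ne hji]
            exact hx j (by simp [hji, hj])
        · intro U hU a y hy
          -- The loop `a` is replaced by a trigonometric section `f` with the same principal part at
          -- `t i`. The regular difference preserves `U`, and modulo $\mathfrak g^{\rm trig}_{\rm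
          -- out}M$ the germ of `f` at `t i` can be moved to the other factors, where `f` is regular
          -- and preserves the `V j`.
          obtain ⟨f, hf, hfi, hfl⟩ := exists_gTrig_principal hN ht0 htne i (A := a.1) a.1.2
          have hr : germ N (t i) f - a ∈ affinePlus N := hfi
          have h1 : ⁅a, y⁆ = ⁅germ N (t i) f, y⁆ - ⁅germ N (t i) f - a, y⁆ := by
            rw [sub_lie, sub_sub_cancel]
          rw [h1]
          refine sub_mem ?_ (hU (U.lie_mem (x := ⟨_, hr⟩) hy))
          rw [hYmem]
          intro x hx
          have h2 := actM_mem_trigSpan t hf (PiTensorProduct.tprod ℂ (Function.update x i y))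
          rw [actM, LinearMap.sum_apply, ← Finset.add_sum_erase _ _ (Finset.mem_univ i),
            actFactor_tprod, Function.update_self, Function.update_idem] at h2
          rw [← add_sub_cancel_right (PiTensorProduct.tprod ℂ (Function.update x i _)) _]
          refine sub_mem (Submodule.mem_sup_right h2) (sum_mem fun j hj => ?_)
          have hji := (Finset.mem_erase.mp hj).1
          rw [actFactor_tprod, Function.update_of_ne hji, Function.update_comm hji.symm]
          refine hU hy _ fun l hl => ?_
          by_cases hlj : l = j
          · subst hlj
            rw [Function.update_self]
            exact (V l).lie_mem (x := ⟨_, germ_mem_affinePlus (hfl l hji)⟩) (hx l hl)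
          · rw [Function.update_of_ne hlj]
            exact hx l hl
      intro x hx
      have := (hYmem (x i)).mp (hY ▸ Submodule.mem_top) x hx
      rwa [Function.update_eq_self] at this
  refine tensor_eq_top_of_tprod_mem P (fun i => Set.univ) (fun i => Submodule.span_univ)
    fun x _ => main Finset.univ x fun i hi => absurd (Finset.mem_univ i) hi

end Generation

/-! ### Orders of matrices of Laurent series -/

section MatOrd

variable {N : ℕ} {A B : Mat N (LaurentSeries ℂ)} {m n : ℤ}

theorem MatOrdGE.anti (h : MatOrdGE n A) (hmn : m ≤ n) : MatOrdGE m A :=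
  fun j k => ordGE_anti hmn (h j k)

theorem MatOrdGE.add (hA : MatOrdGE n A) (hB : MatOrdGE n B) : MatOrdGE n (A + B) :=
  fun j k => add_mem (hA j k) (hB j k)

theorem MatOrdGE.sub (hA : MatOrdGE n A) (hB : MatOrdGE n B) : MatOrdGE n (A - B) :=
  fun j k => sub_mem (hA j k) (hB j k)

theorem MatOrdGE.mul (hA : MatOrdGE m A) (hB : MatOrdGE n B) {l : ℤ} (hl : l ≤ m + n) :
    MatOrdGE l (A * B) := fun j k => by
  rw [Matrix.mul_apply]
  exact sum_mem fun i _ => mul_mem_ordGE (hA j i) (hB i k) hl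

theorem MatOrdGE.lie (hA : MatOrdGE m A) (hB : MatOrdGE n B) {l : ℤ} (hl : l ≤ m + n) :
    MatOrdGE l ⁅A, B⁆ :=
  (hA.mul hB hl).sub (hB.mul hA (by omega))

theorem cocycle_eq_zero (c : ℂ) (hA : MatOrdGE m A) (hB : MatOrdGE n B) (h : 1 ≤ m + n) :
    cocycle c A B = 0 := by
  have h1 : MatOrdGE (m - 1) (matD A) := fun j k => D_mem_ordGE (hA j k) le_rfl
  have h2 : MatOrdGE 0 (matD A * B) := h1.mul hB (by omega)
  have h3 : (matD A * B).trace ∈ ordGE 0 := sum_mem fun j _ => h2 j j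
  rw [cocycle, res_eq_zero h3, mul_zero]

theorem cocycle_congr (c : ℂ) {A' B' : Mat N (LaurentSeries ℂ)} {p : ℤ} (hB : MatOrdGE p B)
    (hA' : MatOrdGE p A') (hAA : MatOrdGE n (A - A')) (hBB : MatOrdGE n (B - B'))
    (h : 1 ≤ p + n) : cocycle c A B = cocycle c A' B' := by
  have h1 : cocycle c A B = cocycle c (A - A') B + cocycle c A' (B - B') + cocycle c A' B' := by
    rw [add_assoc, ← cocycle_add_right, sub_add_cancel, ← cocycle_add_left, sub_add_cancel]
  rw [h1, cocycle_eq_zero c hAA hB (by omega), cocycle_eq_zero c hA' hBB h, zero_add, zero_add]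

theorem lie_sub_lie_matOrdGE {A' B' : Mat N (LaurentSeries ℂ)} {p l : ℤ} (hB : MatOrdGE p B)
    (hA' : MatOrdGE p A') (hAA : MatOrdGE n (A - A')) (hBB : MatOrdGE n (B - B'))
    (h : l ≤ p + n) : MatOrdGE l (⁅A, B⁆ - ⁅A', B'⁆) := by
  have : ⁅A, B⁆ - ⁅A', B'⁆ = ⁅A - A', B⁆ + ⁅A', B - B'⁆ := by
    rw [sub_lie, lie_sub, sub_add_sub_cancel]
  rw [this]
  exact (hAA.lie hB (by omega)).add (hA'.lie hBB h)

end MatOrd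

/-! ### Verma modules -/

namespace Verma

variable {N : ℕ} {z : ℂˣ} {k : ℂ} {lam : Module.Dual ℂ (cartan N)}

/-- The class of `u` in the Verma module. -/
def mk : UTw N z →ₗ[ℂ] Verma N z k lam :=
  ((vermaIdeal N z k lam).mkQ).restrictScalars ℂ

variable (N z k lam) in
/-- The highest weight vector. -/
def vac : Verma N z k lam := mk 1

theorem lie_mk (x : AffineTw N z) (u : UTw N z) :
    ⁅x, (mk u : Verma N z k lam)⁆ = mk (iotaTw N z x * u) := rfl

theorem mk_surjective : Function.Surjective (mk : UTw N z →ₗ[ℂ] Verma N z k lam) :=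
  fun v => Quot.exists_rep v

theorem mk_eq_zero {u : UTw N z} (hu : u ∈ vermaIdeal N z k lam) :
    (mk u : Verma N z k lam) = 0 := (Submodule.Quotient.mk_eq_zero _).mpr hu

theorem lie_vac_of_mem_nPlus {x : AffineTw N z} (hx : x ∈ nPlus N z) : ⁅x, vac N z k lam⁆ = 0 := by
  rw [vac, lie_mk, mul_one]
  exact mk_eq_zero (Submodule.subset_span (Or.inl (Or.inl ⟨x, hx, rfl⟩)))

theorem lie_cartanTw_vac (H : cartan N) :
    ⁅cartanTw N z H, vac N z k lam⁆ = lam H • vac N z k lam := by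
  rw [vac, lie_mk, mul_one, ← map_smul, ← sub_eq_zero, ← map_sub]
  refine mk_eq_zero (Submodule.subset_span (Or.inl (Or.inr ⟨H, ?_⟩)))
  rw [Algebra.algebraMap_eq_smul_one]

/-- A subspace of a Verma module that contains the highest weight vector and is stable under the
Lie algebra is everything. -/
theorem eq_top_of_lie_mem (P : Submodule ℂ (Verma N z k lam)) (h0 : vac N z k lam ∈ P)
    (h1 : ∀ (x : AffineTw N z), ∀ v ∈ P, ⁅x, v⁆ ∈ P) : P = ⊤ := by
  let S : Subalgebra ℂ (UTw N z) :=
    { carrier := {u | ∀ v ∈ P, u • v ∈ P}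
      mul_mem' := fun {u w} hu hw v hv => by rw [mul_smul]; exact hu _ (hw _ hv)
      add_mem' := fun {u w} hu hw v hv => by rw [add_smul]; exact add_mem (hu _ hv) (hw _ hv)
      algebraMap_mem' := fun c v hv => by
        rw [algebraMap_smul]; exact P.smul_mem c hv }
  let ι' : AffineTw N z →ₗ⁅ℂ⁆ S :=
    { toFun := fun x => ⟨iotaTw N z x, h1 x⟩
      map_add' := fun x y => Subtype.ext (map_add (iotaTw N z) x y)
      map_smul' := fun c x => Subtype.ext (map_smul (iotaTw N z) c x)
      map_lie' := fun {x y} => Subtype.ext ((iotaTw N z).map_lie x y) }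
  -- Both sides agree on the Lie algebra, so the elements of the enveloping algebra that preserve
  -- `P` are all of it.
  have h2 : S.val.comp (UniversalEnvelopingAlgebra.lift ℂ ι') = AlgHom.id ℂ _ := by
    apply UniversalEnvelopingAlgebra.hom_ext
    ext x
    change S.val (UniversalEnvelopingAlgebra.lift ℂ ι' (UniversalEnvelopingAlgebra.ι ℂ x)) = _
    rw [UniversalEnvelopingAlgebra.lift_ι_apply]
    rfl
  refine top_unique fun v _ => ?_
  obtain ⟨u, rfl⟩ := mk_surjective v
  have h3 : u ∈ S := by
    have := DFunLike.congr_fun h2 u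
    change S.val (UniversalEnvelopingAlgebra.lift ℂ ι' u) = u at this
    rw [← this]
    exact (UniversalEnvelopingAlgebra.lift ℂ ι' u).2
  have h4 : (mk u : Verma N z k lam) = u • vac N z k lam := by
    have h5 : u • vac N z k lam = (mk (u * 1) : Verma N z k lam) := rfl
    rw [h5, mul_one]
  rw [h4]
  exact h3 _ h0

/-- The universal property of Verma modules. -/
theorem exists_lift {Y : Type*} [AddCommGroup Y] [Module ℂ Y]
    (ρ : AffineTw N z →ₗ⁅ℂ⁆ Module.End ℂ Y) (y : Y) (hn : ∀ x ∈ nPlus N z, ρ x y = 0)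
    (hH : ∀ H, ρ (cartanTw N z H) y = lam H • y) (hk : ρ Affine.khat y = k • y) :
    ∃ F : Verma N z k lam →ₗ[ℂ] Y, F (vac N z k lam) = y ∧ ∀ x v, F ⁅x, v⁆ = ρ x (F v) := by
  let φ : UTw N z →ₐ[ℂ] Module.End ℂ Y := UniversalEnvelopingAlgebra.lift ℂ ρ
  have hφ : ∀ x, φ (iotaTw N z x) = ρ x := fun x =>
    UniversalEnvelopingAlgebra.lift_ι_apply ℂ ρ x
  let F₀ : UTw N z →ₗ[ℂ] Y := (LinearMap.applyₗ y).comp φ.toLinearMap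
  have hF₀ : ∀ u, F₀ u = φ u y := fun u => rfl
  -- The annihilator of `y` is a left ideal, so it is enough to test the generators.
  have hker : (vermaIdeal N z k lam).restrictScalars ℂ ≤ LinearMap.ker F₀ := by
    intro u hu
    rw [Submodule.restrictScalars_mem] at hu
    rw [LinearMap.mem_ker, hF₀]
    induction hu using Submodule.span_induction with
    | mem u hu =>
      rcases hu with (⟨x, hx, rfl⟩ | ⟨H, rfl⟩) | rfl
      · rw [hφ, hn x hx]
      · rw [map_sub, hφ, AlgHom.commutes, LinearMap.sub_apply, hH, Module.algebraMap_end_apply,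
          sub_self]
      · rw [map_sub, hφ, AlgHom.commutes, LinearMap.sub_apply, hk, Module.algebraMap_end_apply,
          sub_self]
    | zero => rw [map_zero]; rfl
    | add u v _ _ hu hv => rw [map_add, LinearMap.add_apply, hu, hv, add_zero]
    | smul a u _ hu => rw [smul_eq_mul, map_mul, Module.End.mul_apply, hu, map_zero]
  let F : Verma N z k lam →ₗ[ℂ] Y := ((vermaIdeal N z k lam).restrictScalars ℂ).liftQ F₀ hker
  have hF : ∀ u, F (mk u) = φ u y := fun u => rfl
  refine ⟨F, ?_, fun x v => ?_⟩
  · rw [vac, hF, map_one]; rfl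
  · obtain ⟨u, rfl⟩ := mk_surjective v
    rw [lie_mk, hF, hF, map_mul, hφ]; rfl

/-- The vectors on which $\hat k$ acts by $k$ form a submodule, because $\hat k$ is central, and the
highest weight vector is one of them. -/
theorem lie_khat (v : Verma N z k lam) : ⁅(Affine.khat : AffineTw N z), v⁆ = k • v := by
  have hc : ∀ x : AffineTw N z, ⁅(Affine.khat : AffineTw N z), x⁆ = 0 := fun x => by
    refine Affine.ext' (fun i j => ?_) ?_
    · change ⁅(0 : Mat N (LaurentSeries ℂ)), (x.1 : Mat N (LaurentSeries ℂ))⁆ i j = 0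
      rw [zero_lie]; rfl
    · change cocycle (1 / (N : ℂ)) (0 : Mat N (LaurentSeries ℂ)) x.1 = 0
      have : matD (0 : Mat N (LaurentSeries ℂ)) = 0 := by ext1 i j; simp [matD]
      rw [cocycle, this, zero_mul, Matrix.trace_zero, map_zero, mul_zero]
  let P : Submodule ℂ (Verma N z k lam) :=
    LinearMap.ker (LieModule.toEnd ℂ (AffineTw N z) (Verma N z k lam) Affine.khat - k • 1)
  have hP : ∀ v, v ∈ P ↔ ⁅(Affine.khat : AffineTw N z), v⁆ = k • v := fun v => by
    rw [LinearMap.mem_ker, LinearMap.sub_apply, sub_eq_zero]; rfl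
  have := eq_top_of_lie_mem P ?_ ?_
  · exact (hP v).mp (this ▸ Submodule.mem_top)
  · rw [hP, vac, lie_mk, mul_one, ← map_smul, ← sub_eq_zero, ← map_sub]
    refine mk_eq_zero (Submodule.subset_span (Or.inr ?_))
    rw [Algebra.algebraMap_eq_smul_one]; rfl
  · intro x v hv
    rw [hP] at hv ⊢
    rw [leibniz_lie, hc, zero_lie, zero_add, hv, lie_smul]

/-- Every vector of a Verma module is annihilated by all loops of sufficiently high order. -/
theorem smooth (v : Verma N z k lam) : ∃ n : ℕ, ∀ x : AffineTw N z, x.2 = 0 →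
    MatOrdGE n (x.1 : Mat N (LaurentSeries ℂ)) → ⁅x, v⁆ = 0 := by
  let P : Submodule ℂ (Verma N z k lam) :=
    { carrier := {v | ∃ n : ℕ, ∀ x : AffineTw N z, x.2 = 0 →
        MatOrdGE n (x.1 : Mat N (LaurentSeries ℂ)) → ⁅x, v⁆ = 0}
      add_mem' := by
        rintro v w ⟨m, hm⟩ ⟨n, hn⟩
        refine ⟨max m n, fun x hx hx' => ?_⟩
        rw [lie_add, hm x hx (hx'.anti (by simp)), hn x hx (hx'.anti (by simp)), add_zero]
      zero_mem' := ⟨0, fun x _ _ => lie_zero x⟩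
      smul_mem' := by
        rintro c v ⟨m, hm⟩
        exact ⟨m, fun x hx hx' => by rw [lie_smul, hm x hx hx', smul_zero]⟩ }
  have hP : P = ⊤ := by
    refine eq_top_of_lie_mem P ⟨1, fun x hx hx' => ?_⟩ ?_
    · exact lie_vac_of_mem_nPlus ⟨fun i j n hn => hx' i j n (by push_cast; omega), hx⟩
    · rintro a v ⟨n, hn⟩
      obtain ⟨q, hq⟩ := exists_matOrdGE (a.1 : Mat N (LaurentSeries ℂ))
      -- If `a` has poles of order at most `q`, the bracket with `a` still has order at least `n`;
      -- the extra $1$ makes its cocycle vanish even when $n=0$.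
      refine ⟨n + q + 1, fun x hx hx' => ?_⟩
      rw [leibniz_lie, hn x hx (hx'.anti (by push_cast; omega)), lie_zero, add_zero]
      refine hn _ ?_ ?_
      · exact cocycle_eq_zero (1 / (N : ℂ)) hx' (show MatOrdGE (-q) _ from hq) (by push_cast; omega)
      · exact MatOrdGE.lie hx' (show MatOrdGE (-q) _ from hq) (by push_cast; omega)
  exact (hP ▸ Submodule.mem_top : v ∈ P)

/-- A regular loop with constant term `H` acts on the highest weight vector by `λ(H)`. -/
theorem lie_vac_of_regular {x : AffineTw N z} {H : cartan N} (h2 : x.2 = 0)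
    (hreg : ∀ i j, (x.1 : Mat N (LaurentSeries ℂ)) i j ∈ regular)
    (hH : ∀ i j, ((x.1 : Mat N (LaurentSeries ℂ)) i j).coeff 0 = (H : Mat N ℂ) i j) :
    ⁅x, vac N z k lam⁆ = lam H • vac N z k lam := by
  have h1 : x - cartanTw N z H ∈ nPlus N z := by
    refine ⟨fun i j n hn => ?_, ?_⟩
    · change ((x.1 : Mat N (LaurentSeries ℂ)) i j - algebraMap ℂ (LaurentSeries ℂ)
        ((H : Mat N ℂ) i j)).coeff n = 0
      rw [HahnSeries.coeff_sub]
      rcases hn.lt_or_eq with h | rfl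
      · rw [hreg i j n h, regular.algebraMap_mem ((H : Mat N ℂ) i j) n h, sub_zero]
      · rw [hH, sub_eq_zero]
        change _ = (HahnSeries.single (0 : ℤ) _ : LaurentSeries ℂ).coeff 0
        rw [HahnSeries.coeff_single_same]; rfl
    · change x.2 - 0 = 0
      rw [h2, sub_zero]
  rw [← sub_add_cancel x (cartanTw N z H), add_lie, lie_vac_of_mem_nPlus h1, lie_cartanTw_vac,
    zero_add]

end Verma

/-! ### Approximation of loops at `0` and `∞` by global sections -/

section Approx

variable {N : ℕ}

/-- The loop `x` has no terms of order less than `n`. -/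
def Affine.OrdGE {K : LieSubalgebra ℂ (Mat N (LaurentSeries ℂ))} {c : ℂ} (n : ℤ)
    (x : Affine K c) : Prop := MatOrdGE n (x.1 : Mat N (LaurentSeries ℂ))

namespace Affine

variable {K : LieSubalgebra ℂ (Mat N (LaurentSeries ℂ))} {c : ℂ} {x y : Affine K c} {m n : ℤ}

theorem OrdGE.anti (h : OrdGE n x) (hmn : m ≤ n) : OrdGE m x := MatOrdGE.anti h hmn

theorem OrdGE.add (hx : OrdGE n x) (hy : OrdGE n y) : OrdGE n (x + y) := MatOrdGE.add hx hy

theorem OrdGE.sub (hx : OrdGE n x) (hy : OrdGE n y) : OrdGE n (x - y) := MatOrdGE.sub hx hy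

theorem OrdGE.smul (r : ℂ) (hx : OrdGE n x) : OrdGE n (r • x) :=
  fun j k => (ordGE n).smul_mem r (hx j k)

theorem ordGE_zero : OrdGE n (0 : Affine K c) := fun _ _ => zero_mem _

theorem exists_ordGE (x : Affine K c) : ∃ q : ℕ, OrdGE (-q) x := exists_matOrdGE _

theorem OrdGE.of_sub (hx : OrdGE n y) (h : OrdGE m (x - y)) (hmn : n ≤ m) : OrdGE n x := by
  rw [← sub_add_cancel x y]
  exact (h.anti hmn).add hx

end Affine

theorem germZero_add (f g : meroOrb N) : germZero N (f + g) = germZero N f + germZero N g :=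
  Affine.ext' (fun _ _ => map_add (expand ((0 : ℂ) : OnePoint ℂ)) _ _) (add_zero (0 : ℂ)).symm

theorem germZero_smul (r : ℂ) (f : meroOrb N) : germZero N (r • f) = r • germZero N f :=
  Affine.ext' (fun _ _ => map_smul (expand ((0 : ℂ) : OnePoint ℂ)) r _) (mul_zero r).symm

theorem germInfty_add (f g : meroOrb N) : germInfty N (f + g) = germInfty N f + germInfty N g :=
  Affine.ext' (fun _ _ => map_add (expand OnePoint.infty) _ _) (add_zero (0 : ℂ)).symm

theorem germInfty_smul (r : ℂ) (f : meroOrb N) : germInfty N (r • f) = r • germInfty N f :=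
  Affine.ext' (fun _ _ => map_smul (expand OnePoint.infty) r _) (mul_zero r).symm

/-- Taking germs respects brackets up to the central term, which `Affine.OrdGE` does not see; hence
the order is arbitrary. -/
theorem germZero_lie (f g : meroOrb N) (n : ℤ) :
    Affine.OrdGE n (germZero N ⁅f, g⁆ - ⁅germZero N f, germZero N g⁆) := fun j k => by
  have h : expand ((0 : ℂ) : OnePoint ℂ) (⁅(f : Mat N (RatFunc ℂ)), (g : Mat N (RatFunc ℂ))⁆ j k) -
      ⁅(f : Mat N (RatFunc ℂ)).map (expand ((0 : ℂ) : OnePoint ℂ)),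
        (g : Mat N (RatFunc ℂ)).map (expand ((0 : ℂ) : OnePoint ℂ))⁆ j k ∈ ordGE n := by
    rw [lie_map_expand, sub_self]; exact zero_mem _
  exact h

theorem germInfty_lie (f g : meroOrb N) (n : ℤ) :
    Affine.OrdGE n (germInfty N ⁅f, g⁆ - ⁅germInfty N f, germInfty N g⁆) := fun j k => by
  have h : expand OnePoint.infty (⁅(f : Mat N (RatFunc ℂ)), (g : Mat N (RatFunc ℂ))⁆ j k) -
      ⁅(f : Mat N (RatFunc ℂ)).map (expand OnePoint.infty),
        (g : Mat N (RatFunc ℂ)).map (expand OnePoint.infty)⁆ j k ∈ ordGE n := by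
    rw [lie_map_expand, sub_self]; exact zero_mem _
  exact h

variable {L : ℕ} (t : Fin L → ℂ)

/-- `f` is a section of `g^orb`, holomorphic outside the marked points, `0` and `∞`, that agrees
with the loops `x.1` at `0` and `x.2` at `∞` up to terms of order at least `n`. -/
structure Approx (n : ℤ) (x : AffineZero N × AffineInfty N) (f : meroOrb N) : Prop where
  mem : (f : Mat N (RatFunc ℂ)) ∈ gOrb N (markedZeroInfty N t)
  zero : Affine.OrdGE n (germZero N f - x.1)
  infty : Affine.OrdGE n (germInfty N f - x.2)

variable {t} {m n : ℤ} {x y : AffineZero N × AffineInfty N} {f g : meroOrb N}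

theorem Approx.anti (h : Approx t n x f) (hmn : m ≤ n) : Approx t m x f :=
  ⟨h.mem, h.zero.anti hmn, h.infty.anti hmn⟩

theorem Approx.add (hf : Approx t n x f) (hg : Approx t n y g) : Approx t n (x + y) (f + g) where
  mem := add_mem hf.mem hg.mem
  zero := by
    rw [germZero_add, Prod.fst_add, add_sub_add_comm]; exact hf.zero.add hg.zero
  infty := by
    rw [germInfty_add, Prod.snd_add, add_sub_add_comm]; exact hf.infty.add hg.infty

theorem Approx.smul (r : ℂ) (hf : Approx t n x f) : Approx t n (r • x) (r • f) where
  mem := SMulMemClass.smul_mem r hf.mem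
  zero := by rw [germZero_smul, Prod.smul_fst, ← smul_sub]; exact hf.zero.smul r
  infty := by rw [germInfty_smul, Prod.smul_snd, ← smul_sub]; exact hf.infty.smul r

theorem Approx.sub (hf : Approx t n x f) (hg : Approx t n y g) : Approx t n (x - y) (f - g) := by
  have := hf.add (hg.smul (-1))
  rwa [neg_one_smul, neg_one_smul, ← sub_eq_add_neg, ← sub_eq_add_neg] at this

theorem approx_germ (hf : (f : Mat N (RatFunc ℂ)) ∈ gOrb N (markedZeroInfty N t)) (n : ℤ) :
    Approx t n (germZero N f, germInfty N f) f :=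
  ⟨hf, by rw [sub_self]; exact Affine.ordGE_zero, by rw [sub_self]; exact Affine.ordGE_zero⟩

theorem exists_Approx (hN : N ≠ 0) (hL : 1 ≤ L) (ht0 : ∀ i, t i ≠ 0)
    (x : AffineZero N × AffineInfty N) (n : ℕ) : ∃ f, Approx t n x f := by
  obtain ⟨f, hf, h0, h1⟩ := exists_approx hN hL ht0 x.1.1.2 x.2.1.2 n
  exact ⟨f, hf, h0, h1⟩

/-- The sum of the cocycles at `0` and `∞`. -/
def cocycleZI (x y : AffineZero N × AffineInfty N) : ℂ :=
  cocycle (1 / (N : ℂ)) (x.1.1 : Mat N (LaurentSeries ℂ)) y.1.1 +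
    cocycle (1 / (N : ℂ)) (x.2.1 : Mat N (LaurentSeries ℂ)) y.2.1

/-- The error is $[f-x,g]+[x,g-y]$ at each point, so poles of order at most `q` cost at most `q`
orders of precision. -/
theorem Approx.lie {q : ℤ} (hq : 0 ≤ q) (hm : 0 ≤ m) (hf : Approx t m x f) (hg : Approx t m y g)
    (hx1 : Affine.OrdGE (-q) x.1) (hx2 : Affine.OrdGE (-q) x.2)
    (hy1 : Affine.OrdGE (-q) y.1) (hy2 : Affine.OrdGE (-q) y.2) (hn : n + q ≤ m) :
    Approx t n ⁅x, y⁆ ⁅f, g⁆ where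
  mem := LieSubalgebra.lie_mem _ hf.mem hg.mem
  zero := by
    rw [← sub_add_sub_cancel]
    refine (germZero_lie f g n).add ?_
    exact lie_sub_lie_matOrdGE (hy1.of_sub hg.zero (by omega)) hx1 hf.zero hg.zero (by omega)
  infty := by
    rw [← sub_add_sub_cancel]
    refine (germInfty_lie f g n).add ?_
    exact lie_sub_lie_matOrdGE (hy2.of_sub hg.infty (by omega)) hx2 hf.infty hg.infty (by omega)

/-- A cocycle vanishes once the orders of its arguments add up to at least $1$, so errors of order
$1+q$ against poles of order `q` do not change it. -/
theorem Approx.cocycleZI_eq {q : ℤ} (hq : 0 ≤ q) (hf : Approx t m x f) (hg : Approx t m y g)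
    (hx1 : Affine.OrdGE (-q) x.1) (hx2 : Affine.OrdGE (-q) x.2)
    (hy1 : Affine.OrdGE (-q) y.1) (hy2 : Affine.OrdGE (-q) y.2) (hm : 1 + q ≤ m) :
    cocycleZI (germZero N f, germInfty N f) (germZero N g, germInfty N g) = cocycleZI x y :=
  congrArg₂ (· + ·)
    (cocycle_congr _ (hy1.of_sub hg.zero (by omega)) hx1 hf.zero hg.zero (by omega))
    (cocycle_congr _ (hy2.of_sub hg.infty (by omega)) hx2 hf.infty hg.infty (by omega))

end Approx

/-! ### The action of loops at `0` and `∞` on smooth maps -/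

section Smooth

variable {N L : ℕ} (t : Fin L → ℂ) (k : ℂ) {X : Type*} [AddCommGroup X] [Module ℂ X]
  (W : Type*) [AddCommGroup W] [Module ℂ W]

variable (N X) in
/-- A projective action of the sections of `g^orb` that are holomorphic outside the marked points,
`0` and `∞`, of the level opposite to `k` at `0` and `∞`; and approximability of loops at `0` and
`∞` by such sections. -/
structure SectionAction where
  act : meroOrb N →ₗ[ℂ] Module.End ℂ X
  commutator : ∀ f g : meroOrb N, (f : Mat N (RatFunc ℂ)) ∈ gOrb N (markedZeroInfty N t) →
    (g : Mat N (RatFunc ℂ)) ∈ gOrb N (markedZeroInfty N t) →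
    act f * act g - act g * act f = act ⁅f, g⁆ -
      (k * cocycleZI (germZero N f, germInfty N f) (germZero N g, germInfty N g)) • 1
  approx : ∀ (x : AffineZero N × AffineInfty N) (n : ℕ), ∃ f, Approx t n x f

variable {t k W}

namespace SectionAction

variable (α : SectionAction N t k X)

/-- `ψ` vanishes on the images of all sections of order at least `n` at `0` and `∞`. -/
def Kills (n : ℕ) (ψ : X →ₗ[ℂ] W) : Prop := ∀ f, Approx t n 0 f → ψ ∘ₗ α.act f = 0

variable {α} {ψ : X →ₗ[ℂ] W} {m n : ℕ} {x y : AffineZero N × AffineInfty N} {f g : meroOrb N}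

theorem Kills.mono (h : α.Kills m ψ) (hmn : m ≤ n) : α.Kills n ψ :=
  fun f hf => h f (hf.anti (by exact_mod_cast hmn))

/-- Two approximations of the same loops differ by an approximation of zero. This makes the action
of loops independent of the chosen section. -/
theorem Kills.comp_eq (h : α.Kills n ψ) (hf : Approx t n x f) (hg : Approx t n x g) :
    ψ ∘ₗ α.act f = ψ ∘ₗ α.act g := by
  have h1 := hf.sub hg
  rw [sub_self] at h1
  have h2 := h _ h1
  rwa [map_sub, LinearMap.comp_sub, sub_eq_zero] at h2

theorem comp_commutator (hf : (f : Mat N (RatFunc ℂ)) ∈ gOrb N (markedZeroInfty N t))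
    (hg : (g : Mat N (RatFunc ℂ)) ∈ gOrb N (markedZeroInfty N t)) (ψ : X →ₗ[ℂ] W) :
    (ψ ∘ₗ α.act f) ∘ₗ α.act g = (ψ ∘ₗ α.act g) ∘ₗ α.act f + ψ ∘ₗ α.act ⁅f, g⁆ -
      (k * cocycleZI (germZero N f, germInfty N f) (germZero N g, germInfty N g)) • ψ := by
  have h := congrArg (fun T : Module.End ℂ X => ψ ∘ₗ T) (α.commutator f g hf hg)
  simp only [LinearMap.comp_sub, LinearMap.comp_smul, Module.End.mul_eq_comp, Module.End.one_eq_id,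
    LinearMap.comp_id, ← LinearMap.comp_assoc] at h
  rw [add_sub_assoc, ← h, add_sub_cancel]

/-- Moving `f` past a section of order $n+q+1$ leaves a bracket of order at least `n` and a
vanishing cocycle, and `ψ` kills every remaining term. -/
theorem Kills.comp (h : α.Kills n ψ) {q : ℕ}
    (hf : (f : Mat N (RatFunc ℂ)) ∈ gOrb N (markedZeroInfty N t))
    (h1 : Affine.OrdGE (-q) (germZero N f)) (h2 : Affine.OrdGE (-q) (germInfty N f)) :
    α.Kills (n + q + 1) (ψ ∘ₗ α.act f) := by
  intro g hg
  rw [comp_commutator hf hg.mem, h g (hg.anti (by push_cast; omega)), LinearMap.zero_comp, zero_add]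
  have hf' := approx_germ (n := ((n + q + 1 : ℕ) : ℤ)) hf
  have h3 := hf'.cocycleZI_eq (q := q) (by omega) hg h1 h2 Affine.ordGE_zero Affine.ordGE_zero
    (by push_cast; omega)
  have h4 := hf'.lie (q := q) (n := n) (by omega) (by omega) hg h1 h2 Affine.ordGE_zero
    Affine.ordGE_zero (by push_cast; omega)
  have h5 : cocycleZI (germZero N f, germInfty N f) 0 = 0 :=
    add_eq_zero_iff_eq_neg.mpr (by
      have : ∀ A : Mat N (LaurentSeries ℂ), cocycle (1 / (N : ℂ)) A 0 = 0 := fun A => by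
        rw [cocycle, mul_zero, Matrix.trace_zero, map_zero, mul_zero]
      exact (this _).trans ((congrArg Neg.neg (this _)).trans neg_zero).symm)
  rw [lie_zero] at h4
  rw [h3, h5, h _ h4, mul_zero, zero_smul, sub_zero]

variable (α W) in
/-- Linear maps killed by all sections of sufficiently high order at `0` and `∞`. -/
def smoothMaps : Submodule ℂ (X →ₗ[ℂ] W) where
  carrier := {ψ | ∃ n, α.Kills n ψ}
  add_mem' := by
    rintro ψ φ ⟨m, hm⟩ ⟨n, hn⟩
    refine ⟨max m n, fun f hf => ?_⟩
    rw [LinearMap.add_comp, hm.mono (le_max_left m n) f hf, hn.mono (le_max_right m n) f hf,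
      add_zero]
  zero_mem' := ⟨0, fun _ _ => LinearMap.zero_comp _⟩
  smul_mem' := by
    rintro c ψ ⟨n, hn⟩
    exact ⟨n, fun f hf => by rw [LinearMap.smul_comp, hn f hf, smul_zero]⟩

/-- The action of loops at `0` and `∞` on smooth maps. -/
def rhoFun (x : AffineZero N × AffineInfty N) (ψ : α.smoothMaps W) : X →ₗ[ℂ] W :=
  (k * (x.1.2 + x.2.2)) • (ψ : X →ₗ[ℂ] W) -
    (ψ : X →ₗ[ℂ] W) ∘ₗ α.act (α.approx x ψ.2.choose).choose

theorem rhoFun_eq {ψ : α.smoothMaps W} (hψ : α.Kills n (ψ : X →ₗ[ℂ] W)) (hf : Approx t n x f) :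
    rhoFun x ψ = (k * (x.1.2 + x.2.2)) • (ψ : X →ₗ[ℂ] W) - (ψ : X →ₗ[ℂ] W) ∘ₗ α.act f := by
  obtain ⟨g, hg⟩ := α.approx x (max n ψ.2.choose)
  rw [rhoFun, ψ.2.choose_spec.comp_eq (α.approx x ψ.2.choose).choose_spec (hg.anti (by simp)),
    hψ.comp_eq hf (hg.anti (by simp))]

theorem Kills.rhoFun {ψ : α.smoothMaps W} (hψ : α.Kills n (ψ : X →ₗ[ℂ] W)) {q : ℕ}
    (h1 : Affine.OrdGE (-q) x.1) (h2 : Affine.OrdGE (-q) x.2) :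
    α.Kills (n + q + 1) (rhoFun x ψ) := by
  obtain ⟨f, hf⟩ := α.approx x n
  rw [rhoFun_eq hψ hf]
  have h3 := hψ.comp (q := q) hf.mem (h1.of_sub hf.zero (by omega)) (h2.of_sub hf.infty (by omega))
  intro g hg
  rw [LinearMap.sub_comp, LinearMap.smul_comp, h3 g hg, hψ.mono (by omega) g hg, smul_zero,
    sub_zero]

theorem exists_ordGE_pair (x : AffineZero N × AffineInfty N) :
    ∃ q : ℕ, Affine.OrdGE (-q) x.1 ∧ Affine.OrdGE (-q) x.2 := by
  obtain ⟨p, hp⟩ := Affine.exists_ordGE x.1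
  obtain ⟨q, hq⟩ := Affine.exists_ordGE x.2
  exact ⟨max p q, hp.anti (by simp), hq.anti (by simp)⟩

theorem rhoFun_mem (x : AffineZero N × AffineInfty N) (ψ : α.smoothMaps W) :
    rhoFun x ψ ∈ α.smoothMaps W := by
  obtain ⟨q, h1, h2⟩ := exists_ordGE_pair x
  obtain ⟨n, hn⟩ := ψ.2
  exact ⟨_, hn.rhoFun h1 h2⟩

/-- Precomposition reverses products and the minus sign in `rhoFun` restores their order. The
commutator of sections carries $-k$ times the cocycles at $0$ and $\infty$, so the scalar left over
is exactly the central term of the bracket of loops. -/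
theorem rhoFun_lie (x y : AffineZero N × AffineInfty N) (ψ : α.smoothMaps W) :
    rhoFun ⁅x, y⁆ ψ = rhoFun x (⟨rhoFun y ψ, rhoFun_mem y ψ⟩ : α.smoothMaps W) -
      rhoFun y (⟨rhoFun x ψ, rhoFun_mem x ψ⟩ : α.smoothMaps W) := by
  obtain ⟨n, hn⟩ := ψ.2
  obtain ⟨p, hp1, hp2⟩ := exists_ordGE_pair x
  obtain ⟨r, hr1, hr2⟩ := exists_ordGE_pair y
  obtain ⟨q, hq⟩ : ∃ q, q = max p r := ⟨_, rfl⟩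
  have hx1 : Affine.OrdGE (-(q : ℤ)) x.1 := hp1.anti (by omega)
  have hx2 : Affine.OrdGE (-(q : ℤ)) x.2 := hp2.anti (by omega)
  have hy1 : Affine.OrdGE (-(q : ℤ)) y.1 := hr1.anti (by omega)
  have hy2 : Affine.OrdGE (-(q : ℤ)) y.2 := hr2.anti (by omega)
  -- One precision serves three purposes: the first action costs $q+1$ orders before the second is
  -- computed, the bracket needs $n+q$, and the cocycle needs $1+q$.
  obtain ⟨f, hf⟩ := α.approx x (n + q + 1)
  obtain ⟨g, hg⟩ := α.approx y (n + q + 1)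
  have hn' : α.Kills (n + q + 1) (ψ : X →ₗ[ℂ] W) := hn.mono (by omega)
  have hfg : Approx t n ⁅x, y⁆ ⁅f, g⁆ := hf.lie (q := q) (by omega) (by omega) hg hx1 hx2 hy1 hy2
    (by push_cast; omega)
  have hc := hf.cocycleZI_eq (q := q) (by omega) hg hx1 hx2 hy1 hy2 (by push_cast; omega)
  have e1 : rhoFun x (⟨rhoFun y ψ, rhoFun_mem y ψ⟩ : α.smoothMaps W) = _ :=
    rhoFun_eq (hn.rhoFun hy1 hy2) hf
  have e2 : rhoFun y (⟨rhoFun x ψ, rhoFun_mem x ψ⟩ : α.smoothMaps W) = _ :=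
    rhoFun_eq (hn.rhoFun hx1 hx2) hg
  have e3 := comp_commutator (α := α) hf.mem hg.mem (ψ : X →ₗ[ℂ] W)
  rw [hc] at e3
  have e4 : k * ((⁅x, y⁆ : AffineZero N × AffineInfty N).1.2 +
    (⁅x, y⁆ : AffineZero N × AffineInfty N).2.2) = k * cocycleZI x y := rfl
  rw [e1, e2]
  dsimp only
  rw [rhoFun_eq hn hfg, rhoFun_eq hn' hf, rhoFun_eq hn' hg, LinearMap.sub_comp,
    LinearMap.sub_comp, LinearMap.smul_comp, LinearMap.smul_comp, e3, e4]
  module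

variable (α W) in
/-- The Lie algebra of loops at `0` and `∞` acts on smooth maps. -/
def rho : (AffineZero N × AffineInfty N) →ₗ⁅ℂ⁆ Module.End ℂ (α.smoothMaps W) where
  toFun x :=
    { toFun := fun ψ => ⟨rhoFun x ψ, rhoFun_mem x ψ⟩
      map_add' := fun ψ φ => Subtype.ext <| by
        obtain ⟨m, hm⟩ := ψ.2
        obtain ⟨n, hn⟩ := φ.2
        have h1 := hm.mono (le_max_left m n)
        have h2 := hn.mono (le_max_right m n)
        have h3 : α.Kills (max m n) ((ψ + φ : α.smoothMaps W) : X →ₗ[ℂ] W) := fun f hf => by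
          rw [Submodule.coe_add, LinearMap.add_comp, h1 f hf, h2 f hf, add_zero]
        obtain ⟨f, hf⟩ := α.approx x (max m n)
        change rhoFun x (ψ + φ) = rhoFun x ψ + rhoFun x φ
        rw [rhoFun_eq h1 hf, rhoFun_eq h2 hf, rhoFun_eq h3 hf, Submodule.coe_add, smul_add,
          LinearMap.add_comp, add_sub_add_comm]
      map_smul' := fun c ψ => Subtype.ext <| by
        obtain ⟨m, hm⟩ := ψ.2
        have h3 : α.Kills m ((c • ψ : α.smoothMaps W) : X →ₗ[ℂ] W) := fun f hf => by
          rw [Submodule.coe_smul, LinearMap.smul_comp, hm f hf, smul_zero]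
        obtain ⟨f, hf⟩ := α.approx x m
        change rhoFun x (c • ψ) = c • rhoFun x ψ
        rw [rhoFun_eq hm hf, rhoFun_eq h3 hf, Submodule.coe_smul, smul_comm,
          LinearMap.smul_comp, smul_sub] }
  map_add' x y := LinearMap.ext fun ψ => Subtype.ext <| by
    obtain ⟨m, hm⟩ := ψ.2
    obtain ⟨f, hf⟩ := α.approx x m
    obtain ⟨g, hg⟩ := α.approx y m
    change rhoFun (x + y) ψ = rhoFun x ψ + rhoFun y ψ
    rw [rhoFun_eq hm hf, rhoFun_eq hm hg, rhoFun_eq hm (hf.add hg), map_add, LinearMap.comp_add,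
      sub_add_sub_comm, ← add_smul, ← mul_add]
    congr 3
    change (x.1.2 + y.1.2) + (x.2.2 + y.2.2) = _
    ring
  map_smul' c x := LinearMap.ext fun ψ => Subtype.ext <| by
    obtain ⟨m, hm⟩ := ψ.2
    obtain ⟨f, hf⟩ := α.approx x m
    change rhoFun (c • x) ψ = c • rhoFun x ψ
    rw [rhoFun_eq hm hf, rhoFun_eq hm (hf.smul c), map_smul, LinearMap.comp_smul, smul_sub,
      smul_smul]
    congr 2
    change k * (c * x.1.2 + c * x.2.2) = _
    ring
  map_lie' {x y} := LinearMap.ext fun ψ => Subtype.ext (rhoFun_lie x y ψ)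

theorem rho_apply {ψ : α.smoothMaps W} (hψ : α.Kills n (ψ : X →ₗ[ℂ] W)) (hf : Approx t n x f) :
    (α.rho W x ψ : X →ₗ[ℂ] W) =
      (k * (x.1.2 + x.2.2)) • (ψ : X →ₗ[ℂ] W) - (ψ : X →ₗ[ℂ] W) ∘ₗ α.act f := rhoFun_eq hψ hf

end SectionAction

end Smooth

/-! ### Pairings of Verma modules -/

section Pairing

variable {N L : ℕ} {t : Fin L → ℂ} {k : ℂ} {X : Type*} [AddCommGroup X] [Module ℂ X]
  {W : Type*} [AddCommGroup W] [Module ℂ W]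

/-- The intertwining map from a Verma module preserves an eigenvalue equation for an operator
that commutes with the action. -/
theorem Verma.eigen_of_commute {z : ℂˣ} {lam : Module.Dual ℂ (cartan N)} {Y : Type*}
    [AddCommGroup Y] [Module ℂ Y] {ρ : AffineTw N z → Module.End ℂ Y}
    {F : Verma N z k lam →ₗ[ℂ] Y} (hF : ∀ x v, F ⁅x, v⁆ = ρ x (F v)) {T : Module.End ℂ Y} {c : ℂ}
    (hT : ∀ x, Commute T (ρ x)) (h0 : T (F (vac N z k lam)) = c • F (vac N z k lam))
    (v : Verma N z k lam) : T (F v) = c • F v := by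
  let P : Submodule ℂ (Verma N z k lam) := LinearMap.ker (T ∘ₗ F - c • F)
  have hP : ∀ v, v ∈ P ↔ T (F v) = c • F v := fun v => by
    rw [LinearMap.mem_ker, LinearMap.sub_apply, sub_eq_zero]; rfl
  have := eq_top_of_lie_mem P ((hP _).mpr h0) fun x v hv => by
    rw [hP] at hv ⊢
    rw [hF, ← Module.End.mul_apply, (hT x).eq, Module.End.mul_apply, hv, map_smul]
  exact (hP v).mp (this ▸ Submodule.mem_top)

/-- If loops at `0` and `∞` act on `Y`, a common highest weight vector gives a pairing of Verma
modules with values in `Y`. -/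
theorem exists_pairing {Y : Type*} [AddCommGroup Y] [Module ℂ Y]
    (ρ : (AffineZero N × AffineInfty N) →ₗ⁅ℂ⁆ Module.End ℂ Y) {μ μ' : Module.Dual ℂ (cartan N)}
    (y : Y) (hn : ∀ x ∈ nPlus N (eps N), ρ (x, 0) y = 0)
    (hn' : ∀ x ∈ nPlus N (eps N)⁻¹, ρ (0, x) y = 0)
    (hH : ∀ H, ρ (cartanTw N _ H, 0) y = μ H • y) (hH' : ∀ H, ρ (0, cartanTw N _ H) y = μ' H • y)
    (hk : ρ (Affine.khat, 0) y = k • y) (hk' : ρ (0, Affine.khat) y = k • y) :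
    ∃ B : Verma N (eps N) k μ →ₗ[ℂ] Verma N (eps N)⁻¹ k μ' →ₗ[ℂ] Y,
      B (Verma.vac _ _ _ _) (Verma.vac _ _ _ _) = y ∧
      ∀ a b v v', B ⁅a, v⁆ v' + B v ⁅b, v'⁆ = ρ (a, b) (B v v') := by
  let ρ₀ := ρ.comp (LieHom.inl ℂ (AffineZero N) (AffineInfty N))
  let ρ₁ := ρ.comp (LieHom.inr ℂ (AffineZero N) (AffineInfty N))
  have hρ₀ : ∀ a, ρ₀ a = ρ (a, 0) := fun _ => rfl
  have hρ₁ : ∀ a, ρ₁ a = ρ (0, a) := fun _ => rfl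
  have hcomm : ∀ a b, Commute (ρ₀ a) (ρ₁ b) := fun a b => by
    have h : ⁅((a, 0) : AffineZero N × AffineInfty N), ((0, b) : AffineZero N × AffineInfty N)⁆ = 0 :=
      Prod.ext (lie_zero a) (zero_lie b)
    have h1 := ρ.map_lie (a, 0) (0, b)
    rw [h, map_zero] at h1
    exact (sub_eq_zero.mp h1.symm)
  -- The two Verma modules are handled one after the other: first the one at $\infty$ is mapped to
  -- `Y`, then the one at $0$ to the linear maps from it to `Y`.
  obtain ⟨F, hF0, hF⟩ := Verma.exists_lift ρ₁ y hn' hH' hk'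
  let comp : Module.End ℂ Y →ₗ[ℂ] Module.End ℂ (Verma N (eps N)⁻¹ k μ' →ₗ[ℂ] Y) :=
    LinearMap.llcomp ℂ _ Y Y
  have hcomp : ∀ T G, comp T G = T ∘ₗ G := fun _ _ => rfl
  let σ : AffineZero N →ₗ⁅ℂ⁆ Module.End ℂ (Verma N (eps N)⁻¹ k μ' →ₗ[ℂ] Y) :=
    { comp ∘ₗ (ρ₀ : AffineZero N →ₗ[ℂ] Module.End ℂ Y) with
      map_lie' := fun {a b} => LinearMap.ext fun G => LinearMap.ext fun v => by
        exact LinearMap.congr_fun (ρ₀.map_lie a b) (G v) }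
  have hσ : ∀ a G v, σ a G v = ρ₀ a (G v) := fun _ _ _ => rfl
  -- Loops at $0$ commute with loops at $\infty$, so an eigenvalue equation at the highest weight
  -- vector holds on all of `F`. Thus `F` is itself a highest weight vector for the loops at $0$.
  have key : ∀ a (c : ℂ), ρ₀ a y = c • y → σ a F = c • F := fun a c h =>
    LinearMap.ext fun v => Verma.eigen_of_commute hF (hcomm a) (by rw [hF0, h]) v
  obtain ⟨G, hG0, hG⟩ := Verma.exists_lift (lam := μ) (k := k) σ F
    (fun x hx => by rw [key x 0 (by rw [zero_smul]; exact hn x hx), zero_smul])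
    (fun H => key _ _ (hH H)) (key _ _ hk)
  have hG' : ∀ b v v', G v ⁅b, v'⁆ = ρ₁ b (G v v') := fun b v => by
    let P : Submodule ℂ (Verma N (eps N) k μ) :=
      { carrier := {v | ∀ v', G v ⁅b, v'⁆ = ρ₁ b (G v v')}
        add_mem' := fun {v w} hv hw v' => by
          rw [map_add, LinearMap.add_apply, LinearMap.add_apply, hv, hw, map_add]
        zero_mem' := fun v' => by
          rw [map_zero, LinearMap.zero_apply, LinearMap.zero_apply, map_zero]
        smul_mem' := fun c v hv v' => by
          rw [map_smul, LinearMap.smul_apply, LinearMap.smul_apply, hv, map_smul] }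
    have hP : P = ⊤ := by
      refine Verma.eq_top_of_lie_mem P (fun v' => ?_) fun a w hw v' => ?_
      · rw [hG0, hF]
      · rw [hG, hσ, hσ, hw v', ← Module.End.mul_apply, (hcomm a b).eq, Module.End.mul_apply]
    exact (hP ▸ Submodule.mem_top : v ∈ P)
  refine ⟨G, by rw [hG0, hF0], fun a b v v' => ?_⟩
  have hab : ((a, b) : AffineZero N × AffineInfty N) = (a, 0) + (0, b) := by
    rw [Prod.mk_add_mk, add_zero, zero_add]
  rw [hG, hσ, hG', hab, map_add]
  rfl

/-- `x` is regular with constant term `H`, and without central part. -/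
structure Affine.IsRegular {K : LieSubalgebra ℂ (Mat N (LaurentSeries ℂ))} {c : ℂ} (x : Affine K c)
    (H : cartan N) : Prop where
  central : x.2 = 0
  reg : ∀ i j, (x.1 : Mat N (LaurentSeries ℂ)) i j ∈ regular
  coeff : ∀ i j, ((x.1 : Mat N (LaurentSeries ℂ)) i j).coeff 0 = (H : Mat N ℂ) i j

theorem Affine.isRegular_zero {K : LieSubalgebra ℂ (Mat N (LaurentSeries ℂ))} {c : ℂ} :
    (0 : Affine K c).IsRegular 0 := ⟨rfl, fun _ _ => zero_mem _, fun _ _ => rfl⟩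

theorem isRegular_of_mem_nPlus {z : ℂˣ} {x : AffineTw N z} (hx : x ∈ nPlus N z) :
    x.IsRegular 0 := ⟨hx.2, fun i j n hn => hx.1 i j n hn.le, fun i j => hx.1 i j 0 le_rfl⟩

theorem isRegular_cartanTw {z : ℂˣ} (H : cartan N) : (cartanTw N z H).IsRegular H :=
  ⟨rfl, fun i j => regular.algebraMap_mem ((H : Mat N ℂ) i j),
    fun _ _ => HahnSeries.coeff_single_same _ _⟩

/-- `f` is a section of `g^orb`, holomorphic outside the marked points, with value `H` at `0` and
`H'` at `∞`. -/
structure HasValues (t : Fin L → ℂ) (f : meroOrb N) (H H' : cartan N) : Prop where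
  mem : (f : Mat N (RatFunc ℂ)) ∈ gOrb N (markedZeroInfty N t)
  zero : (germZero N f).IsRegular H
  infty : (germInfty N f).IsRegular H'

theorem Affine.IsRegular.of_ordGE_sub {K : LieSubalgebra ℂ (Mat N (LaurentSeries ℂ))} {c : ℂ}
    {x y : Affine K c} {H : cartan N} (hx : x.IsRegular H) (hy : y.2 = 0)
    (h : Affine.OrdGE 1 (y - x)) : y.IsRegular H := by
  have h1 : ∀ i j (n : ℤ), n < 1 → ((y.1 : Mat N (LaurentSeries ℂ)) i j).coeff n =
      ((x.1 : Mat N (LaurentSeries ℂ)) i j).coeff n := fun i j n hn => by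
    have : ((y.1 : Mat N (LaurentSeries ℂ)) i j - (x.1 : Mat N (LaurentSeries ℂ)) i j).coeff n = 0 :=
      h i j n hn
    rwa [HahnSeries.coeff_sub, sub_eq_zero] at this
  exact ⟨hy, fun i j n hn => (h1 i j n (by omega)).trans (hx.reg i j n hn),
    fun i j => (h1 i j 0 (by omega)).trans (hx.coeff i j)⟩

theorem Approx.hasValues {x : AffineZero N × AffineInfty N} {f : meroOrb N} (hf : Approx t 1 x f)
    {H H' : cartan N} (h : x.1.IsRegular H) (h' : x.2.IsRegular H') : HasValues t f H H' :=
  ⟨hf.mem, h.of_ordGE_sub rfl hf.zero, h'.of_ordGE_sub rfl hf.infty⟩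

/-- A linear map on `X` with a prescribed transformation law under the sections regular at `0` and
`∞` extends to a pairing of Verma modules, invariant under all sections. -/
theorem SectionAction.exists_pairing (α : SectionAction N t k X)
    {μ μ' : Module.Dual ℂ (cartan N)} (φ : X →ₗ[ℂ] W)
    (hφ : ∀ f H H', HasValues t f H H' → ∀ x, φ (α.act f x) = -(μ H + μ' H') • φ x) :
    ∃ B : Verma N (eps N) k μ →ₗ[ℂ] Verma N (eps N)⁻¹ k μ' →ₗ[ℂ] X →ₗ[ℂ] W,
      B (Verma.vac _ _ _ _) (Verma.vac _ _ _ _) = φ ∧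
      ∀ f : meroOrb N, (f : Mat N (RatFunc ℂ)) ∈ gOrb N (markedZeroInfty N t) → ∀ v x v',
        B ⁅germZero N f, v⁆ v' x + B v v' (α.act f x) + B v ⁅germInfty N f, v'⁆ x = 0 := by
  -- A section of order at least one at $0$ and $\infty$ has both values zero, so the transformation
  -- law makes `φ` a smooth map.
  have hφ1 : α.Kills 1 φ := fun f hf => LinearMap.ext fun x => by
    have h := hφ f 0 0 (Approx.hasValues (by exact_mod_cast hf) Affine.isRegular_zero
      Affine.isRegular_zero) x
    rwa [map_zero, map_zero, add_zero, neg_zero, zero_smul] at h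
  let y : α.smoothMaps W := ⟨φ, 1, hφ1⟩
  -- Approximating regular loops to order one preserves their constant terms, so the transformation
  -- law turns into highest weight conditions; the two minus signs cancel.
  have key : ∀ (x : AffineZero N × AffineInfty N) (H H' : cartan N), x.1.IsRegular H →
      x.2.IsRegular H' → α.rho W x y = (μ H + μ' H') • y := fun x H H' h h' => by
    obtain ⟨f, hf⟩ := α.approx x 1
    refine Subtype.ext ((SectionAction.rho_apply hφ1 hf).trans (LinearMap.ext fun v => ?_))
    rw [h.central, h'.central, add_zero, mul_zero, zero_smul, zero_sub]
    change -φ (α.act f v) = (μ H + μ' H') • φ v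
    rw [hφ f H H' (Approx.hasValues (by exact_mod_cast hf) h h'), neg_smul, neg_neg]
  -- A purely central element is approximated by the zero section, and only the scalar term of the
  -- action survives.
  have keyk : ∀ x : AffineZero N × AffineInfty N, (∀ n, Affine.OrdGE n x.1) →
      (∀ n, Affine.OrdGE n x.2) → x.1.2 + x.2.2 = 1 → α.rho W x y = k • y := fun x h h' h1 => by
    have hf : Approx t (1 : ℕ) x (0 : meroOrb N) := by
      refine ⟨zero_mem _, ?_, ?_⟩
      · have : germZero N 0 = 0 := by
          have := germZero_smul (0 : ℂ) (0 : meroOrb N); rwa [zero_smul, zero_smul] at this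
        rw [this]; exact Affine.ordGE_zero.sub (h _)
      · have : germInfty N 0 = 0 := by
          have := germInfty_smul (0 : ℂ) (0 : meroOrb N); rwa [zero_smul, zero_smul] at this
        rw [this]; exact Affine.ordGE_zero.sub (h' _)
    refine Subtype.ext ((SectionAction.rho_apply hφ1 hf).trans ?_)
    rw [h1, mul_one, map_zero, LinearMap.comp_zero, sub_zero]
    rfl
  have hz : ∀ {z : ℂˣ} (n : ℤ), Affine.OrdGE n (Affine.khat : AffineTw N z) :=
    fun _ _ _ => zero_mem _
  obtain ⟨B, hB0, hB⟩ := TrigWZW.exists_pairing (k := k) (μ := μ) (μ' := μ') (α.rho W) y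
    (fun x hx => by
      rw [key _ 0 0 (isRegular_of_mem_nPlus hx) Affine.isRegular_zero, map_zero, map_zero,
        add_zero, zero_smul])
    (fun x hx => by
      rw [key _ 0 0 Affine.isRegular_zero (isRegular_of_mem_nPlus hx), map_zero, map_zero,
        add_zero, zero_smul])
    (fun H => by
      rw [key _ H 0 (isRegular_cartanTw H) Affine.isRegular_zero, map_zero, add_zero])
    (fun H => by
      rw [key _ 0 H Affine.isRegular_zero (isRegular_cartanTw H), map_zero, zero_add])
    (keyk _ hz (fun _ => Affine.ordGE_zero) (add_zero 1))
    (keyk _ (fun _ => Affine.ordGE_zero) hz (zero_add 1))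
  let incl := (α.smoothMaps W).subtype
  refine ⟨B.compr₂ incl, by rw [LinearMap.compr₂_apply, hB0]; rfl, fun f hf v x v' => ?_⟩
  obtain ⟨n, hn⟩ := (B v v').2
  have h1 := congrArg incl (hB (germZero N f) (germInfty N f) v v')
  rw [map_add] at h1
  have h2 : incl (α.rho W (germZero N f, germInfty N f) (B v v')) =
      (k * ((germZero N f).2 + (germInfty N f).2)) • incl (B v v') - incl (B v v') ∘ₗ α.act f :=
    SectionAction.rho_apply hn (approx_germ hf n)
  have h3 : k * ((germZero N f).2 + (germInfty N f).2) = 0 := by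
    change k * (0 + 0) = 0
    rw [add_zero, mul_zero]
  rw [h2, h3, zero_smul, zero_sub] at h1
  have h4 := LinearMap.congr_fun h1 x
  rw [LinearMap.add_apply, LinearMap.neg_apply, LinearMap.comp_apply, ← add_eq_zero_iff_eq_neg] at h4
  simp only [LinearMap.compr₂_apply]
  rw [add_right_comm]
  exact h4

end Pairing

/-! ### Orbifold coinvariants with Verma modules inserted at `0` and `∞` -/

section Orbifold

variable {N L : ℕ} {t : Fin L → ℂ} {M : Fin L → Type*} [∀ i, AddCommGroup (M i)]
  [∀ i, Module ℂ (M i)] [∀ i, LieRingModule (AffineSl N) (M i)]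
  [∀ i, LieModule ℂ (AffineSl N) (M i)] {k : ℂ}

/-- Sections act on `M_1 ⊗ ⋯ ⊗ M_L`. -/
def sectionAction (hN : N ≠ 0) (hL : 1 ≤ L) (ht0 : ∀ i, t i ≠ 0)
    (htne : ∀ i j, i ≠ j → ∀ a : ℕ, t i ≠ (eps N : ℂ) ^ a * t j)
    (hlevel : ∀ (i : Fin L) (v : M i), ⁅(Affine.khat : AffineSl N), v⁆ = k • v) :
    SectionAction N t k (⨂[ℂ] i, M i) where
  act :=
    { toFun := actM N t M
      map_add' := actM_add t M
      map_smul' := actM_smul t M }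
  commutator f g hf hg := by
    have h := actM_commutator t hlevel f g
    have h1 : k * ∑ i, cocycle 1 ((germ N (t i) f).1 : Mat N (LaurentSeries ℂ))
        (germ N (t i) g).1 =
        -(k * cocycleZI (germZero N f, germInfty N f) (germZero N g, germInfty N g)) := by
      rw [← mul_neg]
      exact congrArg (k * ·)
        (eq_neg_of_add_eq_zero_left (sum_cocycle_germ hN ht0 htne f g hf hg))
    rw [h1] at h
    exact h.trans ((congrArg _ (neg_smul _ _)).trans (sub_eq_add_neg _ _).symm)
  approx := exists_Approx hN hL ht0

/-- The relations imposed on `X` by coupling to highest weight vectors at `0` and `∞`. -/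
def vacSpan {X : Type*} [AddCommGroup X] [Module ℂ X] (α : SectionAction N t k X)
    (μ μ' : Module.Dual ℂ (cartan N)) : Submodule ℂ X := Submodule.span ℂ
  {w | ∃ f H H', HasValues t f H H' ∧ ∃ x, w = α.act f x + (μ H + μ' H') • x}

/-- Up to central terms, only finitely many terms of a loop matter for its action on a given
vector of a Verma module. -/
theorem Verma.exists_lie_eq {z : ℂˣ} {lam : Module.Dual ℂ (cartan N)} (v : Verma N z k lam) :
    ∃ n : ℕ, ∀ x y : AffineTw N z, Affine.OrdGE n (y - x) →
      ⁅x, v⁆ = ⁅y, v⁆ + (k * (x.2 - y.2)) • v := by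
  obtain ⟨n, hn⟩ := smooth v
  refine ⟨n, fun x y h => ?_⟩
  have h1 : x = y + (x.2 - y.2) • Affine.khat - Affine.ofLoop (y - x).1 := by
    refine Affine.ext' (fun i j => ?_) ?_
    · change _ = (y.1 : Mat N (LaurentSeries ℂ)) i j + (x.2 - y.2) • (0 : LaurentSeries ℂ) -
        ((y.1 : Mat N (LaurentSeries ℂ)) i j - (x.1 : Mat N (LaurentSeries ℂ)) i j)
      rw [smul_zero, add_zero, sub_sub_cancel]
    · change x.2 = y.2 + (x.2 - y.2) * 1 - 0
      ring
  conv_lhs => rw [h1]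
  rw [sub_lie, add_lie, smul_lie, lie_khat, hn (Affine.ofLoop (y - x).1) rfl h, sub_zero,
    smul_smul, mul_comm]

section Relations

variable {M₀ : Type*} [AddCommGroup M₀] [Module ℂ M₀] [LieRingModule (AffineZero N) M₀]
  [LieModule ℂ (AffineZero N) M₀]
variable {M' : Type*} [AddCommGroup M'] [Module ℂ M'] [LieRingModule (AffineInfty N) M']
  [LieModule ℂ (AffineInfty N) M']

variable (N t M M₀ M') in
/-- The projection to the coinvariants. -/
def CCorb.mk : (M₀ ⊗[ℂ] (⨂[ℂ] i, M i) ⊗[ℂ] M') →ₗ[ℂ] CCorb N t M M₀ M' := Submodule.mkQ _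

theorem CCorb.mk_surjective : Function.Surjective (CCorb.mk N t M M₀ M') :=
  fun v => Quot.exists_rep v

theorem CCorb.mk_relation {f : meroOrb N}
    (hf : (f : Mat N (RatFunc ℂ)) ∈ gOrb N (markedZeroInfty N t)) (v : M₀) (x : ⨂[ℂ] i, M i)
    (v' : M') : CCorb.mk N t M M₀ M' (⁅germZero N f, v⁆ ⊗ₜ x ⊗ₜ v') +
      CCorb.mk N t M M₀ M' (v ⊗ₜ actM N t M f x ⊗ₜ v') +
      CCorb.mk N t M M₀ M' (v ⊗ₜ x ⊗ₜ ⁅germInfty N f, v'⁆) = 0 := by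
  rw [← map_add, ← map_add]
  exact (Submodule.Quotient.mk_eq_zero _).mpr (Submodule.subset_span ⟨f, hf, v ⊗ₜ x ⊗ₜ v', rfl⟩)

/-- An invariant trilinear map factors through the coinvariants. -/
theorem CCorb.exists_lift {W : Type*} [AddCommGroup W] [Module ℂ W]
    (B : M₀ →ₗ[ℂ] M' →ₗ[ℂ] (⨂[ℂ] i, M i) →ₗ[ℂ] W)
    (hB : ∀ f : meroOrb N, (f : Mat N (RatFunc ℂ)) ∈ gOrb N (markedZeroInfty N t) → ∀ v x v',
      B ⁅germZero N f, v⁆ v' x + B v v' (actM N t M f x) + B v ⁅germInfty N f, v'⁆ x = 0) :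
    ∃ Ψ : CCorb N t M M₀ M' →ₗ[ℂ] W, ∀ v x v', Ψ (CCorb.mk N t M M₀ M' (v ⊗ₜ x ⊗ₜ v')) = B v v' x := by
  let Ψ₀ : (M₀ ⊗[ℂ] (⨂[ℂ] i, M i) ⊗[ℂ] M') →ₗ[ℂ] W :=
    TensorProduct.lift (TensorProduct.lift
      ((LinearMap.lflip (R₀ := ℂ)).toLinearMap ∘ₗ B))
  have h0 : ∀ v x v', Ψ₀ (v ⊗ₜ x ⊗ₜ v') = B v v' x := fun _ _ _ => rfl
  refine ⟨Submodule.liftQ _ Ψ₀ (Submodule.span_le.mpr ?_), fun v x v' => h0 v x v'⟩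
  rintro _ ⟨f, hf, v, rfl⟩
  have : Ψ₀ ∘ₗ actZMI N t M M₀ M' f = 0 := by
    refine TensorProduct.ext_threefold fun v x v' => ?_
    rw [LinearMap.comp_apply, actZMI, LinearMap.add_apply, LinearMap.add_apply, map_add, map_add]
    simp only [TensorProduct.map_tmul, LinearMap.id_apply, h0, LieModule.toEnd_apply_apply]
    exact hB f hf v x v'
  exact LinearMap.congr_fun this v

end Relations

/-- Inserting highest weight vectors at `0` and `∞`. -/
theorem exists_vacSpan_quotient_map (hN : N ≠ 0) (hL : 1 ≤ L) (ht0 : ∀ i, t i ≠ 0)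
    (htne : ∀ i j, i ≠ j → ∀ a : ℕ, t i ≠ (eps N : ℂ) ^ a * t j)
    (hlevel : ∀ (i : Fin L) (v : M i), ⁅(Affine.khat : AffineSl N), v⁆ = k • v)
    (μ μ' : Module.Dual ℂ (cartan N)) :
    ∃ Φ : ((⨂[ℂ] i, M i) ⧸ vacSpan (sectionAction hN hL ht0 htne hlevel) μ μ') →ₗ[ℂ]
      CCorb N t M (Verma N (eps N) k μ) (Verma N (eps N)⁻¹ k μ'),
      ∀ x, Φ (Submodule.Quotient.mk x) = CCorb.mk N t M _ _
        (Verma.vac N (eps N) k μ ⊗ₜ x ⊗ₜ Verma.vac N (eps N)⁻¹ k μ') := by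
  let Φ₀ : (⨂[ℂ] i, M i) →ₗ[ℂ] CCorb N t M (Verma N (eps N) k μ) (Verma N (eps N)⁻¹ k μ') :=
    CCorb.mk N t M _ _ ∘ₗ (TensorProduct.mk ℂ _ _).flip (Verma.vac N (eps N)⁻¹ k μ') ∘ₗ
      TensorProduct.mk ℂ _ _ (Verma.vac N (eps N) k μ)
  refine ⟨Submodule.liftQ _ Φ₀ (Submodule.span_le.mpr ?_), fun x => rfl⟩
  rintro _ ⟨f, H, H', hf, x, rfl⟩
  have h := CCorb.mk_relation (M := M) hf.mem (Verma.vac N (eps N) k μ) x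
    (Verma.vac N (eps N)⁻¹ k μ')
  rw [Verma.lie_vac_of_regular hf.zero.central hf.zero.reg hf.zero.coeff,
    Verma.lie_vac_of_regular hf.infty.central hf.infty.reg hf.infty.coeff, ← TensorProduct.smul_tmul',
    ← TensorProduct.smul_tmul', TensorProduct.tmul_smul, map_smul, map_smul] at h
  rw [SetLike.mem_coe, LinearMap.mem_ker, map_add, map_smul, add_smul, ← add_assoc,
    add_comm (Φ₀ _)]
  exact h

/-- The coinvariants are spanned by the classes of `vac ⊗ x ⊗ vac`. -/
theorem CCorb.eq_top_of_vac_mem (hN : N ≠ 0) (hL : 1 ≤ L) (ht0 : ∀ i, t i ≠ 0)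
    (μ μ' : Module.Dual ℂ (cartan N))
    (R : Submodule ℂ (CCorb N t M (Verma N (eps N) k μ) (Verma N (eps N)⁻¹ k μ')))
    (hR : ∀ x, CCorb.mk N t M _ _
        (Verma.vac N (eps N) k μ ⊗ₜ x ⊗ₜ Verma.vac N (eps N)⁻¹ k μ') ∈ R) : R = ⊤ := by
  -- A section approximating both loops acts on the two given Verma vectors as the loops do, up to
  -- scalars. Its relation moves the action to the middle factor, where membership in `R` is known
  -- for every `x`.
  have step : ∀ (a : AffineZero N) (b : AffineInfty N) v v', (∀ x, CCorb.mk N t M (Verma N (eps N) k μ) (Verma N (eps N)⁻¹ k μ')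
      (v ⊗ₜ x ⊗ₜ v') ∈ R) → ∀ x, CCorb.mk N t M _ _ (⁅a, v⁆ ⊗ₜ x ⊗ₜ v') +
        CCorb.mk N t M _ _ (v ⊗ₜ x ⊗ₜ ⁅b, v'⁆) ∈ R := by
    intro a b v v' hv x
    obtain ⟨m, hm⟩ := Verma.exists_lie_eq v
    obtain ⟨n, hn⟩ := Verma.exists_lie_eq v'
    obtain ⟨f, hf⟩ := exists_Approx hN hL ht0 (a, b) (max m n)
    have h := CCorb.mk_relation (M := M) hf.mem v x v'
    rw [hm a _ (hf.zero.anti (by simp)), hn b _ (hf.infty.anti (by simp)), TensorProduct.add_tmul,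
      TensorProduct.add_tmul, TensorProduct.tmul_add, map_add, map_add, TensorProduct.tmul_smul,
      ← TensorProduct.smul_tmul', ← TensorProduct.smul_tmul', map_smul, map_smul,
      add_add_add_comm]
    refine add_mem ?_ (add_mem (R.smul_mem _ (hv x)) (R.smul_mem _ (hv x)))
    rw [add_right_comm] at h
    rw [eq_neg_of_add_eq_zero_left h]
    exact neg_mem (hv _)
  have h1 : ∀ v' x, CCorb.mk N t M (Verma N (eps N) k μ) (Verma N (eps N)⁻¹ k μ')
      (Verma.vac N (eps N) k μ ⊗ₜ x ⊗ₜ v') ∈ R := by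
    let P : Submodule ℂ (Verma N (eps N)⁻¹ k μ') :=
      { carrier := {v' | ∀ x, CCorb.mk N t M (Verma N (eps N) k μ) (Verma N (eps N)⁻¹ k μ')
          (Verma.vac N (eps N) k μ ⊗ₜ x ⊗ₜ v') ∈ R}
        add_mem' := fun {v w} hv hw x => by
          rw [TensorProduct.tmul_add, map_add]; exact add_mem (hv x) (hw x)
        zero_mem' := fun x => by rw [TensorProduct.tmul_zero, map_zero]; exact zero_mem _
        smul_mem' := fun c v hv x => by
          rw [TensorProduct.tmul_smul, map_smul]; exact R.smul_mem c (hv x) }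
    have hP : P = ⊤ := Verma.eq_top_of_lie_mem P hR fun b v' hv' x => by
      have := step 0 b _ v' hv' x
      rwa [zero_lie, TensorProduct.zero_tmul, TensorProduct.zero_tmul, map_zero, zero_add] at this
    exact fun v' => (hP ▸ Submodule.mem_top : v' ∈ P)
  have h2 : ∀ v v' x, CCorb.mk N t M (Verma N (eps N) k μ) (Verma N (eps N)⁻¹ k μ')
      (v ⊗ₜ x ⊗ₜ v') ∈ R := by
    intro v v'
    let P : Submodule ℂ (Verma N (eps N) k μ) :=
      { carrier := {v | ∀ x, CCorb.mk N t M (Verma N (eps N) k μ) (Verma N (eps N)⁻¹ k μ')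
          (v ⊗ₜ x ⊗ₜ v') ∈ R}
        add_mem' := fun {v w} hv hw x => by
          rw [TensorProduct.add_tmul, TensorProduct.add_tmul, map_add]; exact add_mem (hv x) (hw x)
        zero_mem' := fun x => by
          rw [TensorProduct.zero_tmul, TensorProduct.zero_tmul, map_zero]; exact zero_mem _
        smul_mem' := fun c v hv x => by
          rw [← TensorProduct.smul_tmul', ← TensorProduct.smul_tmul', map_smul]
          exact R.smul_mem c (hv x) }
    have hP : P = ⊤ := Verma.eq_top_of_lie_mem P (h1 v') fun a v hv x => by
      have := step a 0 v v' hv x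
      rwa [zero_lie, TensorProduct.tmul_zero, map_zero, add_zero] at this
    exact (hP ▸ Submodule.mem_top : v ∈ P)
  refine top_unique fun w _ => ?_
  obtain ⟨u, rfl⟩ := CCorb.mk_surjective w
  induction u using TensorProduct.induction_on with
  | zero => rw [map_zero]; exact zero_mem _
  | add u w hu hw => rw [map_add]; exact add_mem (hu Submodule.mem_top) (hw Submodule.mem_top)
  | tmul u v' =>
    induction u using TensorProduct.induction_on with
    | zero => rw [TensorProduct.zero_tmul, map_zero]; exact zero_mem _
    | add u w hu hw =>
      rw [TensorProduct.add_tmul, map_add]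
      exact add_mem (hu Submodule.mem_top) (hw Submodule.mem_top)
    | tmul v x => exact h2 v v' x

/-- Orbifold coinvariants with Verma modules inserted at `0` and `∞` are a quotient of
`M_1 ⊗ ⋯ ⊗ M_L`. -/
theorem nonempty_vacSpan_quotient_equiv (hN : N ≠ 0) (hL : 1 ≤ L) (ht0 : ∀ i, t i ≠ 0)
    (htne : ∀ i j, i ≠ j → ∀ a : ℕ, t i ≠ (eps N : ℂ) ^ a * t j)
    (hlevel : ∀ (i : Fin L) (v : M i), ⁅(Affine.khat : AffineSl N), v⁆ = k • v)
    (μ μ' : Module.Dual ℂ (cartan N)) :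
    Nonempty (((⨂[ℂ] i, M i) ⧸ vacSpan (sectionAction hN hL ht0 htne hlevel) μ μ') ≃ₗ[ℂ]
      CCorb N t M (Verma N (eps N) k μ) (Verma N (eps N)⁻¹ k μ')) := by
  obtain ⟨Φ, hΦ⟩ := exists_vacSpan_quotient_map hN hL ht0 htne hlevel μ μ'
  -- The projection to the quotient satisfies the transformation law by construction. The resulting
  -- invariant pairing descends to the coinvariants and is a left inverse of `Φ`.
  obtain ⟨B, hB0, hB⟩ := (sectionAction hN hL ht0 htne hlevel).exists_pairing (μ := μ) (μ' := μ')
    (vacSpan (sectionAction hN hL ht0 htne hlevel) μ μ').mkQ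
    fun f H H' hf x => by
      rw [neg_smul, ← add_eq_zero_iff_eq_neg, ← map_smul, ← map_add]
      exact (Submodule.Quotient.mk_eq_zero _).mpr (Submodule.subset_span ⟨f, H, H', hf, x, rfl⟩)
  obtain ⟨Ψ, hΨ⟩ := CCorb.exists_lift B hB
  refine ⟨LinearEquiv.ofBijective Φ ⟨Function.LeftInverse.injective (g := Ψ) fun y => ?_, ?_⟩⟩
  · obtain ⟨x, rfl⟩ := Submodule.Quotient.mk_surjective _ y
    rw [hΦ, hΨ, hB0]
    rfl
  · rw [← LinearMap.range_eq_top]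
    exact CCorb.eq_top_of_vac_mem hN hL ht0 μ μ' _ fun x => ⟨_, hΦ x⟩

end Orbifold

/-! ### Comparison of the trigonometric and the orbifold coinvariants -/

section Values

variable {N L : ℕ} {t : Fin L → ℂ} {f g : meroOrb N} {H H' K K' : cartan N}

theorem Affine.IsRegular.add {𝔏 : LieSubalgebra ℂ (Mat N (LaurentSeries ℂ))} {c : ℂ}
    {x y : Affine 𝔏 c} (hx : x.IsRegular H) (hy : y.IsRegular K) : (x + y).IsRegular (H + K) where
  central := (congrArg₂ (· + ·) hx.central hy.central).trans (add_zero 0)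
  reg i j := add_mem (hx.reg i j) (hy.reg i j)
  coeff i j := HahnSeries.coeff_add.trans (congrArg₂ (· + ·) (hx.coeff i j) (hy.coeff i j))

theorem HasValues.add (hf : HasValues t f H H') (hg : HasValues t g K K') :
    HasValues t (f + g) (H + K) (H' + K') where
  mem := add_mem hf.mem hg.mem
  zero := by rw [germZero_add]; exact hf.zero.add hg.zero
  infty := by rw [germInfty_add]; exact hf.infty.add hg.infty

theorem hasValues_constSec (H : cartan N) : HasValues t (constSec H) H H where
  mem := constSec_mem_gOrb H _
  zero := ⟨rfl, holoAt_constSec H _, fun i j => congrFun (congrFun (valueAt_constSec H _) i) j⟩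
  infty := ⟨rfl, holoAt_constSec H _, fun i j => congrFun (congrFun (valueAt_constSec H _) i) j⟩

theorem HasValues.mem_gTrig (hf : HasValues t f H (adBeta N H)) :
    (f : Mat N (RatFunc ℂ)) ∈ gTrig N (marked N t) := by
  have h0 : HoloAt ((0 : ℂ) : OnePoint ℂ) (f : Mat N (RatFunc ℂ)) := hf.zero.reg
  have h1 : HoloAt OnePoint.infty (f : Mat N (RatFunc ℂ)) := hf.infty.reg
  have e0 : valueAt ((0 : ℂ) : OnePoint ℂ) (f : Mat N (RatFunc ℂ)) = H :=
    Matrix.ext fun i j => hf.zero.coeff i j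
  have e1 : valueAt OnePoint.infty (f : Mat N (RatFunc ℂ)) = adBeta N H :=
    Matrix.ext fun i j => hf.infty.coeff i j
  refine ⟨⟨f.2, fun P hP => ?_⟩, h0, h1, by rw [e0, e1]; rfl⟩
  by_cases hP0 : P = ((0 : ℂ) : OnePoint ℂ)
  · rw [hP0]; exact h0
  by_cases hP1 : P = OnePoint.infty
  · rw [hP1]; exact h1
  · exact hf.mem.2 P fun h => h.elim hP fun h => h.elim hP0 hP1

theorem exists_hasValues_of_mem_gTrig (hf : (f : Mat N (RatFunc ℂ)) ∈ gTrig N (marked N t)) :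
    ∃ H, HasValues t f H (adBeta N H) :=
  ⟨⟨_, valueAt_zero_mem_cartan f⟩,
    ⟨hf.1.1, fun P hP => hf.1.2 P fun h => hP (Or.inl h)⟩, ⟨rfl, hf.2.1, fun _ _ => rfl⟩,
    ⟨rfl, hf.2.2.1, fun i j => congrFun (congrFun hf.2.2.2 i) j⟩⟩

theorem adBeta_adBetaInv (H : cartan N) : adBeta N (adBetaInv N H) = H := by
  refine Subtype.ext (Matrix.ext fun i j => ?_)
  refine (Ad_beta_apply N _ i j).trans ((Ad_beta_inv_apply N _ _ _).trans ?_)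
  rw [Equiv.symm_apply_apply, Equiv.symm_apply_apply]
  rfl

theorem adBetaInv_adBeta (H : cartan N) : adBetaInv N (adBeta N H) = H := by
  refine Subtype.ext (Matrix.ext fun i j => ?_)
  refine (Ad_beta_inv_apply N _ i j).trans ((Ad_beta_apply N _ _ _).trans ?_)
  rw [Equiv.apply_symm_apply, Equiv.apply_symm_apply]
  rfl

theorem oneSubAdBeta_apply (H : cartan N) : oneSubAdBeta N H = H - adBeta N H := rfl

theorem oneSubAdBetaInv_apply (H : cartan N) : oneSubAdBetaInv N H = H - adBetaInv N H := rfl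

/-- The hypothesis says that values $H$ at $0$ and $H'$ at $\infty$ satisfy the gluing condition
after $K$ is subtracted from both. From
$1-\operatorname{Ad}\beta^{-1}=-\operatorname{Ad}\beta^{-1}(1-\operatorname{Ad}\beta)$ follows
$K=(1-\operatorname{Ad}\beta^{-1})^{-1}H+(1-\operatorname{Ad}\beta)^{-1}H'$, which explains the two
shifted weights. -/
theorem tildeWt_add_tildeWt' (lam : Module.Dual ℂ (cartan N)) (H K : cartan N)
    (h : oneSubAdBetaInv N K = H - adBetaInv N H') :
    tildeWt lam H + tildeWt' lam H' = -lam K := by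
  have h1 : K = (oneSubAdBetaInv N).symm H + (oneSubAdBeta N).symm H' := by
    rw [← (oneSubAdBetaInv N).injective.eq_iff, h, map_add, LinearEquiv.apply_symm_apply,
      sub_eq_add_neg]
    congr 1
    obtain ⟨Y, rfl⟩ := (oneSubAdBeta N).surjective H'
    rw [LinearEquiv.symm_apply_apply, oneSubAdBeta_apply, oneSubAdBetaInv_apply, map_sub,
      adBetaInv_adBeta, neg_sub]
  rw [h1, map_add, neg_add]
  rfl

end Values

/-! ### The orbifold relations as trigonometric relations plus weight relations -/

section Comparison

variable {N L : ℕ} {t : Fin L → ℂ} {M : Fin L → Type*} [∀ i, AddCommGroup (M i)]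
  [∀ i, Module ℂ (M i)] [∀ i, LieRingModule (AffineSl N) (M i)]
  [∀ i, LieModule ℂ (AffineSl N) (M i)] {k : ℂ}

/-- A section with values at $0$ and $\infty$ splits into a trigonometric section, whose relation
has scalar zero, and a constant $K$, whose relation has scalar $-\lambda(K)$. -/
theorem vacSpan_tildeWt (hN : N ≠ 0) (hL : 1 ≤ L) (ht0 : ∀ i, t i ≠ 0)
    (htne : ∀ i j, i ≠ j → ∀ a : ℕ, t i ≠ (eps N : ℂ) ^ a * t j)
    (hlevel : ∀ (i : Fin L) (v : M i), ⁅(Affine.khat : AffineSl N), v⁆ = k • v)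
    (lam : Module.Dual ℂ (cartan N)) :
    vacSpan (sectionAction hN hL ht0 htne hlevel) (tildeWt lam) (tildeWt' lam) =
      trigSpan N t M ⊔ Submodule.span ℂ
        {w | ∃ H x, w = actM N t M (constSec H) x - lam H • x} := by
  refine le_antisymm (Submodule.span_le.mpr ?_) (sup_le (Submodule.span_le.mpr ?_)
    (Submodule.span_le.mpr ?_))
  · rintro _ ⟨f, H, H', hf, x, rfl⟩
    -- `K` is the constant part of `f`: it solves $H'-K=\operatorname{Ad}\beta(H-K)$.
    obtain ⟨K, hK⟩ := (oneSubAdBetaInv N).surjective (H - adBetaInv N H')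
    rw [tildeWt_add_tildeWt' lam H K hK, neg_smul]
    have h1 := hf.add (hasValues_constSec (-K))
    have h2 : H' + -K = adBeta N (H + -K) := by
      rw [oneSubAdBetaInv_apply, sub_eq_sub_iff_add_eq_add] at hK
      have h3 : H + -K = adBetaInv N (H' + -K) := by
        rw [map_add, map_neg, ← sub_eq_add_neg, ← sub_eq_add_neg, sub_eq_sub_iff_add_eq_add,
          add_comm (adBetaInv N H'), hK]
      rw [h3, adBeta_adBetaInv]
    rw [h2] at h1
    have h3 := actM_mem_trigSpan (M := M) t h1.mem_gTrig x
    have h4 : actM N t M f = actM N t M (f + constSec (-K)) + actM N t M (constSec K) := by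
      rw [← actM_add, add_assoc]
      congr 1
      have : constSec (-K) + constSec K = 0 := Subtype.ext (Matrix.ext fun i j => by
        change algebraMap ℂ (RatFunc ℂ) (-(K : Mat N ℂ) i j) +
          algebraMap ℂ (RatFunc ℂ) ((K : Mat N ℂ) i j) = 0
        rw [map_neg, neg_add_cancel])
      rw [this, add_zero]
    have h5 : actM N t M f x + -(lam K • x) = actM N t M (f + constSec (-K)) x +
        (actM N t M (constSec K) x - lam K • x) := by
      rw [h4, LinearMap.add_apply]; abel
    change actM N t M f x + -(lam K • x) ∈ _
    rw [h5]
    exact add_mem (Submodule.mem_sup_left h3)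
      (Submodule.mem_sup_right (Submodule.subset_span ⟨K, x, rfl⟩))
  · rintro _ ⟨f, hf, x, rfl⟩
    obtain ⟨H, hH⟩ := exists_hasValues_of_mem_gTrig hf
    refine Submodule.subset_span ⟨f, H, _, hH, x, ?_⟩
    rw [tildeWt_add_tildeWt' lam H 0 (by rw [map_zero, adBetaInv_adBeta, sub_self]), map_zero,
      neg_zero, zero_smul, add_zero]
    rfl
  · rintro _ ⟨H, x, rfl⟩
    refine Submodule.subset_span ⟨constSec H, H, H, hasValues_constSec H, x, ?_⟩
    rw [tildeWt_add_tildeWt' lam H H rfl, neg_smul, ← sub_eq_add_neg]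
    rfl

/-- Taking the quotient by $\mathfrak g^{\rm trig}_{\rm out}M$ and then by the weight relations is
taking it by their sum, which is the space of orbifold relations. -/
theorem nonempty_wtCoinv_equiv_CCorb (hN : N ≠ 0) (hL : 1 ≤ L) (ht0 : ∀ i, t i ≠ 0)
    (htne : ∀ i j, i ≠ j → ∀ a : ℕ, t i ≠ (eps N : ℂ) ^ a * t j)
    (hlevel : ∀ (i : Fin L) (v : M i), ⁅(Affine.khat : AffineSl N), v⁆ = k • v)
    (lam : Module.Dual ℂ (cartan N)) :
    Nonempty ((((⨂[ℂ] i, M i) ⧸ trigSpan N t M) ⧸ wtCoinv (cartanCC t hlevel) lam) ≃ₗ[ℂ]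
      CCorb N t M (Verma N (eps N) k (tildeWt lam)) (Verma N (eps N)⁻¹ k (tildeWt' lam))) := by
  obtain ⟨e⟩ := nonempty_vacSpan_quotient_equiv hN hL ht0 htne hlevel (tildeWt lam) (tildeWt' lam)
  have h := vacSpan_tildeWt hN hL ht0 htne hlevel lam
  have hle : trigSpan N t M ≤
      vacSpan (sectionAction hN hL ht0 htne hlevel) (tildeWt lam) (tildeWt' lam) :=
    h ▸ le_sup_left
  have hmap : wtCoinv (cartanCC t hlevel) lam = (vacSpan (sectionAction hN hL ht0 htne hlevel)
      (tildeWt lam) (tildeWt' lam)).map (trigSpan N t M).mkQ := by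
    rw [h, Submodule.map_sup, Submodule.mkQ_map_self, bot_sup_eq, Submodule.map_span, wtCoinv]
    congr 1
    ext y
    constructor
    · rintro ⟨H, x, rfl⟩
      obtain ⟨x, rfl⟩ := Submodule.Quotient.mk_surjective _ x
      exact ⟨_, ⟨H, x, rfl⟩, rfl⟩
    · rintro ⟨_, ⟨H, x, rfl⟩, rfl⟩
      exact ⟨H, Submodule.Quotient.mk x, rfl⟩
  exact ⟨Submodule.quotEquivOfEq _ _ hmap ≪≫ₗ
    Submodule.quotientQuotientEquivQuotient _ _ hle ≪≫ₗ e⟩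

end Comparison

/-! ### The weights of V and the surjection onto the trigonometric coinvariants -/

section Weights

theorem commute_of_iSup_wtSpace {𝔞 X : Type*} [AddCommGroup 𝔞] [Module ℂ 𝔞] [AddCommGroup X]
    [Module ℂ X] {T : 𝔞 → Module.End ℂ X} {S : Set (Module.Dual ℂ 𝔞)}
    (hS : ⨆ lam : S, wtSpace T lam = ⊤) (H K : 𝔞) : Commute (T H) (T K) := by
  refine LinearMap.ext fun x => ?_
  have hx : x ∈ ⨆ lam : S, wtSpace T lam := hS ▸ Submodule.mem_top
  induction hx using Submodule.iSup_induction' with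
  | mem lam x hx =>
    rw [Module.End.mul_apply, Module.End.mul_apply, mem_wtSpace.mp hx, mem_wtSpace.mp hx, map_smul,
      map_smul, mem_wtSpace.mp hx, mem_wtSpace.mp hx, smul_comm]
  | zero => rw [map_zero, map_zero]
  | add x y _ _ hx hy => rw [map_add, map_add, hx, hy]

/-- Constant loops, as a homomorphism of Lie algebras. -/
def constPlus (N : ℕ) : sl N ℂ →ₗ⁅ℂ⁆ affinePlus N where
  toFun A := ⟨Affine.ofLoop ⟨constLoop (A : Mat N ℂ), constLoop_mem_sl A.2⟩,
    fun i j => regular.algebraMap_mem ((A : Mat N ℂ) i j)⟩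
  map_add' A B := Subtype.ext <| Affine.ext'
    (fun _ _ => map_add (algebraMap ℂ (LaurentSeries ℂ)) _ _) (add_zero (0 : ℂ)).symm
  map_smul' c A := Subtype.ext <| Affine.ext'
    (fun _ _ => map_smul (Algebra.ofId ℂ (LaurentSeries ℂ)) c _) (mul_zero c).symm
  map_lie' {A B} := Subtype.ext <| Affine.ext' (fun i j => by
      have h : constLoop ((A : Mat N ℂ) * (B : Mat N ℂ) - (B : Mat N ℂ) * (A : Mat N ℂ)) =
          constLoop (A : Mat N ℂ) * constLoop (B : Mat N ℂ) - constLoop (B : Mat N ℂ) *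
            constLoop (A : Mat N ℂ) := by
        rw [constLoop, map_sub, map_mul, map_mul]; rfl
      exact congrFun (congrFun h i) j) <| by
    change (0 : ℂ) = cocycle 1 (constLoop (A : Mat N ℂ)) (constLoop (B : Mat N ℂ))
    have : matD (constLoop (A : Mat N ℂ)) = 0 := Matrix.ext fun i j => D_C _
    rw [cocycle, this, zero_mul, Matrix.trace_zero, map_zero, mul_zero]

variable {N L : ℕ} {t : Fin L → ℂ} {M : Fin L → Type*} [∀ i, AddCommGroup (M i)]
  [∀ i, Module ℂ (M i)] [∀ i, LieRingModule (AffineSl N) (M i)]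
  [∀ i, LieModule ℂ (AffineSl N) (M i)] {k : ℂ} (V : ∀ i, LieSubmodule ℂ (affinePlus N) (M i))

/-- The action of the Cartan subalgebra on `V_1 ⊗ ⋯ ⊗ V_L`. -/
def cartanAct (H : cartan N) : Module.End ℂ (⨂[ℂ] i, V i) :=
  ∑ i, actFactor (W := fun i => V i) i
    (LieModule.toEnd ℂ (affinePlus N) (V i) (cartanPlus N H))

theorem weights_eq : weights V = {lam | wtSpace (cartanAct V) lam ≠ ⊥} := by
  ext lam
  rw [Set.mem_ofPred_eq, Submodule.ne_bot_iff]
  exact ⟨fun ⟨v, h0, h⟩ => ⟨v, mem_wtSpace.mpr h, h0⟩, fun ⟨v, h, h0⟩ => ⟨v, h0, mem_wtSpace.mp h⟩⟩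

/-- Constant loops make each `V i` a finite-dimensional $\mathfrak{sl}_N$-module, so every factor is
a sum of weight spaces. -/
theorem iSup_wtSpace_cartanAct [∀ i, FiniteDimensional ℂ (V i)] :
    ⨆ lam : weights V, wtSpace (cartanAct V) lam = ⊤ := by
  rw [weights_eq]
  refine iSup_wtSpace_ne_bot _ (iSup_wtSpace_tensor (W := fun i => V i)
    (fun i H => LieModule.toEnd ℂ (affinePlus N) (V i) (cartanPlus N H)) fun i => ?_)
  exact iSup_wtSpace_sl ((LieModule.toEnd ℂ (affinePlus N) (V i)).comp (constPlus N))

/-- Distinct weights have independent weight spaces, and a finite-dimensional space holds only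
finitely many independent nonzero subspaces. -/
theorem weights_finite [∀ i, FiniteDimensional ℂ (V i)] : (weights V).Finite := by
  have h := iSup_wtSpace_cartanAct V
  rw [weights_eq]
  exact WellFoundedGT.finite_ne_bot_of_iSupIndep
    (iSupIndep_wtSpace (commute_of_iSup_wtSpace h))

variable (t) in
/-- The map `V_1 ⊗ ⋯ ⊗ V_L → M / g_out^trig M`. -/
def toCC : (⨂[ℂ] i, V i) →ₗ[ℂ] (⨂[ℂ] i, M i) ⧸ trigSpan N t M :=
  (trigSpan N t M).mkQ ∘ₗ PiTensorProduct.map fun i => (V i).toSubmodule.subtype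

theorem toCC_surjective (hN : N ≠ 0) (ht0 : ∀ i, t i ≠ 0)
    (htne : ∀ i j, i ≠ j → ∀ a : ℕ, t i ≠ (eps N : ℂ) ^ a * t j)
    (hVgen : ∀ i, LieSubmodule.lieSpan ℂ (AffineSl N) (V i : Set (M i)) = ⊤) :
    Function.Surjective (toCC t V) := by
  have h := range_sup_trigSpan_eq_top hN ht0 htne V hVgen
  rw [← LinearMap.range_eq_top, toCC, LinearMap.range_comp]
  have h1 := congrArg (Submodule.map (trigSpan N t M).mkQ) h
  rwa [Submodule.map_sup, Submodule.mkQ_map_self, sup_bot_eq, Submodule.map_top,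
    Submodule.range_mkQ] at h1

theorem germ_constSec (c : ℂ) (H : cartan N) :
    germ N c (constSec H) = (cartanPlus N H : AffineSl N) :=
  Affine.ext' (fun _ _ => expand_algebraMap _ _) rfl

/-- The germ of a constant section at every marked point is the constant loop. Equivariance then
carries the weight decomposition of $V$ over to the coinvariants. -/
theorem toCC_cartanAct
    (hlevel : ∀ (i : Fin L) (v : M i), ⁅(Affine.khat : AffineSl N), v⁆ = k • v) (H : cartan N)
    (x : ⨂[ℂ] i, V i) : toCC t V (cartanAct V H x) = cartanCC t hlevel H (toCC t V x) := by
  have h : (PiTensorProduct.map fun i => (V i).toSubmodule.subtype) ∘ₗ cartanAct V H =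
      actM N t M (constSec H) ∘ₗ PiTensorProduct.map fun i => (V i).toSubmodule.subtype := by
    refine PiTensorProduct.ext (MultilinearMap.ext fun x => ?_)
    change PiTensorProduct.map (fun i => (V i).toSubmodule.subtype)
        (cartanAct V H (PiTensorProduct.tprod ℂ x)) = actM N t M (constSec H)
        (PiTensorProduct.map (fun i => (V i).toSubmodule.subtype) (PiTensorProduct.tprod ℂ x))
    rw [PiTensorProduct.map_tprod, cartanAct, actM, LinearMap.sum_apply, LinearMap.sum_apply,
      map_sum]
    refine Finset.sum_congr rfl fun i _ => ?_
    refine (congrArg _ (actFactor_tprod i _ x)).trans ?_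
    rw [actFactor_tprod]
    refine (PiTensorProduct.map_tprod _ _).trans (congrArg _ (funext fun j => ?_))
    by_cases hj : j = i
    · subst hj
      rw [Function.update_self, Function.update_self, germ_constSec]
      rfl
    · rw [Function.update_of_ne hj, Function.update_of_ne hj]
  exact congrArg (trigSpan N t M).mkQ (LinearMap.congr_fun h x)

end Weights

end TrigWZW

end

/-! ### The theorem -/

theorem mainTheorem2 (N L : ℕ) (hN : 2 ≤ N) (hL : 1 ≤ L)
    (t : Fin L → ℂ) (ht0 : ∀ i, t i ≠ 0)
    (htne : ∀ i j, i ≠ j → ∀ a : ℕ, t i ≠ (TrigWZW.eps N : ℂ) ^ a * t j)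
    (k : ℂ)
    (M : Fin L → Type*) [∀ i, AddCommGroup (M i)] [∀ i, Module ℂ (M i)]
    [∀ i, LieRingModule (TrigWZW.AffineSl N) (M i)]
    [∀ i, LieModule ℂ (TrigWZW.AffineSl N) (M i)]
    (hlevel : ∀ (i : Fin L) (v : M i), ⁅(TrigWZW.Affine.khat : TrigWZW.AffineSl N), v⁆ = k • v)
    (V : ∀ i, LieSubmodule ℂ (TrigWZW.affinePlus N) (M i))
    (hVfin : ∀ i, FiniteDimensional ℂ (V i))
    (hVgen : ∀ i, LieSubmodule.lieSpan ℂ (TrigWZW.AffineSl N) (V i : Set (M i)) = ⊤) :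
    (TrigWZW.weights V).Finite ∧
    FiniteDimensional ℂ (TrigWZW.CCtrig N t M) ∧
    Nonempty (TrigWZW.CCtrig N t M ≃ₗ[ℂ]
      DirectSum (TrigWZW.weights V) fun lam =>
        TrigWZW.CCorb N t M
          (TrigWZW.Verma N (TrigWZW.eps N) k (TrigWZW.tildeWt lam))
          (TrigWZW.Verma N (TrigWZW.eps N)⁻¹ k (TrigWZW.tildeWt' lam))) := by
  have hN0 : N ≠ 0 := by omega
  have hq := TrigWZW.toCC_surjective V hN0 ht0 htne hVgen
  have hS := TrigWZW.wtSpace_iSup_eq_top_of_surjective (TrigWZW.toCC t V) hq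
    (TrigWZW.toCC_cartanAct V hlevel) (TrigWZW.iSup_wtSpace_cartanAct V)
  obtain ⟨e⟩ := TrigWZW.nonempty_equiv_directSum_wtCoinv (TrigWZW.cartanCC t hlevel)
    (TrigWZW.weights V) (TrigWZW.commute_of_iSup_wtSpace hS) hS
  have he := TrigWZW.nonempty_wtCoinv_equiv_CCorb hN0 hL ht0 htne hlevel
  refine ⟨TrigWZW.weights_finite V, ?_, ?_⟩
  · exact Module.Finite.of_surjective (TrigWZW.toCC t V) hq
  · exact ⟨e.trans (DFinsupp.mapRange.linearEquiv fun lam => (he lam).some)⟩
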